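/- Let $n\ge 1$ and let $a\in C^\infty(\mathbb{R}_+,\mathrm{GL}(n))\cap C([0,\infty),\mathrm{GL}(n))$, where $\mathbb{R}_+=(0,\infty)$, be real matrix-valued with $a(t)$ symmetric positive definite for every $t>0$. Put $\mathcal{L}_t=\sum_{i,j=1}^n a_{ij}(t)\,\partial^2_{x_ix_j}$ (acting on tempered distributions), $A(t)=\int_0^t a(s)\,ds$ and, for $0\le s<t$ and $x\in\mathbb{R}^n$, $$\mathcal{W}(x;s,t)=\frac{1}{\sqrt{(4\pi)^n\det[A(t)-A(s)]}}\;e^{-\frac14\langle x,[A(t)-A(s)]^{-1}x\rangle}.$$ Let $\mathrm{W}_{s,t}v=\mathcal{W}(\cdot\,;s,t)*v$ for $0\le s<t$ and $\mathrm{W}_{t,t}v=v$. Let $q\in[1,\infty]$, let $L^q=L^q(\mathbb{R}^n;\mathbb{C})$, and let $u_0\in L^q$ and $f\in C^\infty(\mathbb{R}_+,L^q)\cap C([0,\infty),L^q)$. Then: 1. For all $0\le s<t$ and $v\in L^q$, the integral defining $(\mathcal{W}(\cdot\,;s,t)*v)(x)$ converges absolutely for every $x$ and $\mathrm{W}_{s,t}v\in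 L^q$; and for every $t\ge0$ the function $s\mapsto \mathrm{W}_{s,t}f(s)$ is Bochner integrable on $[0,t]$ with values in $L^q$. Hence $$u(t)=\mathrm{W}_{0,t}u_0+\int_0^t \mathrm{W}_{s,t}f(s)\,ds,\qquad t\ge 0,$$ is well defined in $L^q$. 2. $u\in C^\infty(\mathbb{R}_+,L^q)$, and for every $t>0$ one has $\partial_t u(t)-\mathcal{L}_tu(t)=f(t)$, where $\partial_t u(t)$ is the derivative in the norm of $L^q$, the space derivatives are taken in the sense of distributions, and the equality holds in $\mathcal{S}'(\mathbb{R}^n)$. 3. If $q<\infty$, then $\lim_{t\to0+}u(t)=u_0$ in $L^q$ and $u\in C([0,\infty),L^q)$, so that $u$ solves the Cauchy problem $$\partial_t u(t)-\mathcal{L}_tu(t)=f(t)\quad(t>0),\qquad \lim_{t\to0+}u(t)=u_0 .$$ If $q=\infty$, the initial condition is attained in the weak-$*$ sense: $\lim_{t\to0+}\int_{\mathbb{R}^n} u(t)\varphi\,dx=\int_{\mathbb{R}^n} u_0\varphi\,dx$ for every $\varphi\in L^1(\mathbb{R}^n)$. 4. $\|u(t)\|_q\le\|u_0\|_q+\int_0^t\|f(s)\|_q\,ds$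 for all $t\ge0$. 5. If $1<q<\infty$, the solution is unique: every $v:\mathbb{R}_+\to L^q$ that is differentiable in the norm of $L^q$, satisfies $\partial_tv(t)-\mathcal{L}_tv(t)=f(t)$ in the above sense for all $t>0$, and satisfies $\lim_{t\to0+}v(t)=u_0$ in $L^q$, coincides with $u$ on $\mathbb{R}_+$. 6. If $u_0\ge0$ and $f(t)\ge0$ for all $t>0$ (almost everywhere on $\mathbb{R}^n$), then $u(t)\ge0$ almost everywhere for all $t\ge0$. -/

import Mathlib

open MeasureTheory Set Filter Topology
open scoped ENNReal ContDiff SchwartzMap LineDeriv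

noncomputable section

/-- A matrix-valued diffusivity `a ∈ C^∞((0,∞), GL(n)) ∩ C([0,∞), GL(n))`, symmetric and positive
definite at every positive time (smoothness and continuity are read entrywise). -/
structure IsDiffusivity {n : ℕ} (a : ℝ → Matrix (Fin n) (Fin n) ℝ) : Prop where
  contDiffOn : ∀ i j, ContDiffOn ℝ ∞ (fun t => a t i j) (Ioi 0)
  continuousOn : ∀ i j, ContinuousOn (fun t => a t i j) (Ici 0)
  posDef : ∀ t, 0 < t → (a t).PosDef
  isUnit_zero : IsUnit (a 0)

/-- `A(t) = ∫₀ᵗ a(r) dr`, entrywise. -/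
def cumulativeDiffusivity {n : ℕ} (a : ℝ → Matrix (Fin n) (Fin n) ℝ) (t : ℝ) :
    Matrix (Fin n) (Fin n) ℝ :=
  Matrix.of fun i j => ∫ r in (0 : ℝ)..t, a r i j

/-- The heat kernel
`𝒲(x; s, t) = ((4π)^n det[A(t) - A(s)])^(-1/2) exp(-¼ ⟨x, [A(t) - A(s)]⁻¹ x⟩)`. -/
def heatKernel {n : ℕ} (a : ℝ → Matrix (Fin n) (Fin n) ℝ) (s t : ℝ)
    (x : EuclideanSpace ℝ (Fin n)) : ℝ :=
  1 / √((4 * Real.pi) ^ n * (cumulativeDiffusivity a t - cumulativeDiffusivity a s).det) *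
    Real.exp (-(1 / 4) * (x.ofLp ⬝ᵥ
      ((cumulativeDiffusivity a t - cumulativeDiffusivity a s)⁻¹.mulVec x.ofLp)))

/-- The convolution `(𝒲(·; s, t) ∗ v)(x) = ∫ 𝒲(x - y; s, t) v(y) dy`. -/
def heatConvolution {n : ℕ} (a : ℝ → Matrix (Fin n) (Fin n) ℝ) (s t : ℝ)
    (v : EuclideanSpace ℝ (Fin n) → ℂ) (x : EuclideanSpace ℝ (Fin n)) : ℂ :=
  ∫ y, (heatKernel a s t (x - y) : ℂ) * v y

open Classical in
/-- The operator `W_{s,t}` on `L^q(ℝⁿ)`, for `0 ≤ s ≤ t`: convolution with `𝒲(·; s, t)` if `s < t`,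
and the identity if `s = t`. (That the convolution does lie in `L^q` is part of the theorem;
the value `0` below is never taken for `0 ≤ s`.) -/
def heatOperator {n : ℕ} {q : ℝ≥0∞} (a : ℝ → Matrix (Fin n) (Fin n) ℝ) (s t : ℝ)
    (v : Lp ℂ q (volume : Measure (EuclideanSpace ℝ (Fin n)))) :
    Lp ℂ q (volume : Measure (EuclideanSpace ℝ (Fin n))) :=
  if s < t then
    if h : MemLp (heatConvolution a s t v) q volume then h.toLp (heatConvolution a s t v) else 0
  else v

/-- The Duhamel formula `u(t) = W_{0,t} u₀ + ∫₀ᵗ W_{s,t} f(s) ds`, the integral being a Bochner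
integral in `L^q(ℝⁿ)`. -/
def duhamel {n : ℕ} {q : ℝ≥0∞} [Fact (1 ≤ q)] (a : ℝ → Matrix (Fin n) (Fin n) ℝ)
    (u₀ : Lp ℂ q (volume : Measure (EuclideanSpace ℝ (Fin n))))
    (f : ℝ → Lp ℂ q (volume : Measure (EuclideanSpace ℝ (Fin n)))) (t : ℝ) :
    Lp ℂ q (volume : Measure (EuclideanSpace ℝ (Fin n))) :=
  heatOperator a 0 t u₀ + ∫ s in (0 : ℝ)..t, heatOperator a s t (f s)

/-- The operator `∑_{i,j} b_{ij} ∂²_{x_i x_j}` on tempered distributions; `ℒ_t` is the case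
`b = a(t)`. -/
def secondOrderOperator {n : ℕ} (b : Matrix (Fin n) (Fin n) ℝ)
    (T : 𝓢'(EuclideanSpace ℝ (Fin n), ℂ)) : 𝓢'(EuclideanSpace ℝ (Fin n), ℂ) :=
  ∑ i, ∑ j, (b i j : ℂ) •
    ∂_{(EuclideanSpace.single i (1 : ℝ) : EuclideanSpace ℝ (Fin n))}
      (∂_{(EuclideanSpace.single j (1 : ℝ) : EuclideanSpace ℝ (Fin n))} T)

/-- `u : (0,∞) → L^q(ℝⁿ)` solves `∂ₜ u(t) - ℒ_t u(t) = f(t)` for all `t > 0`: the time derivative is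
the derivative in the norm of `L^q`, and the space derivatives are distributional. -/
def SolvesHeatEquation {n : ℕ} {q : ℝ≥0∞} [Fact (1 ≤ q)] (a : ℝ → Matrix (Fin n) (Fin n) ℝ)
    (f u : ℝ → Lp ℂ q (volume : Measure (EuclideanSpace ℝ (Fin n)))) : Prop :=
  ∀ t, 0 < t → ∃ u' : Lp ℂ q (volume : Measure (EuclideanSpace ℝ (Fin n))),
    HasDerivAt u u' t ∧
      Lp.toTemperedDistribution u' - secondOrderOperator (a t) (Lp.toTemperedDistribution (u t)) =
        Lp.toTemperedDistribution (f t)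

/-- `u` solves the Cauchy problem `∂ₜ u - ℒ_t u = f` on `(0,∞)`, `lim_{t → 0+} u(t) = u₀`, the limit
being taken in the norm of `L^q`. -/
def SolvesCauchyProblem {n : ℕ} {q : ℝ≥0∞} [Fact (1 ≤ q)] (a : ℝ → Matrix (Fin n) (Fin n) ℝ)
    (u₀ : Lp ℂ q (volume : Measure (EuclideanSpace ℝ (Fin n))))
    (f u : ℝ → Lp ℂ q (volume : Measure (EuclideanSpace ℝ (Fin n)))) : Prop :=
  SolvesHeatEquation a f u ∧ Tendsto u (𝓝[>] 0) (𝓝 u₀)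

/-- `v ∈ L^q` is real and nonnegative almost everywhere. -/
def IsNonnegLp {n : ℕ} {q : ℝ≥0∞}
    (v : Lp ℂ q (volume : Measure (EuclideanSpace ℝ (Fin n)))) : Prop :=
  ∀ᵐ x, 0 ≤ (v x).re ∧ (v x).im = 0

end

/-! For `s < t` the operator `W_{s,t}` is convolution with an even Gaussian probability density
determined by the matrix `A(t) - A(s)`. Young's inequality makes it a contraction of every `L^q`,
which gives the convergence of the Duhamel integral and the norm estimate; positivity of the density
gives positivity of the solution.

The remaining claims come from viewing the kernel as a curve in `L¹`. Convolution is a bounded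
bilinear map `L¹ × L^q → L^q` (`convCLM`), so regularity of the kernel in `t` passes to the
operators for all `q` at once. The Gaussian is a `C^∞` function of its matrix `N` with values in
`L¹` (`contDiffOn_heatL1`), and its derivative along a curve of matrices is `∑ N'_{ij} ∂_i ∂_j` of
the Gaussian (`hasDerivAt_heatL1_curve`).

The main difficulty is smoothness of the Duhamel integral, since the kernel degenerates at `s = t`.
The integral is cut at some `δ < t`. Before `δ` the kernel is nondegenerate and continuity of `f`
suffices. After `δ` put `s = δ + θ(t - δ)`; then `A(t) - A(s) = (1 - θ)(t - δ) M`, where `M` is the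
mean of `a` over `[s, t]`, smooth and positive definite up to `s = t`. Gaussian scaling turns the
factor `1 - θ` into the dilation of `L¹` by `√(1 - θ)`, a contraction that does not depend on `t`.
Differentiation under the integral sign is then legitimate to all orders
(`contDiffOn_parametric_integral`).

Once `u` is known to be differentiable in norm, its derivative need only be identified weakly.
Tested against a Schwartz function `φ`, the operator `ℒ_t` falls on `φ`, and the right difference
quotients converge thanks to a Lipschitz bound uniform in `s`
(`IsDiffusivity.tendsto_slope_testCLM`).

The initial condition is an approximate identity argument: in norm for `q < ∞` by continuity of
translations, weak-* for `q = ∞` by duality with `L¹`. For uniqueness, if `w` solves the homogeneous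
problem then `W_{t,T} w(t)` is constant on `(0, T)`, with limit `0` at `0` and `w(T)` at `T`. -/

/-- The Euclidean space `ℝⁿ`. -/
abbrev Eucl (n : ℕ) := EuclideanSpace ℝ (Fin n)

/-- Hölder's inequality in the form of Jensen's inequality for the measure `k dν`, integrated. -/
theorem lintegral_rpow_lintegral_mul_le {α β : Type*} [MeasurableSpace α] [MeasurableSpace β]
    {μ : Measure α} {ν : Measure β} [SFinite μ] [SFinite ν] {p : ℝ} (hp : 1 ≤ p)
    {k : β → ℝ≥0∞} (hk : AEMeasurable k ν) {F : α → β → ℝ≥0∞}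
    (hF : AEMeasurable (Function.uncurry F) (μ.prod ν)) :
    ∫⁻ x, (∫⁻ y, k y * F x y ∂ν) ^ p ∂μ ≤
      (∫⁻ y, k y ∂ν) ^ (p - 1) * ∫⁻ y, k y * ∫⁻ x, F x y ^ p ∂μ ∂ν := by
  have hp0 : 0 < p := by linarith
  have hpi : p⁻¹ ≤ 1 := inv_le_one_of_one_le₀ hp
  have hkF : AEMeasurable (fun z : α × β => k z.2 * F z.1 z.2 ^ p) (μ.prod ν) :=
    (hk.comp_snd).mul (hF.pow_const p)
  have key : ∀ᵐ x ∂μ, (∫⁻ y, k y * F x y ∂ν) ^ p ≤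
      (∫⁻ y, k y ∂ν) ^ (p - 1) * ∫⁻ y, k y * F x y ^ p ∂ν := by
    have hae : ∀ᵐ x ∂μ, AEMeasurable (fun y => k y * F x y ^ p) ν := by
      obtain ⟨G, hG, hGe⟩ := hkF
      filter_upwards [Measure.ae_ae_of_ae_prod hGe] with x hx
      exact ⟨fun y => G (x, y), hG.comp measurable_prodMk_left, hx⟩
    filter_upwards [hae] with x hx
    -- Hölder with the weights `1 - 1/p` and `1/p`, applied to the factorization `k F = k^(1 - 1/p)
    -- (k F^p)^(1/p)`; this form includes `p = 1`.
    have h1 := ENNReal.lintegral_mul_norm_pow_le hk hx (sub_nonneg.2 hpi) (inv_nonneg.2 hp0.le)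
      (by ring)
    have h2 : ∀ y, k y ^ (1 - p⁻¹) * (k y * F x y ^ p) ^ p⁻¹ = k y * F x y := by
      intro y
      rw [ENNReal.mul_rpow_of_nonneg _ _ (inv_nonneg.2 hp0.le), ← mul_assoc,
        ← ENNReal.rpow_add_of_nonneg _ _ (sub_nonneg.2 hpi) (inv_nonneg.2 hp0.le),
        ← ENNReal.rpow_mul, mul_inv_cancel₀ hp0.ne']
      simp
    simp only [h2] at h1
    calc (∫⁻ y, k y * F x y ∂ν) ^ p
        ≤ ((∫⁻ y, k y ∂ν) ^ (1 - p⁻¹) * (∫⁻ y, k y * F x y ^ p ∂ν) ^ p⁻¹) ^ p :=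
          ENNReal.rpow_le_rpow h1 hp0.le
      _ = _ := by
          rw [ENNReal.mul_rpow_of_nonneg _ _ hp0.le, ← ENNReal.rpow_mul, ← ENNReal.rpow_mul,
            inv_mul_cancel₀ hp0.ne', ENNReal.rpow_one]
          congr 2
          field_simp
  calc ∫⁻ x, (∫⁻ y, k y * F x y ∂ν) ^ p ∂μ
      ≤ ∫⁻ x, (∫⁻ y, k y ∂ν) ^ (p - 1) * ∫⁻ y, k y * F x y ^ p ∂ν ∂μ := lintegral_mono_ae key
    _ = (∫⁻ y, k y ∂ν) ^ (p - 1) * ∫⁻ x, ∫⁻ y, k y * F x y ^ p ∂ν ∂μ :=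
        lintegral_const_mul'' _ hkF.lintegral_prod_right'
    _ = (∫⁻ y, k y ∂ν) ^ (p - 1) * ∫⁻ y, ∫⁻ x, k y * F x y ^ p ∂μ ∂ν := by
        rw [lintegral_lintegral_swap hkF]
    _ = _ := by
        congr 1
        have hae : ∀ᵐ y ∂ν, AEMeasurable (fun x => F x y ^ p) μ := by
          obtain ⟨G, hG, hGe⟩ := (hF.pow_const p).prod_swap
          filter_upwards [Measure.ae_ae_of_ae_prod hGe] with y hy
          exact ⟨fun x => G (y, x), hG.comp measurable_prodMk_left, hy⟩
        refine lintegral_congr_ae ?_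
        filter_upwards [hae] with y hy
        exact lintegral_const_mul'' _ hy

/-! ### Young's inequality and convolution as a bounded bilinear map. -/

section Convolution

variable {n : ℕ} {q q' : ℝ≥0∞}

/-- The convolution `(k ∗ v)(x) = ∫ k(x - y) v(y) dy`. -/
noncomputable def convFun (k v : Eucl n → ℂ) (x : Eucl n) : ℂ := ∫ y, k (x - y) * v y

theorem aestronglyMeasurable_conv_integrand {k v : Eucl n → ℂ}
    (hk : AEStronglyMeasurable k) (hv : AEStronglyMeasurable v) :
    AEStronglyMeasurable (fun p : Eucl n × Eucl n => k (p.1 - p.2) * v p.2)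
      ((volume : Measure (Eucl n)).prod volume) :=
  (hv.convolution_integrand (ContinuousLinearMap.mul ℝ ℂ) hk).congr
    (Eventually.of_forall fun p => by simp [mul_comm])

theorem aestronglyMeasurable_conv_integrand_right {k v : Eucl n → ℂ}
    (hk : AEStronglyMeasurable k) (hv : AEStronglyMeasurable v) (x : Eucl n) :
    AEStronglyMeasurable (fun y => k (x - y) * v y) :=
  hk.convolution_integrand_swap_snd (ContinuousLinearMap.mul ℝ ℂ) hv x

theorem aestronglyMeasurable_convFun {k v : Eucl n → ℂ}
    (hk : AEStronglyMeasurable k) (hv : AEStronglyMeasurable v) :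
    AEStronglyMeasurable (convFun k v) :=
  (aestronglyMeasurable_conv_integrand hk hv).integral_prod_right'

theorem aemeasurable_lintegral_conv {k v : Eucl n → ℂ}
    (hk : AEStronglyMeasurable k) (hv : AEStronglyMeasurable v) :
    AEMeasurable (fun x => ∫⁻ y, ‖k (x - y) * v y‖ₑ) :=
  (aestronglyMeasurable_conv_integrand hk hv).enorm.lintegral_prod_right'

/-- Young's inequality `‖|k| ∗ |v|‖_q ≤ ‖k‖₁ ‖v‖_q`. -/
theorem eLpNorm_lintegral_conv_le {k v : Eucl n → ℂ} (hq : 1 ≤ q)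
    (hk : AEStronglyMeasurable k) (hv : AEStronglyMeasurable v) :
    eLpNorm (fun x => ∫⁻ y, ‖k (x - y) * v y‖ₑ) q volume ≤
      eLpNorm k 1 volume * eLpNorm v q volume := by
  rw [eLpNorm_one_eq_lintegral_enorm]
  rcases eq_or_ne q ⊤ with rfl | hqt
  · rw [eLpNorm_exponent_top, eLpNorm_exponent_top]
    refine eLpNormEssSup_le_of_ae_enorm_bound (Eventually.of_forall fun x => ?_)
    rw [enorm_eq_self]
    calc ∫⁻ y, ‖k (x - y) * v y‖ₑ ≤ ∫⁻ y, ‖k (x - y)‖ₑ * eLpNormEssSup v volume := by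
          refine lintegral_mono_ae ?_
          filter_upwards [enorm_ae_le_eLpNormEssSup v volume] with y hy
          rw [enorm_mul]
          gcongr
      _ = (∫⁻ y, ‖k (x - y)‖ₑ) * eLpNormEssSup v volume :=
          lintegral_mul_const'' _ (hk.comp_quasiMeasurePreserving
            (quasiMeasurePreserving_sub_left_of_right_invariant _ x)).enorm
      _ = _ := by rw [lintegral_sub_left_eq_self (fun y => ‖k y‖ₑ) x]
  · have hq0 : q ≠ 0 := (zero_lt_one.trans_le hq).ne'
    have hp : 1 ≤ q.toReal := by
      rw [← ENNReal.toReal_one]; exact (ENNReal.toReal_le_toReal ENNReal.one_ne_top hqt).2 hq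
    have hp0 : 0 < q.toReal := by linarith
    rw [eLpNorm_eq_lintegral_rpow_enorm_toReal hq0 hqt, eLpNorm_eq_lintegral_rpow_enorm_toReal hq0 hqt]
    simp only [enorm_eq_self]
    rw [one_div, ENNReal.rpow_inv_le_iff hp0, ENNReal.mul_rpow_of_nonneg _ _ hp0.le,
      ← ENNReal.rpow_mul, inv_mul_cancel₀ hp0.ne', ENNReal.rpow_one]
    -- After `y ↦ x - y` the weight `‖k y‖ₑ` no longer depends on `x`, as
    -- `lintegral_rpow_lintegral_mul_le` requires.
    have hsub : ∀ x, ∫⁻ y, ‖k (x - y) * v y‖ₑ = ∫⁻ y, ‖k y‖ₑ * ‖v (x - y)‖ₑ := by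
      intro x
      rw [← lintegral_sub_left_eq_self _ x]
      simp [enorm_mul]
    simp only [hsub]
    have hF : AEMeasurable (Function.uncurry fun x y : Eucl n => ‖v (x - y)‖ₑ)
        ((volume : Measure (Eucl n)).prod volume) :=
      (hv.comp_quasiMeasurePreserving
        (quasiMeasurePreserving_sub_of_right_invariant volume volume)).enorm
    refine (lintegral_rpow_lintegral_mul_le hp hk.enorm hF).trans (le_of_eq ?_)
    have hinv : ∀ y, ∫⁻ x, ‖v (x - y)‖ₑ ^ q.toReal = ∫⁻ x, ‖v x‖ₑ ^ q.toReal :=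
      fun y => lintegral_sub_right_eq_self (fun x => ‖v x‖ₑ ^ q.toReal) y
    simp only [hinv]
    rw [lintegral_mul_const'' _ hk.enorm, ← mul_assoc]
    congr 1
    nth_rewrite 2 [← ENNReal.rpow_one (∫⁻ y, ‖k y‖ₑ)]
    rw [← ENNReal.rpow_add_of_nonneg _ _ (by linarith) zero_le_one, sub_add_cancel]

/-- By Young's inequality `|k| ∗ |v|` has finite `L^q` norm, so it is finite almost everywhere. -/
theorem ae_integrable_conv {k v : Eucl n → ℂ} (hq : 1 ≤ q) (hk : Integrable k) (hv : MemLp v q) :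
    ∀ᵐ x, Integrable fun y => k (x - y) * v y := by
  have hle := eLpNorm_lintegral_conv_le hq hk.1 hv.1
  have hlt : eLpNorm (fun x => ∫⁻ y, ‖k (x - y) * v y‖ₑ) q volume < ⊤ :=
    hle.trans_lt (ENNReal.mul_lt_top (memLp_one_iff_integrable.2 hk).2 hv.2)
  have hm : MemLp (fun x => ∫⁻ y, ‖k (x - y) * v y‖ₑ) q volume :=
    ⟨(aemeasurable_lintegral_conv hk.1 hv.1).aestronglyMeasurable, hlt⟩
  have hfin : ∀ᵐ x, (∫⁻ y, ‖k (x - y) * v y‖ₑ) < ⊤ := by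
    rcases eq_or_ne q ⊤ with rfl | hqt
    · rw [eLpNorm_exponent_top] at hlt
      filter_upwards [enorm_ae_le_eLpNormEssSup (fun x => ∫⁻ y, ‖k (x - y) * v y‖ₑ) volume]
        with x hx
      exact hx.trans_lt hlt
    · have hq0 : q ≠ 0 := (zero_lt_one.trans_le hq).ne'
      have hp0 := ENNReal.toReal_pos hq0 hqt
      have := (lintegral_rpow_enorm_lt_top_of_eLpNorm_lt_top hq0 hqt hlt).ne
      filter_upwards [ae_lt_top' ((aemeasurable_lintegral_conv hk.1 hv.1).enorm.pow_const _) this]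
        with x hx
      simpa [ENNReal.rpow_lt_top_iff_of_pos hp0] using hx
  filter_upwards [hfin] with x hx
  exact ⟨aestronglyMeasurable_conv_integrand_right hk.1 hv.1 x, hx⟩

theorem eLpNorm_convFun_le {k v : Eucl n → ℂ} (hq : 1 ≤ q)
    (hk : AEStronglyMeasurable k) (hv : AEStronglyMeasurable v) :
    eLpNorm (convFun k v) q volume ≤ eLpNorm k 1 volume * eLpNorm v q volume := by
  refine le_trans (eLpNorm_mono_enorm fun x => ?_) (eLpNorm_lintegral_conv_le hq hk hv)
  rw [enorm_eq_self]
  exact enorm_integral_le_lintegral_enorm _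

theorem memLp_convFun {k v : Eucl n → ℂ} (hq : 1 ≤ q) (hk : Integrable k) (hv : MemLp v q) :
    MemLp (convFun k v) q :=
  ⟨aestronglyMeasurable_convFun hk.1 hv.1, (eLpNorm_convFun_le hq hk.1 hv.1).trans_lt
    (ENNReal.mul_lt_top (memLp_one_iff_integrable.2 hk).2 hv.2)⟩

/-- The equality holds at every point, because `y ↦ x - y` preserves null sets. Representatives in
`L¹` and `L^q` may therefore be exchanged freely. -/
theorem convFun_congr {k k' v v' : Eucl n → ℂ} (hk : k =ᵐ[volume] k') (hv : v =ᵐ[volume] v') :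
    convFun k v = convFun k' v' := by
  ext x
  refine integral_congr_ae ?_
  have := (quasiMeasurePreserving_sub_left_of_right_invariant volume x).ae_eq_comp hk
  filter_upwards [this, hv] with y h1 h2
  simp only [Function.comp_apply] at h1
  rw [h1, h2]

/-- The input for Fubini: Young's inequality puts `|k| ∗ |v|` in `L^q`, and Hölder pairs it with
`φ`. -/
theorem integrable_conv_pairing [hqq : q.HolderConjugate q'] {k v φ : Eucl n → ℂ}
    (hk : Integrable k) (hv : MemLp v q) (hφ : MemLp φ q') :
    Integrable (fun p : Eucl n × Eucl n => k (p.1 - p.2) * v p.2 * φ p.1)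
      ((volume : Measure (Eucl n)).prod volume) := by
  have hq : 1 ≤ q := ENNReal.HolderConjugate.one_le q q'
  have hm : AEStronglyMeasurable (fun p : Eucl n × Eucl n => k (p.1 - p.2) * v p.2 * φ p.1)
      ((volume : Measure (Eucl n)).prod volume) :=
    (aestronglyMeasurable_conv_integrand hk.1 hv.1).mul hφ.1.comp_fst
  rw [integrable_prod_iff hm]
  constructor
  · filter_upwards [ae_integrable_conv hq hk hv] with x hx using hx.mul_const _
  · have hk' : Integrable (fun x => (‖k x‖ : ℂ)) := hk.norm.ofReal
    have hv' : MemLp (fun x => (‖v x‖ : ℂ)) q := hv.norm.ofReal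
    have h1 := (memLp_convFun hq hk' hv').integrable_mul hφ
    refine h1.norm.congr (Eventually.of_forall fun x => ?_)
    have : convFun (fun x => (‖k x‖ : ℂ)) (fun x => (‖v x‖ : ℂ)) x
        = ((∫ y, ‖k (x - y)‖ * ‖v y‖ : ℝ) : ℂ) := by
      rw [convFun, ← integral_complex_ofReal]
      simp
    simp only [Pi.mul_apply, this, norm_mul, Complex.norm_real, integral_mul_const]
    rw [Real.norm_of_nonneg (integral_nonneg fun y => by positivity)]

/-- The adjoint of a convolution operator. -/
theorem integral_convFun_mul [hqq : q.HolderConjugate q'] {k v φ : Eucl n → ℂ}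
    (hk : Integrable k) (hv : MemLp v q) (hφ : MemLp φ q') :
    ∫ x, convFun k v x * φ x = ∫ y, v y * ∫ x, k (x - y) * φ x := by
  have := integral_integral_swap (f := fun x y => k (x - y) * v y * φ x)
    (integrable_conv_pairing hk hv hφ)
  calc ∫ x, convFun k v x * φ x = ∫ x, ∫ y, k (x - y) * v y * φ x := by
        simp only [convFun, integral_mul_const]
    _ = _ := this
    _ = _ := by
        refine integral_congr_ae (Eventually.of_forall fun y => ?_)
        simp only [← integral_const_mul]
        congr 1; ext x; ring

/-- The space `L¹(ℝⁿ; ℂ)` of convolution kernels. -/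
noncomputable abbrev KernelSpace (n : ℕ) := Lp ℂ 1 (volume : Measure (Eucl n))

theorem integrable_kernel (k : KernelSpace n) : Integrable k := L1.integrable_coeFn k

/-- The space `L^q(ℝⁿ; ℂ)`. -/
noncomputable abbrev LqSpace (n : ℕ) (q : ℝ≥0∞) := Lp ℂ q (volume : Measure (Eucl n))

variable [Fact (1 ≤ q)]

theorem norm_toLp_convFun_le (k : KernelSpace n) (v : LqSpace n q) :
    ‖(memLp_convFun (Fact.out : 1 ≤ q) (integrable_kernel k) (Lp.memLp v)).toLp‖ ≤ ‖k‖ * ‖v‖ := by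
  rw [Lp.norm_toLp, Lp.norm_def, Lp.norm_def, ← ENNReal.toReal_mul]
  exact ENNReal.toReal_mono (ENNReal.mul_ne_top (Lp.eLpNorm_ne_top k) (Lp.eLpNorm_ne_top v))
    (eLpNorm_convFun_le Fact.out (Lp.aestronglyMeasurable k) (Lp.aestronglyMeasurable v))

/-- Convolution as a bounded bilinear map `L¹ × L^q → L^q`. -/
noncomputable def convCLM (n : ℕ) (q : ℝ≥0∞) [Fact (1 ≤ q)] :
    KernelSpace n →L[ℝ] LqSpace n q →L[ℝ] LqSpace n q :=
  LinearMap.mkContinuous₂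
    (LinearMap.mk₂ ℝ (fun (k : KernelSpace n) (v : LqSpace n q) =>
      (memLp_convFun (Fact.out : 1 ≤ q) (integrable_kernel k) (Lp.memLp v)).toLp)
      (fun k k' v => by
        rw [← MemLp.toLp_add]
        refine MemLp.toLp_congr _ _ ?_
        filter_upwards [ae_integrable_conv Fact.out (integrable_kernel k) (Lp.memLp v),
          ae_integrable_conv Fact.out (integrable_kernel k') (Lp.memLp v)] with x h1 h2
        rw [convFun_congr (Lp.coeFn_add k k') (ae_eq_refl _)]
        simp only [convFun, Pi.add_apply, add_mul]
        exact integral_add h1 h2)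
      (fun c k v => by
        rw [← MemLp.toLp_const_smul]
        refine MemLp.toLp_congr _ _ (Eventually.of_forall fun x => ?_)
        rw [convFun_congr (Lp.coeFn_smul c k) (ae_eq_refl _)]
        simp only [convFun, Pi.smul_apply, smul_mul_assoc]
        exact integral_smul _ _)
      (fun k v v' => by
        rw [← MemLp.toLp_add]
        refine MemLp.toLp_congr _ _ ?_
        filter_upwards [ae_integrable_conv Fact.out (integrable_kernel k) (Lp.memLp v),
          ae_integrable_conv Fact.out (integrable_kernel k) (Lp.memLp v')] with x h1 h2
        rw [convFun_congr (ae_eq_refl _) (Lp.coeFn_add v v')]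
        simp only [convFun, Pi.add_apply, mul_add]
        exact integral_add h1 h2)
      (fun c k v => by
        rw [← MemLp.toLp_const_smul]
        refine MemLp.toLp_congr _ _ (Eventually.of_forall fun x => ?_)
        rw [convFun_congr (ae_eq_refl _) (Lp.coeFn_smul c v)]
        simp only [convFun, Pi.smul_apply, mul_smul_comm]
        exact integral_smul _ _)) 1
    (fun k v => by simpa using norm_toLp_convFun_le k v)

theorem norm_convCLM_apply_le (k : KernelSpace n) : ‖convCLM n q k‖ ≤ ‖k‖ :=
  ContinuousLinearMap.opNorm_le_bound _ (norm_nonneg _) fun v => norm_toLp_convFun_le k v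

theorem coeFn_convCLM (k : KernelSpace n) (v : LqSpace n q) :
    convCLM n q k v =ᵐ[volume] convFun k v :=
  (memLp_convFun Fact.out (integrable_kernel k) (Lp.memLp v)).coeFn_toLp

end Convolution

/-! ### Pairing with Schwartz functions and transposition of derivatives. -/

section Distributions

variable {n : ℕ} {q : ℝ≥0∞} [Fact (1 ≤ q)]

/-- Testing an `L^q` function against a fixed Schwartz function. -/
noncomputable def testCLM (q : ℝ≥0∞) [Fact (1 ≤ q)] (φ : 𝓢(Eucl n, ℂ)) : LqSpace n q →L[ℂ] ℂ :=
  (PointwiseConvergenceCLM.evalCLM (RingHom.id ℂ) ℂ φ).comp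
    (Lp.toTemperedDistributionCLM ℂ volume q)

theorem testCLM_apply (φ : 𝓢(Eucl n, ℂ)) (v : LqSpace n q) :
    testCLM q φ v = Lp.toTemperedDistribution v φ := rfl

theorem testCLM_eq_integral (φ : 𝓢(Eucl n, ℂ)) (v : LqSpace n q) :
    testCLM q φ v = ∫ x, φ x * v x := by
  simp [testCLM_apply]

theorem ext_testCLM {v w : LqSpace n q} (h : ∀ φ, testCLM q φ v = testCLM q φ w) : v = w := by
  have hker := Lp.ker_toTemperedDistributionCLM_eq_bot (F := ℂ) (μ := (volume : Measure (Eucl n)))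
    (p := q)
  refine LinearMap.ker_eq_bot.1 hker ?_
  ext φ
  exact h φ

theorem testCLM_convCLM (k : KernelSpace n) (φ : 𝓢(Eucl n, ℂ)) (v : LqSpace n q) :
    testCLM q φ (convCLM n q k v) = ∫ y, v y * ∫ x, k (x - y) * φ x := by
  have := ENNReal.HolderConjugate.inv_one_sub_inv' (Fact.out : 1 ≤ q)
  rw [testCLM_eq_integral, ← integral_convFun_mul (q := q) (q' := (1 - q⁻¹)⁻¹)
    (integrable_kernel k) (Lp.memLp v) (φ.memLp _ _)]
  refine integral_congr_ae ?_
  filter_upwards [coeFn_convCLM k v] with x hx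
  rw [hx, mul_comm]

/-- The Schwartz function `y ↦ g(x - y)`. -/
noncomputable def reflectSchwartz (g : 𝓢(Eucl n, ℂ)) (x : Eucl n) : 𝓢(Eucl n, ℂ) :=
  SchwartzMap.compSubConstCLM ℂ x
    (SchwartzMap.compCLMOfContinuousLinearEquiv ℂ (ContinuousLinearEquiv.neg ℝ) g)

@[simp]
theorem reflectSchwartz_apply (g : 𝓢(Eucl n, ℂ)) (x y : Eucl n) :
    reflectSchwartz g x y = g (x - y) := by
  simp [reflectSchwartz]

theorem lineDeriv_reflectSchwartz (g : 𝓢(Eucl n, ℂ)) (x m : Eucl n) :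
    ∂_{m} (reflectSchwartz g x) = -reflectSchwartz (∂_{m} g) x := by
  ext y
  simp only [neg_apply, reflectSchwartz_apply, SchwartzMap.lineDerivOp_apply_eq_fderiv]
  have h1 : HasFDerivAt (fun y => x - y) (-ContinuousLinearMap.id ℝ (Eucl n)) y :=
    (hasFDerivAt_id y).const_sub x
  have h2 := ((g.differentiableAt (x := x - y)).hasFDerivAt.comp y h1).congr_of_eventuallyEq
    (f₁ := reflectSchwartz g x) (Eventually.of_forall fun z => reflectSchwartz_apply g x z)
  rw [h2.fderiv]
  simp

/-- Convolution with a Schwartz kernel is, point by point, a pairing with a test function; an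
identity between distributions can thus be inserted into it. -/
theorem convFun_schwartz (g : 𝓢(Eucl n, ℂ)) (v : LqSpace n q) (x : Eucl n) :
    convFun g v x = testCLM q (reflectSchwartz g x) v := by
  simp [testCLM_eq_integral, convFun]

/-- A Schwartz function as a convolution kernel. -/
noncomputable def schwartzKernel (g : 𝓢(Eucl n, ℂ)) : KernelSpace n := g.toLp 1 volume

theorem coeFn_schwartzKernel (g : 𝓢(Eucl n, ℂ)) : schwartzKernel g =ᵐ[volume] g :=
  g.coeFn_toLp 1 volume

theorem coeFn_convCLM_schwartz (g : 𝓢(Eucl n, ℂ)) (v : LqSpace n q) :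
    convCLM n q (schwartzKernel g) v =ᵐ[volume] fun x => testCLM q (reflectSchwartz g x) v := by
  filter_upwards [coeFn_convCLM (schwartzKernel g) v] with x hx
  rw [hx, convFun_congr (coeFn_schwartzKernel g) (ae_eq_refl v), convFun_schwartz]

theorem testCLM_convCLM_schwartz (g : 𝓢(Eucl n, ℂ)) (φ : 𝓢(Eucl n, ℂ)) (v : LqSpace n q) :
    testCLM q φ (convCLM n q (schwartzKernel g) v) = ∫ y, v y * ∫ x, g (x - y) * φ x := by
  rw [testCLM_convCLM]
  refine integral_congr_ae (Eventually.of_forall fun y => ?_)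
  simp only
  congr 1
  refine integral_congr_ae ?_
  filter_upwards [(measurePreserving_sub_right volume y).quasiMeasurePreserving.ae_eq_comp
    (coeFn_schwartzKernel g)] with x hx
  simp only [Function.comp_apply] at hx
  rw [hx]

/-- Fubini brings the inner integral `∫ g(x - y) φ(x) dx` to the front, and the integration by parts
is done there, between two Schwartz functions. -/
theorem testCLM_convCLM_lineDeriv (g : 𝓢(Eucl n, ℂ)) (φ : 𝓢(Eucl n, ℂ)) (v : LqSpace n q)
    (m : Eucl n) :
    testCLM q φ (convCLM n q (schwartzKernel (∂_{m} g)) v) =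
      -testCLM q (∂_{m} φ) (convCLM n q (schwartzKernel g) v) := by
  rw [testCLM_convCLM_schwartz, testCLM_convCLM_schwartz, ← integral_neg]
  refine integral_congr_ae (Eventually.of_forall fun y => ?_)
  simp only [← mul_neg]
  congr 1
  have h := SchwartzMap.integral_mul_lineDerivOp_right_eq_neg_left (μ := volume)
    (SchwartzMap.compSubConstCLM ℂ y g) φ m
  have hd : ∀ x, ∂_{m} (SchwartzMap.compSubConstCLM ℂ y g) x = ∂_{m} g (x - y) := by
    intro x
    simp only [SchwartzMap.lineDerivOp_apply_eq_fderiv]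
    have : (SchwartzMap.compSubConstCLM ℂ y g : Eucl n → ℂ) = fun x => g (x - y) := by
      ext x; simp
    rw [this, fderiv_comp_sub]
  simp only [hd, SchwartzMap.compSubConstCLM_apply] at h
  rw [h, neg_neg]

/-- The operator `∑ b_{ij} ∂_j ∂_i` on Schwartz functions. -/
noncomputable def secondOrderSchwartz (b : Matrix (Fin n) (Fin n) ℝ) (g : 𝓢(Eucl n, ℂ)) :
    𝓢(Eucl n, ℂ) :=
  ∑ i, ∑ j, (b i j : ℂ) •
    ∂_{(EuclideanSpace.single j (1 : ℝ) : Eucl n)} (∂_{(EuclideanSpace.single i (1 : ℝ) : Eucl n)} g)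

theorem sum_tempered_apply {ι : Type*} (s : Finset ι) (T : ι → 𝓢'(Eucl n, ℂ)) (φ : 𝓢(Eucl n, ℂ)) :
    (∑ i ∈ s, T i) φ = ∑ i ∈ s, T i φ :=
  map_sum (PointwiseConvergenceCLM.evalCLM (RingHom.id ℂ) ℂ φ) T s

/-- The two signs cancel and transposition reverses the order of the derivatives; this explains the
order chosen in `secondOrderSchwartz`. -/
theorem secondOrderOperator_apply (b : Matrix (Fin n) (Fin n) ℝ) (T : 𝓢'(Eucl n, ℂ))
    (φ : 𝓢(Eucl n, ℂ)) : secondOrderOperator b T φ = T (secondOrderSchwartz b φ) := by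
  simp only [secondOrderOperator, secondOrderSchwartz, sum_tempered_apply, map_sum]
  refine Finset.sum_congr rfl fun i _ => Finset.sum_congr rfl fun j _ => ?_
  rw [map_smul]
  rw [smul_apply, TemperedDistribution.lineDerivOp_apply_apply,
    TemperedDistribution.lineDerivOp_apply_apply, LineDeriv.lineDerivOp_neg, neg_neg]

theorem secondOrderSchwartz_reflect (b : Matrix (Fin n) (Fin n) ℝ) (g : 𝓢(Eucl n, ℂ))
    (x : Eucl n) :
    secondOrderSchwartz b (reflectSchwartz g x) = reflectSchwartz (secondOrderSchwartz b g) x := by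
  ext y
  simp only [secondOrderSchwartz, lineDeriv_reflectSchwartz, LineDeriv.lineDerivOp_neg, neg_neg,
    reflectSchwartz_apply, sum_apply, smul_apply]

/-- If `w' = ∑ b_{ij} ∂_i ∂_j w` as distributions then `g ∗ w' = (∑ b_{ij} ∂_i ∂_j g) ∗ w`. -/
theorem convCLM_eq_of_secondOrderOperator (b : Matrix (Fin n) (Fin n) ℝ) (g : 𝓢(Eucl n, ℂ))
    {w w' : LqSpace n q}
    (h : Lp.toTemperedDistribution w' = secondOrderOperator b (Lp.toTemperedDistribution w)) :
    convCLM n q (schwartzKernel g) w' = convCLM n q (schwartzKernel (secondOrderSchwartz b g)) w := by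
  refine Lp.ext ?_
  filter_upwards [coeFn_convCLM_schwartz g w', coeFn_convCLM_schwartz (secondOrderSchwartz b g) w]
    with x h1 h2
  rw [h1, h2, testCLM_apply, h, secondOrderOperator_apply, secondOrderSchwartz_reflect,
    testCLM_apply]

theorem schwartzKernel_secondOrderSchwartz (b : Matrix (Fin n) (Fin n) ℝ) (g : 𝓢(Eucl n, ℂ)) :
    schwartzKernel (secondOrderSchwartz b g) = ∑ i, ∑ j, b i j •
      schwartzKernel (∂_{(EuclideanSpace.single j (1 : ℝ) : Eucl n)}
        (∂_{(EuclideanSpace.single i (1 : ℝ) : Eucl n)} g)) := by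
  rw [schwartzKernel, ← SchwartzMap.toLpCLM_apply (𝕜 := ℝ), secondOrderSchwartz, map_sum]
  refine Finset.sum_congr rfl fun i _ => ?_
  rw [map_sum]
  refine Finset.sum_congr rfl fun j _ => ?_
  rw [Complex.coe_smul, map_smul, SchwartzMap.toLpCLM_apply, schwartzKernel]

theorem testCLM_secondOrderSchwartz (b : Matrix (Fin n) (Fin n) ℝ) (φ : 𝓢(Eucl n, ℂ))
    (w : LqSpace n q) :
    testCLM q (secondOrderSchwartz b φ) w = ∑ i, ∑ j, (b i j : ℂ) *
      testCLM q (∂_{(EuclideanSpace.single j (1 : ℝ) : Eucl n)}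
        (∂_{(EuclideanSpace.single i (1 : ℝ) : Eucl n)} φ)) w := by
  simp only [testCLM_apply, secondOrderSchwartz, map_sum, map_smul, smul_eq_mul]

/-- The functional `k ↦ ⟨k ∗ v, φ⟩`. -/
noncomputable def kernelTestCLM (φ : 𝓢(Eucl n, ℂ)) (v : LqSpace n q) : KernelSpace n →L[ℝ] ℂ :=
  ((testCLM q φ).restrictScalars ℝ).comp ((convCLM n q).flip v)

theorem kernelTestCLM_apply (φ : 𝓢(Eucl n, ℂ)) (v : LqSpace n q) (k : KernelSpace n) :
    kernelTestCLM φ v k = testCLM q φ (convCLM n q k v) := rfl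

/-- Moving both derivatives from `g` to `φ` reverses their order, so the coefficients appear
transposed; symmetry of `b` repairs this. -/
theorem testCLM_convCLM_secondOrderSchwartz {b : Matrix (Fin n) (Fin n) ℝ} (hb : b.IsSymm)
    (g φ : 𝓢(Eucl n, ℂ)) (v : LqSpace n q) :
    testCLM q φ (convCLM n q (schwartzKernel (secondOrderSchwartz b g)) v) =
      testCLM q (secondOrderSchwartz b φ) (convCLM n q (schwartzKernel g) v) := by
  have h : ∀ i j, kernelTestCLM φ v (b j i • schwartzKernel
      (∂_{(EuclideanSpace.single i (1 : ℝ) : Eucl n)}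
        (∂_{(EuclideanSpace.single j (1 : ℝ) : Eucl n)} g))) = (b i j : ℂ) *
      testCLM q (∂_{(EuclideanSpace.single j (1 : ℝ) : Eucl n)}
        (∂_{(EuclideanSpace.single i (1 : ℝ) : Eucl n)} φ)) (convCLM n q (schwartzKernel g) v) := by
    intro i j
    rw [map_smul, kernelTestCLM_apply, testCLM_convCLM_lineDeriv, testCLM_convCLM_lineDeriv,
      neg_neg, hb.apply, Complex.real_smul]
  have h1 : testCLM q φ (convCLM n q (schwartzKernel (secondOrderSchwartz b g)) v) = ∑ j, ∑ i,
      kernelTestCLM φ v (b j i • schwartzKernel (∂_{(EuclideanSpace.single i (1 : ℝ) : Eucl n)}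
        (∂_{(EuclideanSpace.single j (1 : ℝ) : Eucl n)} g))) := by
    rw [schwartzKernel_secondOrderSchwartz b g, ← kernelTestCLM_apply, map_sum]
    exact Finset.sum_congr rfl fun j _ => map_sum _ _ _
  rw [h1, testCLM_secondOrderSchwartz b φ, Finset.sum_comm]
  exact Finset.sum_congr rfl fun i _ => Finset.sum_congr rfl fun j _ => h i j

end Distributions

/-! ### Approximate identities: norm convergence for `q < ∞`, weak-* convergence for `q = ∞`. -/

section ApproximateIdentity

variable {n : ℕ} {q : ℝ≥0∞} [Fact (1 ≤ q)]

/-- The translate `v(· - y)`. -/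
noncomputable def translateLp (y : Eucl n) (v : LqSpace n q) : LqSpace n q :=
  DomAddAct.mk (-y) +ᵥ v

omit [Fact (1 ≤ q)] in
theorem coeFn_translateLp (y : Eucl n) (v : LqSpace n q) :
    translateLp y v =ᵐ[volume] fun x => v (x - y) := by
  filter_upwards [DomAddAct.vadd_Lp_ae_eq (DomAddAct.mk (-y)) v] with x hx
  rw [translateLp, hx]
  simp [sub_eq_neg_add]

omit [Fact (1 ≤ q)] in
theorem norm_translateLp (y : Eucl n) (v : LqSpace n q) : ‖translateLp y v‖ = ‖v‖ :=
  DomAddAct.norm_vadd_Lp _ _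

omit [Fact (1 ≤ q)] in
theorem translateLp_zero (v : LqSpace n q) : translateLp 0 v = v := by
  simp [translateLp]

/-- False for `q = ∞` in general. Every later use of `q ≠ ⊤` goes back to this continuity. -/
theorem continuous_translateLp (hq : q ≠ ⊤) (v : LqSpace n q) :
    Continuous fun y => translateLp y v := by
  have : Fact (q ≠ ⊤) := ⟨hq⟩
  exact (DomAddAct.mkHomeomorph.continuous.comp continuous_neg).vadd continuous_const

theorem integrable_smul_translateLp (hq : q ≠ ⊤) (k : KernelSpace n) (v : LqSpace n q) :
    Integrable fun y => k y • translateLp y v :=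
  (integrable_kernel k).smul_of_top_left (memLp_top_of_bound
    (continuous_translateLp hq v).aestronglyMeasurable ‖v‖
    (Eventually.of_forall fun y => (norm_translateLp y v).le))

/-- For `q < ∞` a convolution is a Bochner integral of translates. -/
theorem convCLM_eq_integral_translateLp (hq : q ≠ ⊤) (k : KernelSpace n) (v : LqSpace n q) :
    convCLM n q k v = ∫ y, k y • translateLp y v := by
  have := ENNReal.HolderConjugate.inv_one_sub_inv' (Fact.out : 1 ≤ q)
  refine ext_testCLM fun φ => ?_
  rw [← ContinuousLinearMap.integral_comp_comm _ (integrable_smul_translateLp hq k v),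
    testCLM_eq_integral]
  -- The map `(x, y) ↦ (x, x - y)` preserves the product measure, so the integrability in
  -- `integrable_conv_pairing` transfers to `k(y) v(x - y) φ(x)`.
  have hmp := (measurePreserving_prod_add (volume : Measure (Eucl n)) volume).comp
    ((MeasurePreserving.id (volume : Measure (Eucl n))).prod (Measure.measurePreserving_neg volume))
  have hint := (hmp.integrable_comp_of_integrable
      (integrable_conv_pairing (q := q) (q' := (1 - q⁻¹)⁻¹)
    (integrable_kernel k) (Lp.memLp v) (φ.memLp _ _)))
  have hswap := integral_integral_swap (f := fun x y => k y * v (x - y) * φ x) (by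
    refine hint.congr (Eventually.of_forall fun p => ?_)
    simp [Function.comp_apply, Function.uncurry, ← sub_eq_add_neg])
  calc ∫ x, φ x * convCLM n q k v x = ∫ x, ∫ y, k y * v (x - y) * φ x := by
        refine integral_congr_ae ?_
        filter_upwards [coeFn_convCLM k v] with x hx
        rw [hx, convFun, integral_mul_const, mul_comm, ← integral_sub_left_eq_self _ volume x]
        simp
    _ = ∫ y, ∫ x, k y * v (x - y) * φ x := hswap
    _ = _ := by
        refine integral_congr_ae (Eventually.of_forall fun y => ?_)
        simp only [map_smul, testCLM_eq_integral, smul_eq_mul]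
        rw [← integral_const_mul]
        refine integral_congr_ae ?_
        filter_upwards [coeFn_translateLp y v] with x hx
        rw [hx]; ring

theorem norm_convCLM_sub_le (hq : q ≠ ⊤) {k : KernelSpace n} (hk : ∫ x, k x = 1)
    (v : LqSpace n q) :
    ‖convCLM n q k v - v‖ ≤ ∫ y, ‖k y‖ * ‖translateLp y v - v‖ := by
  have h1 : convCLM n q k v - v = ∫ y, k y • (translateLp y v - v) := by
    simp only [smul_sub]
    rw [integral_sub (integrable_smul_translateLp hq k v) ((integrable_kernel k).smul_const v),
      integral_smul_const, hk, one_smul, convCLM_eq_integral_translateLp hq]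
  rw [h1]
  refine (norm_integral_le_integral_norm _).trans (le_of_eq ?_)
  simp only [norm_smul]

/-- A family of kernels of integral `1` that concentrates at the origin. -/
structure IsApproximateIdentity {ι : Type*} (l : Filter ι) (k : ι → KernelSpace n) : Prop where
  integral_eq : ∀ᶠ i in l, ∫ x, k i x = 1
  tendsto : ∀ w : Eucl n → ℝ, Continuous w → (∃ C, ∀ x, |w x| ≤ C) → w 0 = 0 →
    Tendsto (fun i => ∫ x, ‖k i x‖ * w x) l (𝓝 0)

/-- The weight is the modulus of continuity `y ↦ ‖v(· - y) - v‖_q`: continuous, bounded by `2‖v‖`,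
zero at the origin. -/
theorem IsApproximateIdentity.tendsto_convCLM (hq : q ≠ ⊤) {ι : Type*} {l : Filter ι}
    {k : ι → KernelSpace n} (hk : IsApproximateIdentity l k) (v : LqSpace n q) :
    Tendsto (fun i => convCLM n q (k i) v) l (𝓝 v) := by
  rw [tendsto_iff_norm_sub_tendsto_zero]
  refine squeeze_zero' (Eventually.of_forall fun i => norm_nonneg _)
    (hk.integral_eq.mono fun i hi => norm_convCLM_sub_le hq hi v) ?_
  refine hk.tendsto _ ((continuous_translateLp hq v).sub continuous_const).norm
    ⟨‖v‖ + ‖v‖, fun x => ?_⟩ (by simp [translateLp_zero])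
  rw [abs_of_nonneg (norm_nonneg _)]
  refine (norm_sub_le _ _).trans ?_
  rw [norm_translateLp]

/-- Pairing an `L^∞` function with an integrable one. -/
noncomputable def pairingCLM {φ : Eucl n → ℂ} (hφ : Integrable φ) : LqSpace n ⊤ →L[ℂ] ℂ :=
  ((ContinuousLinearMap.mul ℂ ℂ).lpPairing volume ⊤ 1).flip (memLp_one_iff_integrable.2 hφ).toLp

theorem pairingCLM_apply {φ : Eucl n → ℂ} (hφ : Integrable φ) (v : LqSpace n ⊤) :
    pairingCLM hφ v = ∫ x, v x * φ x := by
  rw [pairingCLM, ContinuousLinearMap.flip_apply, ContinuousLinearMap.lpPairing_eq_integral]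
  refine integral_congr_ae ?_
  filter_upwards [(memLp_one_iff_integrable.2 hφ).coeFn_toLp] with x hx
  simp [hx]

/-- Weak-* convergence on `L^∞`, for even kernels. -/
theorem IsApproximateIdentity.tendsto_pairing {ι : Type*} {l : Filter ι} {k : ι → KernelSpace n}
    (hk : IsApproximateIdentity l k) (hsymm : ∀ᶠ i in l, ∀ᵐ x, k i (-x) = k i x)
    (v : LqSpace n ⊤) {φ : Eucl n → ℂ} (hφ : Integrable φ) :
    Tendsto (fun i => pairingCLM hφ (convCLM n ⊤ (k i) v)) l (𝓝 (pairingCLM hφ v)) := by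
  have : ENNReal.HolderConjugate ⊤ 1 := inferInstance
  set Φ : LqSpace n 1 := (memLp_one_iff_integrable.2 hφ).toLp with hΦ
  have hΦa : Φ =ᵐ[volume] φ := (memLp_one_iff_integrable.2 hφ).coeFn_toLp
  let P : LqSpace n 1 →L[ℂ] ℂ := (ContinuousLinearMap.mul ℂ ℂ).lpPairing volume ⊤ 1 v
  have hP : ∀ w : LqSpace n 1, P w = ∫ x, v x * w x := fun w => by
    simp only [P]; rw [ContinuousLinearMap.lpPairing_eq_integral]; rfl
  -- For even kernels convolution is its own transpose, so the kernel can be moved onto `φ`, where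
  -- norm convergence in `L¹` is available.
  have h1 : Tendsto (fun i => P (convCLM n 1 (k i) Φ)) l (𝓝 (P Φ)) :=
    (P.continuous.tendsto _).comp (hk.tendsto_convCLM ENNReal.one_ne_top Φ)
  have h2 : P Φ = pairingCLM hφ v := rfl
  rw [h2] at h1
  refine h1.congr' ?_
  filter_upwards [hsymm] with i hi
  rw [hP, pairingCLM_apply]
  have h3 : ∫ x, convCLM n ⊤ (k i) v x * φ x = ∫ x, convFun (k i) v x * φ x := by
    refine integral_congr_ae ?_
    filter_upwards [coeFn_convCLM (k i) v] with x hx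
    rw [hx]
  rw [h3, integral_convFun_mul (q := ⊤) (q' := 1) (integrable_kernel _) (Lp.memLp v)
    (memLp_one_iff_integrable.2 hφ)]
  refine integral_congr_ae ?_
  filter_upwards [coeFn_convCLM (k i) Φ] with y hy
  rw [hy]
  congr 1
  refine integral_congr_ae ?_
  filter_upwards [hΦa, (quasiMeasurePreserving_sub_left_of_right_invariant volume y).ae hi]
    with x hx h
  rw [hx, ← h]; simp

end ApproximateIdentity

/-! ### Gaussians of coercive quadratic forms are Schwartz functions. -/

section GaussianSchwartz

variable {n : ℕ}

/-- The quadratic form `⟨x, Q x⟩`. -/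
def quadForm (Q : Matrix (Fin n) (Fin n) ℝ) (x : Eucl n) : ℝ := x.ofLp ⬝ᵥ (Q.mulVec x.ofLp)

theorem quadForm_eq_sum (Q : Matrix (Fin n) (Fin n) ℝ) (x : Eucl n) :
    quadForm Q x = ∑ i, ∑ j, Q i j * (x i * x j) := by
  simp only [quadForm, dotProduct, Matrix.mulVec, Finset.mul_sum]
  exact Finset.sum_congr rfl fun i _ => Finset.sum_congr rfl fun j _ => by ring

theorem hasTemperateGrowth_coord (i : Fin n) :
    Function.HasTemperateGrowth fun x : Eucl n => x i :=
  (EuclideanSpace.proj i : Eucl n →L[ℝ] ℝ).hasTemperateGrowth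

theorem hasTemperateGrowth_quadForm (Q : Matrix (Fin n) (Fin n) ℝ) :
    (quadForm Q).HasTemperateGrowth := by
  have h : quadForm Q = fun x => ∑ i, ∑ j, Q i j * (x i * x j) := funext (quadForm_eq_sum Q)
  rw [h]
  exact .sum fun i _ => .sum fun j _ => (Function.HasTemperateGrowth.const _).mul
    ((hasTemperateGrowth_coord i).mul (hasTemperateGrowth_coord j))

/-- The quadratic form of `Q` is bounded below by a positive multiple of `‖x‖²`. -/
def IsCoerciveForm (Q : Matrix (Fin n) (Fin n) ℝ) : Prop :=
  ∃ c > 0, ∀ x : Eucl n, c * ‖x‖ ^ 2 ≤ quadForm Q x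

/-- One term of the exponential series bounds the power by `N! exp(1 + r)`, and completing the
square gives `r ≤ 1/c + c r²/4`. -/
theorem one_add_pow_mul_exp_le {c : ℝ} (hc : 0 < c) (N : ℕ) {r : ℝ} (hr : 0 ≤ r) :
    (1 + r) ^ N * Real.exp (-(1 / 4) * (c * r ^ 2)) ≤ N.factorial * Real.exp (1 + 1 / c) := by
  have h1 : (1 + r) ^ N ≤ N.factorial * Real.exp (1 + r) := by
    have := Real.pow_div_factorial_le_exp (1 + r) (by positivity) N
    rwa [div_le_iff₀ (by positivity), mul_comm] at this
  have h2 : r ≤ 1 / c + 1 / 4 * (c * r ^ 2) := by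
    have : 0 ≤ (c * r - 2) ^ 2 / (4 * c) := by positivity
    have h3 : (c * r - 2) ^ 2 / (4 * c) = 1 / c + 1 / 4 * (c * r ^ 2) - r := by
      field_simp; ring
    linarith
  calc (1 + r) ^ N * Real.exp (-(1 / 4) * (c * r ^ 2))
      ≤ (N.factorial * Real.exp (1 + r)) * Real.exp (-(1 / 4) * (c * r ^ 2)) := by gcongr
    _ = N.factorial * Real.exp (1 + r + -(1 / 4) * (c * r ^ 2)) := by rw [mul_assoc, ← Real.exp_add]
    _ ≤ _ := by
        refine mul_le_mul_of_nonneg_left (Real.exp_le_exp.2 ?_) (by positivity)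
        linarith

/-- Each derivative of `exp` is `exp` itself, so the chain-rule bound for iterated derivatives
leaves the Gaussian times a power of `1 + ‖x‖`. -/
theorem exp_quadForm_decay {Q : Matrix (Fin n) (Fin n) ℝ} (hQ : IsCoerciveForm Q) (k m : ℕ) :
    ∃ C, ∀ x : Eucl n, ‖x‖ ^ k *
      ‖iteratedFDeriv ℝ m (fun x => Real.exp (-(1 / 4) * quadForm Q x)) x‖ ≤ C := by
  obtain ⟨c, hc, hcQ⟩ := hQ
  have hf : Function.HasTemperateGrowth fun x : Eucl n => -(1 / 4) * quadForm Q x :=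
    (Function.HasTemperateGrowth.const _).mul (hasTemperateGrowth_quadForm Q)
  obtain ⟨l, C, hC, hb⟩ := hf.norm_iteratedFDeriv_le_uniform m
  refine ⟨m.factorial * (1 + C) ^ m * ((k + l * m).factorial * Real.exp (1 + 1 / c)), fun x => ?_⟩
  -- Using `1 + C` instead of `C` makes the base at least `1`, so that it is bounded by its own
  -- `i`-th power for `i ≥ 1`.
  have h1 : (1 : ℝ) ≤ (1 + C) * (1 + ‖x‖) ^ l := by
    have := one_le_pow₀ (n := l) (by linarith [norm_nonneg x] : 1 ≤ 1 + ‖x‖)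
    nlinarith
  have h := norm_iteratedFDeriv_comp_le (𝕜 := ℝ) (g := Real.exp)
    (f := fun x : Eucl n => -(1 / 4) * quadForm Q x) (n := m) (N := ∞)
    Real.contDiff_exp hf.1 (mod_cast le_top) x (C := Real.exp (-(1 / 4) * quadForm Q x))
    (D := (1 + C) * (1 + ‖x‖) ^ l)
    (fun i _ => by
      rw [norm_iteratedFDeriv_eq_norm_iteratedDeriv, iteratedDeriv_eq_iterate, Real.iter_deriv_exp,
        Real.norm_eq_abs, abs_of_pos (Real.exp_pos _)])
    (fun i hi him => by
      refine (hb i him x).trans ?_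
      calc C * (1 + ‖x‖) ^ l ≤ (1 + C) * (1 + ‖x‖) ^ l := by gcongr; linarith
        _ ≤ _ := le_self_pow₀ h1 (by omega))
  calc ‖x‖ ^ k * ‖iteratedFDeriv ℝ m (fun x => Real.exp (-(1 / 4) * quadForm Q x)) x‖
      ≤ (1 + ‖x‖) ^ k * (m.factorial * Real.exp (-(1 / 4) * (c * ‖x‖ ^ 2)) *
          ((1 + C) * (1 + ‖x‖) ^ l) ^ m) := by
        gcongr
        · linarith
        · refine h.trans ?_
          gcongr m.factorial * Real.exp ?_ * _
          linarith [hcQ x]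
    _ = m.factorial * (1 + C) ^ m *
          ((1 + ‖x‖) ^ (k + l * m) * Real.exp (-(1 / 4) * (c * ‖x‖ ^ 2))) := by
        rw [mul_pow, pow_add, pow_mul]; ring
    _ ≤ _ := by
        exact mul_le_mul_of_nonneg_left (one_add_pow_mul_exp_le hc _ (norm_nonneg x))
          (by positivity)

/-- The Gaussian `exp(-¼⟨x, Q x⟩)` as a Schwartz function. -/
noncomputable def gaussSchwartz (Q : Matrix (Fin n) (Fin n) ℝ) (hQ : IsCoerciveForm Q) :
    𝓢(Eucl n, ℂ) :=
  SchwartzMap.postcompCLM (𝕜 := ℝ) Complex.ofRealCLM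
    { toFun := fun x => Real.exp (-(1 / 4) * quadForm Q x)
      smooth' := Real.contDiff_exp.comp
        (contDiff_const.mul (hasTemperateGrowth_quadForm Q).1)
      decay' := exp_quadForm_decay hQ }

theorem gaussSchwartz_apply {Q : Matrix (Fin n) (Fin n) ℝ} (hQ : IsCoerciveForm Q) (x : Eucl n) :
    gaussSchwartz Q hQ x = (Real.exp (-(1 / 4) * quadForm Q x) : ℂ) := rfl

/-- The function `p(x) exp(-¼⟨x, Q x⟩)`. -/
noncomputable def polyGauss (p : Eucl n → ℝ) (Q : Matrix (Fin n) (Fin n) ℝ) (x : Eucl n) : ℂ :=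
  ((p x * Real.exp (-(1 / 4) * quadForm Q x) : ℝ) : ℂ)

theorem integrable_polyGauss {p : Eucl n → ℝ} (hp : p.HasTemperateGrowth)
    {Q : Matrix (Fin n) (Fin n) ℝ} (hQ : IsCoerciveForm Q) : Integrable (polyGauss p Q) := by
  have hp' : Function.HasTemperateGrowth fun x => (p x : ℂ) :=
    Complex.ofRealCLM.hasTemperateGrowth.comp hp
  refine (SchwartzMap.integrable (μ := volume)
    (SchwartzMap.smulLeftCLM ℂ (fun x => (p x : ℂ)) (gaussSchwartz Q hQ))).congr
    (Eventually.of_forall fun x => ?_)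
  rw [SchwartzMap.smulLeftCLM_apply_apply hp', gaussSchwartz_apply, polyGauss]
  simp

open Classical in
/-- The class of `p(x) exp(-¼⟨x, Q x⟩)` in `L¹`. -/
noncomputable def polyGaussL1 (p : Eucl n → ℝ) (Q : Matrix (Fin n) (Fin n) ℝ) : KernelSpace n :=
  if h : Integrable (polyGauss p Q) then (memLp_one_iff_integrable.2 h).toLp else 0

theorem coeFn_polyGaussL1 {p : Eucl n → ℝ} (hp : p.HasTemperateGrowth)
    {Q : Matrix (Fin n) (Fin n) ℝ} (hQ : IsCoerciveForm Q) :
    polyGaussL1 p Q =ᵐ[volume] polyGauss p Q := by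
  rw [polyGaussL1, dif_pos (integrable_polyGauss hp hQ)]
  exact MemLp.coeFn_toLp _

end GaussianSchwartz

/-! ### Smooth dependence of `p(x) exp(-¼⟨x, Q x⟩)` on `Q`, with values in `L¹`. -/

section MatrixCalculus

attribute [local instance] Matrix.normedAddCommGroup Matrix.normedSpace

section GaussianSmooth

variable {n : ℕ}

theorem quadForm_add (Q H : Matrix (Fin n) (Fin n) ℝ) (x : Eucl n) :
    quadForm (Q + H) x = quadForm Q x + quadForm H x := by
  simp [quadForm, Matrix.add_mulVec]

theorem quadForm_smul_one (c : ℝ) (x : Eucl n) :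
    quadForm (c • (1 : Matrix (Fin n) (Fin n) ℝ)) x = c * ‖x‖ ^ 2 := by
  rw [EuclideanSpace.real_norm_sq_eq, Finset.mul_sum]
  simp only [quadForm, Matrix.smul_mulVec, Matrix.one_mulVec, dotProduct, Pi.smul_apply, smul_eq_mul]
  exact Finset.sum_congr rfl fun i _ => by ring

theorem isCoerciveForm_smul_one {c : ℝ} (hc : 0 < c) :
    IsCoerciveForm (c • (1 : Matrix (Fin n) (Fin n) ℝ)) :=
  ⟨c, hc, fun x => (quadForm_smul_one c x).ge⟩

theorem abs_quadForm_le (H : Matrix (Fin n) (Fin n) ℝ) (x : Eucl n) :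
    |quadForm H x| ≤ (n : ℝ) ^ 2 * ‖H‖ * ‖x‖ ^ 2 := by
  rw [quadForm_eq_sum]
  refine (Finset.abs_sum_le_sum_abs _ _).trans ?_
  calc ∑ i, |∑ j, H i j * (x i * x j)| ≤ ∑ _i : Fin n, ∑ _j : Fin n, ‖H‖ * (‖x‖ * ‖x‖) := by
        refine Finset.sum_le_sum fun i _ => (Finset.abs_sum_le_sum_abs _ _).trans ?_
        refine Finset.sum_le_sum fun j _ => ?_
        rw [abs_mul, abs_mul]
        have h1 : |H i j| ≤ ‖H‖ := Matrix.norm_entry_le_entrywise_sup_norm H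
        have h2 : ∀ i, |x i| ≤ ‖x‖ := fun i => by simpa using PiLp.norm_apply_le x i
        gcongr
        · exact h2 i
        · exact h2 j
    _ = _ := by simp; ring

theorem quadForm_add_ge {Q H : Matrix (Fin n) (Fin n) ℝ} {c : ℝ}
    (hQ : ∀ x : Eucl n, c * ‖x‖ ^ 2 ≤ quadForm Q x) (hH : (n : ℝ) ^ 2 * ‖H‖ ≤ c / 2) (x : Eucl n) :
    c / 2 * ‖x‖ ^ 2 ≤ quadForm (Q + H) x := by
  rw [quadForm_add]
  have h1 := hQ x
  have h2 := (abs_le.1 (abs_quadForm_le H x)).1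
  have h3 : (n : ℝ) ^ 2 * ‖H‖ * ‖x‖ ^ 2 ≤ c / 2 * ‖x‖ ^ 2 := by gcongr
  linarith

theorem eventually_norm_le {c : ℝ} (hc : 0 < c) :
    ∀ᶠ H : Matrix (Fin n) (Fin n) ℝ in 𝓝 0, (n : ℝ) ^ 2 * ‖H‖ ≤ c / 2 := by
  have : Tendsto (fun H : Matrix (Fin n) (Fin n) ℝ => (n : ℝ) ^ 2 * ‖H‖) (𝓝 0) (𝓝 0) := by
    have h := (continuous_norm.tendsto (0 : Matrix (Fin n) (Fin n) ℝ)).const_mul ((n : ℝ) ^ 2)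
    rwa [norm_zero, mul_zero] at h
  exact (this.eventually (gt_mem_nhds (half_pos hc))).mono fun H h => le_of_lt h

theorem isOpen_isCoerciveForm : IsOpen {Q : Matrix (Fin n) (Fin n) ℝ | IsCoerciveForm Q} := by
  rw [isOpen_iff_mem_nhds]
  rintro Q ⟨c, hc, hQ⟩
  have := eventually_norm_le (n := n) hc
  rw [← sub_self Q] at this
  have h2 : Tendsto (fun Q' : Matrix (Fin n) (Fin n) ℝ => Q' - Q) (𝓝 Q) (𝓝 (Q - Q)) :=
    (continuous_id.sub continuous_const).tendsto Q
  filter_upwards [h2.eventually this] with Q' hQ'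
  refine ⟨c / 2, half_pos hc, fun x => ?_⟩
  simpa using quadForm_add_ge hQ hQ' x

/-- The polynomial `-¼ p(x) x_i x_j`, which appears on differentiating in `Q_{ij}`. -/
noncomputable def polyStep (p : Eucl n → ℝ) (i j : Fin n) (x : Eucl n) : ℝ :=
  p x * (-(1 / 4) * (x i * x j))

theorem hasTemperateGrowth_polyStep {p : Eucl n → ℝ} (hp : p.HasTemperateGrowth) (i j : Fin n) :
    (polyStep p i j).HasTemperateGrowth :=
  hp.mul ((Function.HasTemperateGrowth.const _).mul
    ((hasTemperateGrowth_coord i).mul (hasTemperateGrowth_coord j)))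

/-- The `(i, j)` entry of a matrix, as a continuous linear functional. -/
noncomputable def entryCLM (i j : Fin n) : Matrix (Fin n) (Fin n) ℝ →L[ℝ] ℝ :=
  LinearMap.toContinuousLinearMap (Matrix.entryLinearMap ℝ ℝ i j)

@[simp]
theorem entryCLM_apply (i j : Fin n) (H : Matrix (Fin n) (Fin n) ℝ) : entryCLM i j H = H i j := rfl

/-- The derivative of `Q ↦ p(x) exp(-¼⟨x, Q x⟩)` in `L¹`. -/
noncomputable def polyGaussDeriv (p : Eucl n → ℝ) (Q : Matrix (Fin n) (Fin n) ℝ) :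
    Matrix (Fin n) (Fin n) ℝ →L[ℝ] KernelSpace n :=
  ∑ i, ∑ j, (entryCLM i j).smulRight (polyGaussL1 (polyStep p i j) Q)

theorem polyGaussDeriv_apply (p : Eucl n → ℝ) (Q H : Matrix (Fin n) (Fin n) ℝ) :
    polyGaussDeriv p Q H = ∑ i, ∑ j, H i j • polyGaussL1 (polyStep p i j) Q := by
  simp [polyGaussDeriv]

theorem coeFn_sum_lp {ι : Type*} (s : Finset ι) (k : ι → KernelSpace n) :
    (∑ i ∈ s, k i : KernelSpace n) =ᵐ[volume] fun x => ∑ i ∈ s, k i x := by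
  classical
  induction s using Finset.induction_on with
  | empty => exact Lp.coeFn_zero ℂ 1 (volume : Measure (Eucl n))
  | insert a s ha ih =>
    rw [Finset.sum_insert ha]
    filter_upwards [Lp.coeFn_add (k a) (∑ i ∈ s, k i), ih] with x h1 h2
    rw [h1, Pi.add_apply, h2, Finset.sum_insert ha]

theorem coeFn_polyGaussDeriv {p : Eucl n → ℝ} (hp : p.HasTemperateGrowth)
    {Q : Matrix (Fin n) (Fin n) ℝ} (hQ : IsCoerciveForm Q) (H : Matrix (Fin n) (Fin n) ℝ) :
    polyGaussDeriv p Q H =ᵐ[volume] polyGauss (fun x => p x * (-(1 / 4) * quadForm H x)) Q := by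
  rw [polyGaussDeriv_apply]
  have h1 : ∀ i j, (H i j • polyGaussL1 (polyStep p i j) Q : KernelSpace n) =ᵐ[volume]
      fun x => H i j • polyGauss (polyStep p i j) Q x := by
    intro i j
    filter_upwards [Lp.coeFn_smul (H i j) (polyGaussL1 (polyStep p i j) Q),
      coeFn_polyGaussL1 (hasTemperateGrowth_polyStep hp i j) hQ] with x h2 h3
    rw [h2, Pi.smul_apply, h3]
  have h2 : ∀ᵐ x, ∀ i j, (H i j • polyGaussL1 (polyStep p i j) Q : KernelSpace n) x =
      H i j • polyGauss (polyStep p i j) Q x :=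
    ae_all_iff.2 fun i => ae_all_iff.2 fun j => h1 i j
  have h3 : ∀ᵐ x, ∀ i, (∑ j, H i j • polyGaussL1 (polyStep p i j) Q : KernelSpace n) x =
      ∑ j, (H i j • polyGaussL1 (polyStep p i j) Q : KernelSpace n) x :=
    ae_all_iff.2 fun i => coeFn_sum_lp _ _
  filter_upwards [coeFn_sum_lp Finset.univ fun i => ∑ j, H i j • polyGaussL1 (polyStep p i j) Q,
    h2, h3] with x h4 h5 h6
  rw [h4]
  simp only [h6, h5, polyGauss, polyStep, quadForm_eq_sum H, Finset.mul_sum, Finset.sum_mul,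
    Complex.real_smul, Complex.ofReal_sum]
  refine Finset.sum_congr rfl fun i _ => Finset.sum_congr rfl fun j _ => ?_
  push_cast
  ring

theorem abs_exp_sub_one_sub_le (y : ℝ) : |Real.exp y - 1 - y| ≤ y ^ 2 * Real.exp |y| := by
  have := Complex.norm_exp_sub_sum_le_norm_mul_exp (y : ℂ) 2
  simp only [Finset.sum_range_succ, Finset.sum_range_zero, Complex.norm_real] at this
  simp only [pow_zero, Nat.factorial, pow_one, Real.norm_eq_abs, sq_abs, zero_add] at this
  refine le_trans (le_of_eq ?_) this
  rw [← Real.norm_eq_abs, ← Complex.norm_real]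
  congr 1
  push_cast
  ring

/-- Taylor's formula for `exp` in the increment `y = -¼⟨x, H x⟩` leaves `y² exp|y|`. The smallness
of `H` lets `exp|y|` consume at most half of the Gaussian decay, so the majorant is `‖H‖²` times one
integrable function independent of `H`. -/
theorem norm_polyGauss_remainder_le (p : Eucl n → ℝ) {Q H : Matrix (Fin n) (Fin n) ℝ} {c : ℝ}
    (hQ : ∀ x : Eucl n, c * ‖x‖ ^ 2 ≤ quadForm Q x) (hH : (n : ℝ) ^ 2 * ‖H‖ ≤ c / 2)
    (x : Eucl n) :
    ‖polyGauss p (Q + H) x - polyGauss p Q x -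
        polyGauss (fun x => p x * (-(1 / 4) * quadForm H x)) Q x‖ ≤
      ‖H‖ ^ 2 * ‖polyGauss (fun x => p x * (((n : ℝ) ^ 2) ^ 2 * (‖x‖ ^ 2) ^ 2))
        ((c / 2) • (1 : Matrix (Fin n) (Fin n) ℝ)) x‖ := by
  set y := -(1 / 4) * quadForm H x with hy
  have hHx := abs_quadForm_le H x
  have hyle : |y| ≤ (n : ℝ) ^ 2 * ‖H‖ * ‖x‖ ^ 2 := by
    rw [hy, abs_mul, abs_neg, abs_of_pos (by norm_num : (0 : ℝ) < 1 / 4)]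
    linarith [abs_nonneg (quadForm H x)]
  have hyle' : |y| ≤ 1 / 4 * (c / 2 * ‖x‖ ^ 2) := by
    rw [hy, abs_mul, abs_neg, abs_of_pos (by norm_num : (0 : ℝ) < 1 / 4)]
    have h3 : (n : ℝ) ^ 2 * ‖H‖ * ‖x‖ ^ 2 ≤ c / 2 * ‖x‖ ^ 2 := by gcongr
    linarith
  have hL : polyGauss p (Q + H) x - polyGauss p Q x - polyGauss (fun x => p x * (-(1 / 4) *
      quadForm H x)) Q x = ((p x * Real.exp (-(1 / 4) * quadForm Q x) * (Real.exp y - 1 - y) : ℝ) : ℂ) := by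
    simp only [polyGauss, quadForm_add, mul_add, Real.exp_add, ← hy]
    push_cast
    ring
  rw [hL, polyGauss, Complex.norm_real, Complex.norm_real, quadForm_smul_one, norm_mul, norm_mul,
    norm_mul, norm_mul, Real.norm_eq_abs, Real.norm_eq_abs, Real.norm_eq_abs, Real.norm_eq_abs,
    Real.norm_eq_abs, abs_of_pos (Real.exp_pos _), abs_of_pos (Real.exp_pos _)]
  have h1 := abs_exp_sub_one_sub_le y
  have h2 : Real.exp (-(1 / 4) * quadForm Q x) * Real.exp |y| ≤
      Real.exp (-(1 / 4) * (c / 2 * ‖x‖ ^ 2)) := by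
    rw [← Real.exp_add]
    refine Real.exp_le_exp.2 ?_
    linarith [hQ x]
  have h3 : y ^ 2 ≤ ‖H‖ ^ 2 * (((n : ℝ) ^ 2) ^ 2 * (‖x‖ ^ 2) ^ 2) := by
    calc y ^ 2 = |y| ^ 2 := (sq_abs y).symm
      _ ≤ ((n : ℝ) ^ 2 * ‖H‖ * ‖x‖ ^ 2) ^ 2 := by gcongr
      _ = _ := by ring
  rw [abs_of_nonneg (by positivity : 0 ≤ ((n : ℝ) ^ 2) ^ 2 * (‖x‖ ^ 2) ^ 2)]
  calc |p x| * Real.exp (-(1 / 4) * quadForm Q x) * |Real.exp y - 1 - y|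
      ≤ |p x| * Real.exp (-(1 / 4) * quadForm Q x) * (y ^ 2 * Real.exp |y|) := by gcongr
    _ = |p x| * y ^ 2 * (Real.exp (-(1 / 4) * quadForm Q x) * Real.exp |y|) := by ring
    _ ≤ |p x| * (‖H‖ ^ 2 * (((n : ℝ) ^ 2) ^ 2 * (‖x‖ ^ 2) ^ 2)) *
          Real.exp (-(1 / 4) * (c / 2 * ‖x‖ ^ 2)) := by gcongr
    _ = _ := by ring

/-- Integrating the pointwise remainder bound gives an `L¹` error of order `‖H‖²`. -/
theorem hasFDerivAt_polyGaussL1 {p : Eucl n → ℝ} (hp : p.HasTemperateGrowth)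
    {Q : Matrix (Fin n) (Fin n) ℝ} (hQ : IsCoerciveForm Q) :
    HasFDerivAt (polyGaussL1 p) (polyGaussDeriv p Q) Q := by
  obtain ⟨c, hc, hcQ⟩ := id hQ
  refine hasFDerivAt_iff_isLittleO_nhds_zero.2 ?_
  have hp4 : Function.HasTemperateGrowth
      fun x : Eucl n => p x * (((n : ℝ) ^ 2) ^ 2 * (‖x‖ ^ 2) ^ 2) :=
    hp.mul ((Function.HasTemperateGrowth.const _).mul
      ((Function.hasTemperateGrowth_norm_sq (Eucl n)).pow 2))
  have hint := (integrable_polyGauss hp4 (isCoerciveForm_smul_one (n := n) (half_pos hc))).norm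
  set K := ∫ x, ‖polyGauss (fun x : Eucl n => p x * (((n : ℝ) ^ 2) ^ 2 * (‖x‖ ^ 2) ^ 2))
    ((c / 2) • (1 : Matrix (Fin n) (Fin n) ℝ)) x‖ with hK
  have hO : (fun H => polyGaussL1 p (Q + H) - polyGaussL1 p Q - polyGaussDeriv p Q H) =O[𝓝 0]
      fun H : Matrix (Fin n) (Fin n) ℝ => ‖H‖ ^ 2 := by
    refine Asymptotics.IsBigO.of_bound K ?_
    filter_upwards [eventually_norm_le (n := n) hc] with H hH
    have hQH : IsCoerciveForm (Q + H) := ⟨c / 2, half_pos hc, quadForm_add_ge hcQ hH⟩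
    rw [L1.norm_eq_integral_norm, norm_pow, norm_norm, mul_comm, hK, ← integral_const_mul]
    refine integral_mono_ae (L1.integrable_coeFn _).norm (hint.const_mul _) ?_
    filter_upwards [Lp.coeFn_sub (polyGaussL1 p (Q + H) - polyGaussL1 p Q) (polyGaussDeriv p Q H),
      Lp.coeFn_sub (polyGaussL1 p (Q + H)) (polyGaussL1 p Q), coeFn_polyGaussL1 hp hQH,
      coeFn_polyGaussL1 hp hQ, coeFn_polyGaussDeriv hp hQ H] with x h1 h2 h3 h4 h5
    rw [h1, Pi.sub_apply, h2, Pi.sub_apply, h3, h4, h5]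
    exact norm_polyGauss_remainder_le p hcQ hH x
  exact hO.trans_isLittleO (Asymptotics.isLittleO_norm_pow_id one_lt_two)

/-- The derivative consists of functions of the same kind with `p` replaced by `polyStep p i j`. The
factor `p` is carried along so that the induction on the order closes. -/
theorem contDiffOn_polyGaussL1_nat (m : ℕ) : ∀ {p : Eucl n → ℝ}, p.HasTemperateGrowth →
    ContDiffOn ℝ m (polyGaussL1 p) {Q : Matrix (Fin n) (Fin n) ℝ | IsCoerciveForm Q} := by
  induction m with
  | zero =>
    intro p hp
    rw [Nat.cast_zero, contDiffOn_zero]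
    exact fun Q hQ => (hasFDerivAt_polyGaussL1 hp hQ).continuousAt.continuousWithinAt
  | succ m ih =>
    intro p hp
    rw [Nat.cast_succ, contDiffOn_succ_iff_hasFDerivWithinAt_of_uniqueDiffOn
      isOpen_isCoerciveForm.uniqueDiffOn]
    refine ⟨by simp, polyGaussDeriv p, ?_,
      fun Q hQ => (hasFDerivAt_polyGaussL1 hp hQ).hasFDerivWithinAt⟩
    unfold polyGaussDeriv
    refine ContDiffOn.sum fun i _ => ContDiffOn.sum fun j _ => ?_
    exact contDiffOn_const.smulRight (ih (hasTemperateGrowth_polyStep hp i j))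

theorem contDiffOn_polyGaussL1 {p : Eucl n → ℝ} (hp : p.HasTemperateGrowth) :
    ContDiffOn ℝ ∞ (polyGaussL1 p) {Q : Matrix (Fin n) (Fin n) ℝ | IsCoerciveForm Q} :=
  contDiffOn_infty.2 fun m => contDiffOn_polyGaussL1_nat m hp

end GaussianSmooth

end MatrixCalculus

/-! ### The normalized heat Gaussian as a smooth `L¹`-valued function of its matrix. -/

section MatrixCalculus

attribute [local instance] Matrix.normedAddCommGroup Matrix.normedSpace

section HeatGaussian

variable {n : ℕ}

/-- The normalizing constant of the heat Gaussian. -/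
noncomputable def heatConst (N : Matrix (Fin n) (Fin n) ℝ) : ℝ :=
  1 / √((4 * Real.pi) ^ n * N.det)

/-- The Gaussian `((4π)ⁿ det N)^(-1/2) exp(-¼⟨x, N⁻¹ x⟩)`. -/
noncomputable def heatGaussian (N : Matrix (Fin n) (Fin n) ℝ) (x : Eucl n) : ℝ :=
  heatConst N * Real.exp (-(1 / 4) * quadForm N⁻¹ x)

/-- The matrices for which the heat Gaussian is integrable. -/
def gaussDomain (n : ℕ) : Set (Matrix (Fin n) (Fin n) ℝ) := {N | 0 < N.det ∧ IsCoerciveForm N⁻¹}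

/-- The heat Gaussian in `L¹`. -/
noncomputable def heatL1 (N : Matrix (Fin n) (Fin n) ℝ) : KernelSpace n :=
  heatConst N • polyGaussL1 (fun _ => 1) N⁻¹

/-- The heat Gaussian as a Schwartz function. -/
noncomputable def heatSchwartz (N : Matrix (Fin n) (Fin n) ℝ) (hN : N ∈ gaussDomain n) :
    𝓢(Eucl n, ℂ) :=
  heatConst N • gaussSchwartz N⁻¹ hN.2

theorem heatSchwartz_apply {N : Matrix (Fin n) (Fin n) ℝ} (hN : N ∈ gaussDomain n) (x : Eucl n) :
    heatSchwartz N hN x = (heatGaussian N x : ℂ) := by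
  rw [heatSchwartz, smul_apply, gaussSchwartz_apply, heatGaussian, Complex.real_smul]
  push_cast
  rfl

theorem coeFn_heatL1 {N : Matrix (Fin n) (Fin n) ℝ} (hN : N ∈ gaussDomain n) :
    heatL1 N =ᵐ[volume] fun x => (heatGaussian N x : ℂ) := by
  filter_upwards [Lp.coeFn_smul (heatConst N) (polyGaussL1 (fun _ => 1) N⁻¹),
    coeFn_polyGaussL1 (Function.HasTemperateGrowth.const 1) hN.2] with x h1 h2
  rw [heatL1, h1, Pi.smul_apply, h2, heatGaussian, polyGauss, Complex.real_smul, one_mul,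
    Complex.ofReal_mul]

theorem schwartzKernel_heatSchwartz {N : Matrix (Fin n) (Fin n) ℝ} (hN : N ∈ gaussDomain n) :
    schwartzKernel (heatSchwartz N hN) = heatL1 N := by
  refine Lp.ext ?_
  filter_upwards [coeFn_heatL1 hN, coeFn_schwartzKernel (heatSchwartz N hN)] with x h1 h2
  rw [h1, h2, heatSchwartz_apply]

theorem Matrix.contDiff_det : ContDiff ℝ ∞ fun N : Matrix (Fin n) (Fin n) ℝ => N.det := by
  simp only [Matrix.det_apply]
  refine ContDiff.sum fun σ _ => ContDiff.const_smul _ (contDiff_prod fun i _ => ?_)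
  exact (entryCLM (σ i) i).contDiff

theorem contDiff_matrix {E : Type*} [NormedAddCommGroup E] [NormedSpace ℝ E] {m : ℕ∞ω}
    {f : E → Matrix (Fin n) (Fin n) ℝ} {s : Set E}
    (h : ∀ i j, ContDiffOn ℝ m (fun x => f x i j) s) : ContDiffOn ℝ m f s :=
  contDiffOn_pi.2 fun i => contDiffOn_pi.2 fun j => h i j

theorem Matrix.contDiff_adjugate :
    ContDiff ℝ ∞ fun N : Matrix (Fin n) (Fin n) ℝ => N.adjugate := by
  rw [← contDiffOn_univ]
  refine contDiff_matrix fun i j => contDiffOn_univ.2 ?_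
  simp only [Matrix.adjugate_apply]
  refine Matrix.contDiff_det.comp (contDiffOn_univ.1 (contDiff_matrix fun k l => contDiffOn_univ.2 ?_))
  by_cases hk : k = j
  · subst hk
    simp only [Matrix.updateRow_self]
    exact contDiff_const
  · simp only [Matrix.updateRow_ne hk]
    exact (entryCLM k l).contDiff

/-- The entrywise sup norm is not submultiplicative, so smoothness is read off Cramer's rule rather
than from a Neumann series. -/
theorem Matrix.contDiffOn_inv :
    ContDiffOn ℝ ∞ (fun N : Matrix (Fin n) (Fin n) ℝ => N⁻¹) {N | 0 < N.det} := by
  have h : (fun N : Matrix (Fin n) (Fin n) ℝ => N⁻¹) = fun N => N.det⁻¹ • N.adjugate := by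
    ext1 N
    rw [Matrix.inv_def, Ring.inverse_eq_inv']
  rw [h]
  exact (Matrix.contDiff_det.contDiffOn.inv fun N hN => ne_of_gt hN).smul
    Matrix.contDiff_adjugate.contDiffOn

theorem isOpen_det_pos : IsOpen {N : Matrix (Fin n) (Fin n) ℝ | 0 < N.det} :=
  isOpen_lt continuous_const Matrix.contDiff_det.continuous

/-- Symmetry is not part of the domain: the set is open in the space of all matrices, where
derivatives are taken. -/
theorem isOpen_gaussDomain : IsOpen (gaussDomain n) := by
  have h := Matrix.contDiffOn_inv.continuousOn.isOpen_inter_preimage (isOpen_det_pos (n := n))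
    isOpen_isCoerciveForm
  exact h

theorem contDiffOn_heatConst :
    ContDiffOn ℝ ∞ (heatConst : Matrix (Fin n) (Fin n) ℝ → ℝ) {N | 0 < N.det} := by
  have hpos : ∀ N ∈ {N : Matrix (Fin n) (Fin n) ℝ | 0 < N.det}, 0 < (4 * Real.pi) ^ n * N.det :=
    fun N hN => mul_pos (by positivity) hN
  have h1 : ContDiffOn ℝ ∞ (fun N : Matrix (Fin n) (Fin n) ℝ => (4 * Real.pi) ^ n * N.det)
      {N | 0 < N.det} := (contDiff_const.mul Matrix.contDiff_det).contDiffOn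
  exact contDiffOn_const.div (h1.sqrt fun N hN => (hpos N hN).ne')
    fun N hN => (Real.sqrt_pos.2 (hpos N hN)).ne'

theorem contDiffOn_heatL1 :
    ContDiffOn ℝ ∞ (heatL1 : Matrix (Fin n) (Fin n) ℝ → KernelSpace n) (gaussDomain n) := by
  have h1 : ContDiffOn ℝ ∞ (fun N : Matrix (Fin n) (Fin n) ℝ =>
      polyGaussL1 (fun _ => 1) N⁻¹) (gaussDomain n) :=
    (contDiffOn_polyGaussL1 (Function.HasTemperateGrowth.const 1)).comp
      (Matrix.contDiffOn_inv.mono fun N hN => hN.1) fun N hN => hN.2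
  exact (contDiffOn_heatConst.mono fun N hN => hN.1).smul h1

end HeatGaussian

/-! ### The heat equation satisfied by the kernel. -/

section HeatGaussianDerivative

variable {n : ℕ}

theorem hasDerivAt_matrix {f : ℝ → Matrix (Fin n) (Fin n) ℝ} {H : Matrix (Fin n) (Fin n) ℝ} {t : ℝ}
    (h : ∀ i j, HasDerivAt (fun x => f x i j) (H i j) t) : HasDerivAt f H t :=
  hasDerivAt_pi.2 fun i => hasDerivAt_pi.2 fun j => h i j

theorem HasDerivAt.matrix_entry {f : ℝ → Matrix (Fin n) (Fin n) ℝ} {H : Matrix (Fin n) (Fin n) ℝ}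
    {t : ℝ} (h : HasDerivAt f H t) (i j : Fin n) : HasDerivAt (fun x => f x i j) (H i j) t :=
  hasDerivAt_pi.1 (hasDerivAt_pi.1 h i) j

theorem HasDerivAt.matrix_mul {f g : ℝ → Matrix (Fin n) (Fin n) ℝ}
    {F G : Matrix (Fin n) (Fin n) ℝ} {t : ℝ} (hf : HasDerivAt f F t) (hg : HasDerivAt g G t) :
    HasDerivAt (fun x => f x * g x) (F * g t + f t * G) t := by
  refine hasDerivAt_matrix fun i j => ?_
  have h := HasDerivAt.fun_sum (u := Finset.univ) fun k _ =>
    (hf.matrix_entry i k).mul (hg.matrix_entry k j)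
  simp only [Matrix.add_apply, Matrix.mul_apply, ← Finset.sum_add_distrib]
  exact h

/-- Jacobi's formula along a line: factoring out `N` reduces it to `det(1 + rM) = 1 + r tr M + r²
P(r)` with a polynomial `P`. -/
theorem hasDerivAt_det_add_smul (N H : Matrix (Fin n) (Fin n) ℝ) (hN : N.det ≠ 0) :
    HasDerivAt (fun r : ℝ => (N + r • H).det) (N.det * (N⁻¹ * H).trace) 0 := by
  have hfac : ∀ r : ℝ, (N + r • H).det = N.det * (1 + r • (N⁻¹ * H)).det := by
    intro r
    rw [← Matrix.det_mul, mul_add, mul_one, mul_smul_comm, ← mul_assoc,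
      Matrix.mul_nonsing_inv _ (isUnit_iff_ne_zero.2 hN), one_mul]
  simp only [hfac]
  refine HasDerivAt.const_mul _ ?_
  have h := (((hasDerivAt_id (0 : ℝ)).const_mul (N⁻¹ * H).trace).const_add 1).add
    (((Polynomial.hasDerivAt (((1 : Matrix (Fin n) (Fin n) (Polynomial ℝ)) +
      (Polynomial.X : Polynomial ℝ) • (N⁻¹ * H).map Polynomial.C).det.divX.divX) 0)).mul
        ((hasDerivAt_id (0 : ℝ)).pow 2))
  refine (h.congr_of_eventuallyEq
    (Eventually.of_forall fun r => Matrix.det_one_add_smul r (N⁻¹ * H))).congr_deriv ?_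
  simp

/-- The differential of `det` at `N t` depends only on the direction `H`, so its value is found on
the straight line. -/
theorem hasDerivAt_det_curve {N : ℝ → Matrix (Fin n) (Fin n) ℝ} {H : Matrix (Fin n) (Fin n) ℝ}
    {t : ℝ} (h : HasDerivAt N H t) (hN : (N t).det ≠ 0) :
    HasDerivAt (fun τ => (N τ).det) ((N t).det * ((N t)⁻¹ * H).trace) t := by
  have hd : DifferentiableAt ℝ (fun M : Matrix (Fin n) (Fin n) ℝ => M.det) (N t) :=
    Matrix.contDiff_det.differentiable (by simp) _
  have h1 := hd.hasFDerivAt.comp_hasDerivAt t h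
  have hline : HasDerivAt (fun r : ℝ => N t + r • H) H 0 := by
    exact (((hasDerivAt_id (0 : ℝ)).smul_const H).const_add (N t)).congr_deriv (one_smul _ _)
  have h2 : HasDerivAt (fun r : ℝ => (N t + r • H).det)
      (fderiv ℝ (fun M : Matrix (Fin n) (Fin n) ℝ => M.det) (N t) H) 0 := by
    have hd' : HasFDerivAt (fun M : Matrix (Fin n) (Fin n) ℝ => M.det)
        (fderiv ℝ (fun M : Matrix (Fin n) (Fin n) ℝ => M.det) (N t)) (N t + (0 : ℝ) • H) := by
      simpa using hd.hasFDerivAt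
    exact hd'.comp_hasDerivAt 0 hline
  rw [(hasDerivAt_det_add_smul (N t) H hN).unique h2]
  exact h1

/-- Differentiability is known already; differentiating `N N⁻¹ = 1` and solving gives the value. -/
theorem hasDerivAt_inv_curve {N : ℝ → Matrix (Fin n) (Fin n) ℝ} {H : Matrix (Fin n) (Fin n) ℝ}
    {t : ℝ} (h : HasDerivAt N H t) (hN : 0 < (N t).det) :
    HasDerivAt (fun τ => (N τ)⁻¹) (-((N t)⁻¹ * H * (N t)⁻¹)) t := by
  have hd : DifferentiableAt ℝ (fun M : Matrix (Fin n) (Fin n) ℝ => M⁻¹) (N t) :=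
    (Matrix.contDiffOn_inv.differentiableOn (by simp)).differentiableAt
      (isOpen_det_pos.mem_nhds hN)
  have h1 := (hd.hasFDerivAt.comp_hasDerivAt t h)
  set D := fderiv ℝ (fun M : Matrix (Fin n) (Fin n) ℝ => M⁻¹) (N t) H
  have hpos : ∀ᶠ τ in 𝓝 t, 0 < (N τ).det :=
    h.continuousAt.eventually (isOpen_det_pos.mem_nhds hN)
  have h2 := h.matrix_mul h1
  have h3 : HasDerivAt (fun τ => N τ * (N τ)⁻¹) (0 : Matrix (Fin n) (Fin n) ℝ) t := by
    refine (hasDerivAt_const t (1 : Matrix (Fin n) (Fin n) ℝ)).congr_of_eventuallyEq ?_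
    filter_upwards [hpos] with τ hτ
    exact Matrix.mul_nonsing_inv _ (isUnit_iff_ne_zero.2 hτ.ne')
  have h4 : H * (N t)⁻¹ + N t * D = 0 := h2.unique h3
  have h5 : D = -((N t)⁻¹ * H * (N t)⁻¹) := by
    have h6 : (N t)⁻¹ * (N t * D) = (N t)⁻¹ * (-(H * (N t)⁻¹)) := by
      rw [eq_neg_of_add_eq_zero_right h4]
    rwa [← mul_assoc, Matrix.nonsing_inv_mul _ (isUnit_iff_ne_zero.2 hN.ne'), one_mul, mul_neg,
      ← mul_assoc] at h6
  rw [← h5]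
  exact h1

theorem hasDerivAt_heatConst_curve {N : ℝ → Matrix (Fin n) (Fin n) ℝ}
    {H : Matrix (Fin n) (Fin n) ℝ} {t : ℝ} (h : HasDerivAt N H t) (hN : 0 < (N t).det) :
    HasDerivAt (fun τ => heatConst (N τ)) (-(1 / 2) * ((N t)⁻¹ * H).trace * heatConst (N t)) t := by
  have hpos : 0 < (4 * Real.pi) ^ n * (N t).det := mul_pos (by positivity) hN
  have hs := Real.sqrt_pos.2 hpos
  have h1 := (((hasDerivAt_det_curve h hN.ne').const_mul ((4 * Real.pi) ^ n)).sqrt hpos.ne').inv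
    hs.ne'
  simp only [heatConst, one_div]
  refine h1.congr_deriv ?_
  have h2 : √((4 * Real.pi) ^ n * (N t).det) ^ 2 = (4 * Real.pi) ^ n * (N t).det :=
    Real.sq_sqrt hpos.le
  have h3 : (4 * Real.pi) ^ n * ((N t).det * ((N t)⁻¹ * H).trace) =
    √((4 * Real.pi) ^ n * (N t).det) ^ 2 * ((N t)⁻¹ * H).trace := by rw [h2]; ring
  rw [h3]
  field_simp

theorem mulVec_add_smul_single (Q : Matrix (Fin n) (Fin n) ℝ) (x : Eucl n) (i j : Fin n) (r : ℝ) :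
    Q.mulVec (x + r • EuclideanSpace.single j 1).ofLp i = Q.mulVec x.ofLp i + r * Q i j := by
  simp [Matrix.mulVec_add, Matrix.mulVec_smul]

theorem quadForm_add_smul_single {Q : Matrix (Fin n) (Fin n) ℝ} (hQ : Q.IsSymm) (x : Eucl n)
    (i : Fin n) (r : ℝ) : quadForm Q (x + r • EuclideanSpace.single i 1) =
      quadForm Q x + 2 * r * (Q.mulVec x.ofLp) i + r ^ 2 * Q i i := by
  have h1 : ∑ k, x k * Q k i = Q.mulVec x.ofLp i := by
    simp only [Matrix.mulVec, dotProduct]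
    exact Finset.sum_congr rfl fun k _ => by rw [hQ.apply, mul_comm]
  have h2 : ∀ k, (x + r • EuclideanSpace.single i (1 : ℝ)) k = x k + r * if k = i then 1 else 0 := by
    intro k; simp
  simp only [quadForm, dotProduct, mulVec_add_smul_single, h2]
  simp only [mul_add, add_mul, Finset.sum_add_distrib, mul_ite, ite_mul, mul_one, mul_zero, zero_mul,
    Finset.sum_ite_eq', Finset.mem_univ, if_true]
  have h3 : ∑ k, x k * (r * Q k i) = r * Q.mulVec x.ofLp i := by
    rw [← h1, Finset.mul_sum]
    exact Finset.sum_congr rfl fun k _ => by ring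
  rw [h3]
  ring

theorem hasDerivAt_exp_quadForm_line {Q : Matrix (Fin n) (Fin n) ℝ} (hQ : Q.IsSymm) (x : Eucl n)
    (i : Fin n) : HasDerivAt (fun r : ℝ => Real.exp (-(1 / 4) *
        quadForm Q (x + r • EuclideanSpace.single i 1)))
      (-(1 / 2) * Q.mulVec x.ofLp i * Real.exp (-(1 / 4) * quadForm Q x)) 0 := by
  simp only [quadForm_add_smul_single hQ]
  have h : HasDerivAt (fun r : ℝ => -(1 / 4) *
      (quadForm Q x + 2 * r * (Q.mulVec x.ofLp) i + r ^ 2 * Q i i))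
      (-(1 / 2) * Q.mulVec x.ofLp i) 0 := by
    have := ((((((hasDerivAt_id (0 : ℝ)).const_mul 2).mul_const (Q.mulVec x.ofLp i)).const_add
      (quadForm Q x)).add (((hasDerivAt_id (0 : ℝ)).pow 2).mul_const (Q i i))).const_mul (-(1 / 4)))
    refine this.congr_deriv ?_
    simp
    ring
  refine h.exp.congr_deriv ?_
  simp [mul_comm]

theorem lineDeriv_gaussSchwartz {Q : Matrix (Fin n) (Fin n) ℝ} (hQ : IsCoerciveForm Q)
    (hs : Q.IsSymm) (i : Fin n) (x : Eucl n) :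
    ∂_{(EuclideanSpace.single i (1 : ℝ) : Eucl n)} (gaussSchwartz Q hQ) x =
      ((-(1 / 2) * Q.mulVec x.ofLp i * Real.exp (-(1 / 4) * quadForm Q x) : ℝ) : ℂ) := by
  rw [SchwartzMap.lineDerivOp_apply]
  exact (hasDerivAt_exp_quadForm_line hs x i).ofReal_comp.deriv

theorem lineDeriv_lineDeriv_gaussSchwartz {Q : Matrix (Fin n) (Fin n) ℝ} (hQ : IsCoerciveForm Q)
    (hs : Q.IsSymm) (i j : Fin n) (x : Eucl n) :
    ∂_{(EuclideanSpace.single j (1 : ℝ) : Eucl n)}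
        (∂_{(EuclideanSpace.single i (1 : ℝ) : Eucl n)} (gaussSchwartz Q hQ)) x =
      (((1 / 4 * (Q.mulVec x.ofLp i * Q.mulVec x.ofLp j) - 1 / 2 * Q i j) *
        Real.exp (-(1 / 4) * quadForm Q x) : ℝ) : ℂ) := by
  rw [SchwartzMap.lineDerivOp_apply]
  have h1 : HasDerivAt (fun r : ℝ => Q.mulVec (x + r • EuclideanSpace.single j (1 : ℝ)).ofLp i)
      (Q i j) 0 := by
    simp only [mulVec_add_smul_single]
    exact (((hasDerivAt_id (0 : ℝ)).mul_const (Q i j)).const_add _).congr_deriv (one_mul _)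
  have h2 := ((h1.const_mul (-(1 / 2))).mul (hasDerivAt_exp_quadForm_line hs x j)).ofReal_comp
  simp only [lineDeriv, lineDeriv_gaussSchwartz hQ hs]
  refine h2.deriv.trans ?_
  congr 1
  simp only [zero_smul, add_zero]
  ring

theorem quadForm_conj {Q : Matrix (Fin n) (Fin n) ℝ} (hs : Q.IsSymm)
    (H : Matrix (Fin n) (Fin n) ℝ) (x : Eucl n) :
    quadForm (Q * H * Q) x = ∑ i, ∑ j, H i j * (Q.mulVec x.ofLp i * Q.mulVec x.ofLp j) := by
  have h1 : Matrix.vecMul x.ofLp Q = Q.mulVec x.ofLp := by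
    rw [← Matrix.mulVec_transpose, hs.eq]
  rw [quadForm, ← Matrix.mulVec_mulVec, ← Matrix.mulVec_mulVec, Matrix.dotProduct_mulVec, h1]
  simp only [dotProduct, Matrix.mulVec, Finset.mul_sum]
  refine Finset.sum_congr rfl fun i _ => Finset.sum_congr rfl fun j _ => ?_
  simp only [← Finset.mul_sum]
  ring

/-- For `Q = N⁻¹` the first term matches the derivative of `N⁻¹` in the exponent and the second that
of `(det N)^(-1/2)`. -/
theorem secondOrderSchwartz_gaussSchwartz {Q : Matrix (Fin n) (Fin n) ℝ} (hQ : IsCoerciveForm Q)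
    (hs : Q.IsSymm) (H : Matrix (Fin n) (Fin n) ℝ) (x : Eucl n) :
    secondOrderSchwartz H (gaussSchwartz Q hQ) x =
      (((1 / 4 * quadForm (Q * H * Q) x - 1 / 2 * (Q * H).trace) *
        Real.exp (-(1 / 4) * quadForm Q x) : ℝ) : ℂ) := by
  simp only [secondOrderSchwartz, sum_apply, smul_apply, lineDeriv_lineDeriv_gaussSchwartz hQ hs]
  rw [quadForm_conj hs, Matrix.trace_mul_comm]
  simp only [Matrix.trace, Matrix.diag_apply, Matrix.mul_apply, Finset.mul_sum, sub_mul,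
    Finset.sum_mul, smul_eq_mul, ← Finset.sum_sub_distrib]
  push_cast
  refine Finset.sum_congr rfl fun i _ => Finset.sum_congr rfl fun j _ => ?_
  rw [hs.apply]
  ring

theorem secondOrderSchwartz_smul (c : ℝ) (H : Matrix (Fin n) (Fin n) ℝ) (g : 𝓢(Eucl n, ℂ))
    (x : Eucl n) : secondOrderSchwartz H (c • g) x = c • secondOrderSchwartz H g x := by
  simp only [secondOrderSchwartz, sum_apply, smul_apply, LineDeriv.lineDerivOp_smul, Finset.smul_sum]
  refine Finset.sum_congr rfl fun i _ => Finset.sum_congr rfl fun j _ => ?_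
  rw [smul_comm]

/-- The heat equation for the kernel: along a curve of matrices, the heat Gaussian is differentiable
in `L¹` and its derivative is `∑ N'_{ij} ∂_i ∂_j`. -/
theorem hasDerivAt_heatL1_curve {N : ℝ → Matrix (Fin n) (Fin n) ℝ}
    {H : Matrix (Fin n) (Fin n) ℝ} {t : ℝ} (h : HasDerivAt N H t) (hN : N t ∈ gaussDomain n)
    (hs : (N t).IsSymm) :
    HasDerivAt (fun τ => heatL1 (N τ))
      (schwartzKernel (secondOrderSchwartz H (heatSchwartz (N t) hN))) t := by
  have hone : Function.HasTemperateGrowth fun _ : Eucl n => (1 : ℝ) := .const 1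
  have hs' : ((N t)⁻¹).IsSymm := by
    rw [Matrix.IsSymm, Matrix.transpose_nonsing_inv, hs.eq]
  have h1 := (hasFDerivAt_polyGaussL1 hone hN.2).comp_hasDerivAt t (hasDerivAt_inv_curve h hN.1)
  refine ((hasDerivAt_heatConst_curve h hN.1).smul h1).congr_deriv (Lp.ext ?_)
  set D := polyGaussDeriv (fun _ => 1) (N t)⁻¹ (-((N t)⁻¹ * H * (N t)⁻¹)) with hD
  set c := heatConst (N t) with hc
  set g : KernelSpace n := polyGaussL1 (fun _ => 1) (N t)⁻¹ with hg
  filter_upwards [Lp.coeFn_add (c • D) ((-(1 / 2) * ((N t)⁻¹ * H).trace * c) • g),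
    Lp.coeFn_smul c D, Lp.coeFn_smul (-(1 / 2) * ((N t)⁻¹ * H).trace * c) g,
    coeFn_polyGaussL1 hone hN.2, coeFn_polyGaussDeriv hone hN.2 (-((N t)⁻¹ * H * (N t)⁻¹)),
    coeFn_schwartzKernel (secondOrderSchwartz H (heatSchwartz (N t) hN))] with x e1 e2 e3 e4 e5 e6
  refine e1.trans ?_
  rw [Pi.add_apply, e2, e3, e6, Pi.smul_apply, Pi.smul_apply, hg, e4, hD, e5, heatSchwartz,
    secondOrderSchwartz_smul, secondOrderSchwartz_gaussSchwartz hN.2 hs', ← hc]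
  have hneg : quadForm (-((N t)⁻¹ * H * (N t)⁻¹)) x = -quadForm ((N t)⁻¹ * H * (N t)⁻¹) x := by
    simp [quadForm, Matrix.neg_mulVec]
  simp only [polyGauss, hneg, Complex.real_smul]
  push_cast
  ring

end HeatGaussianDerivative

end MatrixCalculus

/-! ### Positive definite matrices: total mass, and concentration as the trace tends to zero. -/

section PositiveDefinite

variable {n : ℕ}

open scoped MatrixOrder ComplexOrder in
theorem Matrix.PosDef.exists_transpose_mul_self {N : Matrix (Fin n) (Fin n) ℝ} (hN : N.PosDef) :
    ∃ B : Matrix (Fin n) (Fin n) ℝ, N = B.transpose * B := by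
  obtain ⟨B, hB⟩ := CStarAlgebra.nonneg_iff_eq_star_mul_self.mp hN.posSemidef.nonneg
  refine ⟨B, ?_⟩
  rwa [Matrix.star_eq_conjTranspose, Matrix.conjTranspose_eq_transpose_of_trivial] at hB

theorem Matrix.PosDef.isSymm {N : Matrix (Fin n) (Fin n) ℝ} (hN : N.PosDef) : N.IsSymm := by
  have := hN.1
  rwa [Matrix.IsHermitian, Matrix.conjTranspose_eq_transpose_of_trivial] at this

theorem Matrix.PosDef.quadForm_pos {N : Matrix (Fin n) (Fin n) ℝ} (hN : N.PosDef) {x : Eucl n}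
    (hx : x ≠ 0) : 0 < quadForm N x := by
  have := hN.dotProduct_mulVec_pos (x := x.ofLp) (by simpa using hx)
  simpa [quadForm] using this

theorem posDef_of_quadForm_pos {N : Matrix (Fin n) (Fin n) ℝ} (hs : N.IsSymm)
    (h : ∀ x : Eucl n, x ≠ 0 → 0 < quadForm N x) : N.PosDef := by
  refine Matrix.PosDef.of_dotProduct_mulVec_pos
    (by rwa [Matrix.IsHermitian, Matrix.conjTranspose_eq_transpose_of_trivial]) fun x hx => ?_
  have := h (WithLp.toLp 2 x) (by simpa using hx)
  simpa [quadForm] using this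

/-- The action of a matrix on Euclidean space. -/
noncomputable def eucLin (M : Matrix (Fin n) (Fin n) ℝ) : Eucl n →L[ℝ] Eucl n :=
  LinearMap.toContinuousLinearMap (Matrix.toEuclideanLin M)

theorem ofLp_eucLin (M : Matrix (Fin n) (Fin n) ℝ) (x : Eucl n) :
    (eucLin M x).ofLp = M.mulVec x.ofLp := rfl

theorem det_toEuclideanLin (M : Matrix (Fin n) (Fin n) ℝ) :
    LinearMap.det (Matrix.toEuclideanLin M) = M.det := by
  rw [Matrix.toEuclideanLin_eq_toLin_orthonormal, LinearMap.det_toLin]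

theorem quadForm_transpose_mul_self (B : Matrix (Fin n) (Fin n) ℝ) (x : Eucl n) :
    quadForm (B.transpose * B) x = ‖eucLin B x‖ ^ 2 := by
  rw [EuclideanSpace.real_norm_sq_eq, quadForm, ← Matrix.mulVec_mulVec, Matrix.dotProduct_mulVec,
    Matrix.vecMul_transpose]
  simp only [ofLp_eucLin, dotProduct, sq]

theorem Matrix.PosDef.isCoerciveForm {N : Matrix (Fin n) (Fin n) ℝ} (hN : N.PosDef) :
    IsCoerciveForm N := by
  obtain ⟨B, hB⟩ := hN.exists_transpose_mul_self
  have hdet : IsUnit B.det := by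
    have := hN.det_pos
    rw [hB, Matrix.det_mul, Matrix.det_transpose] at this
    exact isUnit_iff_ne_zero.2 fun h => by simp [h] at this
  -- The constant comes from `⟨x, N x⟩ = ‖B x‖²` and `‖x‖ ≤ ‖B⁻¹‖ ‖B x‖`. The added `1` keeps the
  -- denominator positive when `n = 0`.
  refine ⟨1 / (‖eucLin B⁻¹‖ ^ 2 + 1), by positivity, fun x => ?_⟩
  have hx : eucLin B⁻¹ (eucLin B x) = x := by
    apply (WithLp.ofLp_injective 2)
    rw [ofLp_eucLin, ofLp_eucLin, Matrix.mulVec_mulVec, Matrix.nonsing_inv_mul _ hdet,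
      Matrix.one_mulVec]
  have h1 : ‖x‖ ≤ ‖eucLin B⁻¹‖ * ‖eucLin B x‖ := by
    conv_lhs => rw [← hx]
    exact ContinuousLinearMap.le_opNorm _ _
  rw [hB, quadForm_transpose_mul_self, div_mul_eq_mul_div, one_mul, div_le_iff₀ (by positivity)]
  have h2 : ‖x‖ ^ 2 ≤ (‖eucLin B⁻¹‖ * ‖eucLin B x‖) ^ 2 := by gcongr
  nlinarith [sq_nonneg ‖eucLin B x‖]

theorem Matrix.PosDef.mem_gaussDomain {N : Matrix (Fin n) (Fin n) ℝ} (hN : N.PosDef) :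
    N ∈ gaussDomain n := ⟨hN.det_pos, hN.inv.isCoerciveForm⟩

/-- Cauchy–Schwarz in each coordinate: the trace is the squared Hilbert–Schmidt norm of `B`. -/
theorem norm_eucLin_transpose_sq_le (B : Matrix (Fin n) (Fin n) ℝ) (z : Eucl n) :
    ‖eucLin B.transpose z‖ ^ 2 ≤ (B.transpose * B).trace * ‖z‖ ^ 2 := by
  rw [EuclideanSpace.real_norm_sq_eq, EuclideanSpace.real_norm_sq_eq]
  simp only [ofLp_eucLin, Matrix.trace, Matrix.diag_apply, Matrix.mul_apply, Matrix.mulVec,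
    dotProduct, Finset.sum_mul, Matrix.transpose_apply]
  refine Finset.sum_le_sum fun i _ => ?_
  refine (Finset.sum_mul_sq_le_sq_mul_sq _ _ _).trans (le_of_eq ?_)
  rw [Finset.sum_mul]
  exact Finset.sum_congr rfl fun j _ => by ring

/-- Integration against the heat Gaussian of `N` is integration against the standard one,
after a linear change of variables. -/
theorem Matrix.PosDef.exists_integral_heatGaussian {N : Matrix (Fin n) (Fin n) ℝ}
    (hN : N.PosDef) : ∃ L : Eucl n →L[ℝ] Eucl n, (∀ z, ‖L z‖ ^ 2 ≤ N.trace * ‖z‖ ^ 2) ∧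
      ∀ F : Eucl n → ℝ, Continuous F → ∫ x, heatGaussian N x * F x =
        ∫ z, heatGaussian (1 : Matrix (Fin n) (Fin n) ℝ) z * F (L z) := by
  obtain ⟨B, hB⟩ := hN.exists_transpose_mul_self
  have hdet : B.det ≠ 0 := by
    have := hN.det_pos
    rw [hB, Matrix.det_mul, Matrix.det_transpose] at this
    exact fun h => by simp [h] at this
  have hdet' : LinearMap.det (Matrix.toEuclideanLin B.transpose) ≠ 0 := by
    rwa [det_toEuclideanLin, Matrix.det_transpose]
  refine ⟨eucLin B.transpose, fun z => hB ▸ norm_eucLin_transpose_sq_le B z, fun F hF => ?_⟩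
  -- With `N = Bᵀ B` and `x = Bᵀ z` the form `⟨x, N⁻¹ x⟩` becomes `‖z‖²`, and the Jacobian `|det B|
  -- = √(det N)` cancels the normalization.
  have hq : ∀ z, quadForm N⁻¹ (eucLin B.transpose z) = quadForm (1 : Matrix (Fin n) (Fin n) ℝ)⁻¹ z := by
    intro z
    rw [hB, Matrix.mul_inv_rev, quadForm, ofLp_eucLin, quadForm, inv_one, Matrix.one_mulVec,
      Matrix.mulVec_mulVec, Matrix.mul_assoc, Matrix.nonsing_inv_mul _ (by
        rw [Matrix.det_transpose]; exact isUnit_iff_ne_zero.2 hdet), mul_one,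
      Matrix.dotProduct_mulVec, Matrix.mulVec_transpose, Matrix.vecMul_vecMul,
      Matrix.mul_nonsing_inv _ (isUnit_iff_ne_zero.2 hdet), Matrix.vecMul_one]
  have hc : heatConst N * |B.det| = heatConst (1 : Matrix (Fin n) (Fin n) ℝ) := by
    have h1 : √((4 * Real.pi) ^ n * N.det) = √((4 * Real.pi) ^ n) * |B.det| := by
      rw [hB, Matrix.det_mul, Matrix.det_transpose, Real.sqrt_mul (by positivity), ← sq,
        Real.sqrt_sq_eq_abs]
    have h2 : |B.det| ≠ 0 := abs_ne_zero.2 hdet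
    have h3 : √((4 * Real.pi) ^ n) ≠ 0 := (Real.sqrt_pos.2 (by positivity)).ne'
    rw [heatConst, heatConst, h1, Matrix.det_one, mul_one]
    field_simp
  have hcont : Continuous fun x => heatGaussian N x * F x := by
    refine Continuous.mul (continuous_const.mul (Real.continuous_exp.comp
      (continuous_const.mul ?_))) hF
    exact (hasTemperateGrowth_quadForm _).1.continuous
  have hmap := Measure.map_linearMap_addHaar_eq_smul_addHaar (volume : Measure (Eucl n)) hdet'
  have h4 : ∫ z, heatGaussian N (eucLin B.transpose z) * F (eucLin B.transpose z) =
      |B.det|⁻¹ * ∫ x, heatGaussian N x * F x := by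
    have h5 := integral_map (μ := (volume : Measure (Eucl n)))
      (eucLin B.transpose).continuous.measurable.aemeasurable (f := fun x => heatGaussian N x * F x)
      hcont.aestronglyMeasurable
    rw [← h5]
    change ∫ y, _ ∂(Measure.map (Matrix.toEuclideanLin B.transpose) volume) = _
    rw [hmap, integral_smul_measure, det_toEuclideanLin, Matrix.det_transpose,
      ENNReal.toReal_ofReal (abs_nonneg _), abs_inv, smul_eq_mul]
  have h6 : ∫ x, heatGaussian N x * F x = |B.det| *
      ∫ z, heatGaussian N (eucLin B.transpose z) * F (eucLin B.transpose z) := by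
    rw [h4, mul_inv_cancel_left₀ (abs_ne_zero.2 hdet)]
  rw [h6, ← integral_const_mul]
  refine integral_congr_ae (Eventually.of_forall fun z => ?_)
  simp only [heatGaussian, hq, ← hc]
  ring

theorem heatConst_nonneg (N : Matrix (Fin n) (Fin n) ℝ) : 0 ≤ heatConst N := by
  unfold heatConst; positivity

theorem heatGaussian_nonneg (N : Matrix (Fin n) (Fin n) ℝ) (x : Eucl n) : 0 ≤ heatGaussian N x :=
  mul_nonneg (heatConst_nonneg N) (Real.exp_pos _).le

theorem heatGaussian_neg (N : Matrix (Fin n) (Fin n) ℝ) (x : Eucl n) :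
    heatGaussian N (-x) = heatGaussian N x := by
  simp [heatGaussian, quadForm, Matrix.mulVec_neg]

theorem integrable_heatGaussian {N : Matrix (Fin n) (Fin n) ℝ} (hN : N ∈ gaussDomain n) :
    Integrable (heatGaussian N) := by
  have h := (integrable_polyGauss (Function.HasTemperateGrowth.const (1 : ℝ)) hN.2).re
  refine (h.const_mul (heatConst N)).congr (Eventually.of_forall fun x => ?_)
  simp only [polyGauss, one_mul, RCLike.re_to_complex, Complex.ofReal_re, heatGaussian]

theorem integral_heatGaussian_one : ∫ x, heatGaussian (1 : Matrix (Fin n) (Fin n) ℝ) x = 1 := by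
  have h : ∀ x : Eucl n, quadForm (1 : Matrix (Fin n) (Fin n) ℝ)⁻¹ x = ‖x‖ ^ 2 := by
    intro x
    have := quadForm_smul_one (n := n) 1 x
    rwa [one_smul, one_mul, ← inv_one] at this
  simp only [heatGaussian, h, integral_const_mul]
  rw [GaussianFourier.integral_rexp_neg_mul_sq_norm (by norm_num : (0 : ℝ) < 1 / 4)]
  have hpi : (0 : ℝ) < 4 * Real.pi := by positivity
  rw [heatConst, Matrix.det_one, mul_one, finrank_euclideanSpace_fin, div_div_eq_mul_div, div_one,
    mul_comm Real.pi, Real.sqrt_eq_rpow, ← Real.rpow_natCast, ← Real.rpow_mul hpi.le,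
    mul_one_div, one_div, inv_mul_cancel₀ (Real.rpow_pos_of_pos hpi _).ne']

theorem Matrix.PosDef.integral_heatGaussian {N : Matrix (Fin n) (Fin n) ℝ} (hN : N.PosDef) :
    ∫ x, heatGaussian N x = 1 := by
  obtain ⟨L, -, hL⟩ := hN.exists_integral_heatGaussian
  have := hL (fun _ => 1) continuous_const
  simpa [integral_heatGaussian_one] using this

theorem Matrix.PosDef.norm_heatL1 {N : Matrix (Fin n) (Fin n) ℝ} (hN : N.PosDef) :
    ‖heatL1 N‖ = 1 := by
  rw [L1.norm_eq_integral_norm, ← hN.integral_heatGaussian]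
  refine integral_congr_ae ?_
  filter_upwards [coeFn_heatL1 hN.mem_gaussDomain] with x hx
  rw [hx, Complex.norm_real, Real.norm_of_nonneg (heatGaussian_nonneg N x)]

theorem Matrix.PosDef.integral_heatL1 {N : Matrix (Fin n) (Fin n) ℝ} (hN : N.PosDef) :
    ∫ x, heatL1 N x = 1 := by
  rw [integral_congr_ae (coeFn_heatL1 hN.mem_gaussDomain), integral_complex_ofReal,
    hN.integral_heatGaussian, Complex.ofReal_one]

theorem Matrix.PosDef.heatL1_even {N : Matrix (Fin n) (Fin n) ℝ} (hN : N.PosDef) :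
    ∀ᵐ x, heatL1 N (-x) = heatL1 N x := by
  filter_upwards [coeFn_heatL1 hN.mem_gaussDomain,
    (Measure.measurePreserving_neg (volume : Measure (Eucl n))).quasiMeasurePreserving.ae_eq_comp
      (coeFn_heatL1 hN.mem_gaussDomain)] with x h1 h2
  simp only [Function.comp_apply] at h2
  rw [h1, h2, heatGaussian_neg]

/-- Heat Gaussians form an approximate identity as the covariance tends to zero. -/
theorem isApproximateIdentity_heatL1 {ι : Type*} {l : Filter ι} [l.IsCountablyGenerated]
    {N : ι → Matrix (Fin n) (Fin n) ℝ} (hpos : ∀ᶠ i in l, (N i).PosDef)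
    (htr : Tendsto (fun i => (N i).trace) l (𝓝 0)) :
    IsApproximateIdentity l fun i => heatL1 (N i) := by
  refine ⟨hpos.mono fun i hi => hi.integral_heatL1, fun w hw ⟨C, hC⟩ hw0 => ?_⟩
  -- Indices at which `N i` is not positive definite receive the value `L = 0`; they are eventually
  -- absent.
  have hex : ∀ i, ∃ L : Eucl n →L[ℝ] Eucl n, (N i).PosDef →
      (∀ z, ‖L z‖ ^ 2 ≤ (N i).trace * ‖z‖ ^ 2) ∧
      ∀ F : Eucl n → ℝ, Continuous F → ∫ x, heatGaussian (N i) x * F x =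
        ∫ z, heatGaussian (1 : Matrix (Fin n) (Fin n) ℝ) z * F (L z) := by
    intro i
    by_cases h : (N i).PosDef
    · obtain ⟨L, hL⟩ := h.exists_integral_heatGaussian
      exact ⟨L, fun _ => hL⟩
    · exact ⟨0, fun h' => absurd h' h⟩
  choose L hL using hex
  have hg1 := integrable_heatGaussian (Matrix.PosDef.one (n := Fin n) (R := ℝ)).mem_gaussDomain
  -- All integrals now refer to one fixed Gaussian, with `L i z → 0` by the trace bound, and
  -- dominated convergence applies.
  have hlim : Tendsto (fun i => ∫ z, heatGaussian (1 : Matrix (Fin n) (Fin n) ℝ) z * w (L i z)) l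
      (𝓝 (∫ _z : Eucl n, (0 : ℝ))) := by
    refine tendsto_integral_filter_of_dominated_convergence
      (fun z => heatGaussian (1 : Matrix (Fin n) (Fin n) ℝ) z * C)
      (Eventually.of_forall fun i => hg1.1.mul (hw.comp (L i).continuous).aestronglyMeasurable)
      (Eventually.of_forall fun i => Eventually.of_forall fun z => ?_) (hg1.mul_const C)
      (Eventually.of_forall fun z => ?_)
    · rw [norm_mul, Real.norm_of_nonneg (heatGaussian_nonneg _ z)]
      exact mul_le_mul_of_nonneg_left (hC _) (heatGaussian_nonneg _ z)
    · have h1 : Tendsto (fun i => ‖L i z‖ ^ 2) l (𝓝 0) := by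
        refine squeeze_zero' (Eventually.of_forall fun i => by positivity)
          (hpos.mono fun i hi => (hL i hi).1 z) ?_
        simpa using htr.mul_const (‖z‖ ^ 2)
      have h2 : Tendsto (fun i => L i z) l (𝓝 0) := by
        rw [tendsto_zero_iff_norm_tendsto_zero]
        have := (Real.continuous_sqrt.tendsto 0).comp h1
        rw [Real.sqrt_zero] at this
        exact this.congr fun i => Real.sqrt_sq (norm_nonneg _)
      have h3 := ((hw.tendsto 0).comp h2).const_mul
        (heatGaussian (1 : Matrix (Fin n) (Fin n) ℝ) z)
      rw [hw0, mul_zero] at h3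
      exact h3
  rw [integral_zero] at hlim
  refine hlim.congr' ?_
  filter_upwards [hpos] with i hi
  rw [← (hL i hi).2 w hw]
  refine integral_congr_ae ?_
  filter_upwards [coeFn_heatL1 hi.mem_gaussDomain] with x hx
  rw [hx, Complex.norm_real, Real.norm_of_nonneg (heatGaussian_nonneg _ x)]

end PositiveDefinite

/-! ### Dilations of `L¹`: contractions, strongly continuous in the scale. -/

section Dilation

variable {n : ℕ}

/-- The `L¹`-normalized dilation `ρ^{-n} k(x / ρ)`. -/
noncomputable def dilFun (ρ : ℝ) (k : Eucl n → ℂ) (x : Eucl n) : ℂ := (|ρ| ^ n)⁻¹ • k (ρ⁻¹ • x)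

theorem integrable_dilFun {ρ : ℝ} (hρ : ρ ≠ 0) {k : Eucl n → ℂ} (hk : Integrable k) :
    Integrable (dilFun ρ k) := by
  unfold dilFun
  exact (hk.comp_smul (inv_ne_zero hρ)).smul (|ρ| ^ n)⁻¹

theorem dilFun_congr {ρ : ℝ} (hρ : ρ ≠ 0) {k k' : Eucl n → ℂ} (h : k =ᵐ[volume] k') :
    dilFun ρ k =ᵐ[volume] dilFun ρ k' := by
  filter_upwards [(Measure.quasiMeasurePreserving_smul (volume : Measure (Eucl n))
    (inv_ne_zero hρ)).ae_eq_comp h] with x hx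
  simp only [Function.comp_apply] at hx
  rw [dilFun, dilFun, hx]

theorem integral_norm_dilFun {ρ : ℝ} (hρ : ρ ≠ 0) (k : Eucl n → ℂ) :
    ∫ x, ‖dilFun ρ k x‖ = ∫ x, ‖k x‖ := by
  have h0 : |ρ| ^ n ≠ 0 := pow_ne_zero _ (abs_ne_zero.2 hρ)
  simp only [dilFun, norm_smul, integral_const_mul]
  rw [Measure.integral_comp_inv_smul (volume : Measure (Eucl n)) (fun x => ‖k x‖) ρ,
    finrank_euclideanSpace_fin, abs_pow, smul_eq_mul, norm_inv, Real.norm_of_nonneg (by positivity),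
    inv_mul_cancel_left₀ h0]

open Classical in
/-- The dilation of a kernel (with value `0` for `ρ = 0`). -/
noncomputable def dilL1 (ρ : ℝ) (k : KernelSpace n) : KernelSpace n :=
  if hρ : ρ = 0 then 0
  else (memLp_one_iff_integrable.2 (integrable_dilFun hρ (integrable_kernel k))).toLp

theorem coeFn_dilL1 {ρ : ℝ} (hρ : ρ ≠ 0) (k : KernelSpace n) :
    dilL1 ρ k =ᵐ[volume] dilFun ρ k := by
  rw [dilL1, dif_neg hρ]
  exact MemLp.coeFn_toLp _

theorem dilL1_add (ρ : ℝ) (k k' : KernelSpace n) : dilL1 ρ (k + k') = dilL1 ρ k + dilL1 ρ k' := by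
  by_cases hρ : ρ = 0
  · simp [dilL1, hρ]
  refine Lp.ext ?_
  filter_upwards [coeFn_dilL1 hρ (k + k'), coeFn_dilL1 hρ k, coeFn_dilL1 hρ k',
    Lp.coeFn_add (dilL1 ρ k) (dilL1 ρ k'), dilFun_congr hρ (Lp.coeFn_add k k')] with x h1 h2 h3 h4 h5
  rw [h1, h5, h4, Pi.add_apply, h2, h3]
  simp [dilFun]

theorem dilL1_smul (ρ c : ℝ) (k : KernelSpace n) : dilL1 ρ (c • k) = c • dilL1 ρ k := by
  by_cases hρ : ρ = 0
  · simp [dilL1, hρ]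
  refine Lp.ext ?_
  filter_upwards [coeFn_dilL1 hρ (c • k), coeFn_dilL1 hρ k, Lp.coeFn_smul c (dilL1 ρ k),
    dilFun_congr hρ (Lp.coeFn_smul c k)] with x h1 h2 h4 h5
  rw [h1, h5, h4, Pi.smul_apply, h2]
  simp only [dilFun, Pi.smul_apply]
  rw [smul_comm]

theorem norm_dilL1_le (ρ : ℝ) (k : KernelSpace n) : ‖dilL1 ρ k‖ ≤ ‖k‖ := by
  by_cases hρ : ρ = 0
  · simp [dilL1, hρ]
  rw [L1.norm_eq_integral_norm, L1.norm_eq_integral_norm, ← integral_norm_dilFun hρ k]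
  refine le_of_eq (integral_congr_ae ?_)
  filter_upwards [coeFn_dilL1 hρ k] with x hx
  rw [hx]

/-- The dilation as a bounded operator. -/
noncomputable def dilCLM (n : ℕ) (ρ : ℝ) : KernelSpace n →L[ℝ] KernelSpace n :=
  LinearMap.mkContinuous
    { toFun := dilL1 ρ
      map_add' := dilL1_add ρ
      map_smul' := fun c k => dilL1_smul ρ c k } 1
    fun k => by simpa using norm_dilL1_le ρ k

theorem dilCLM_apply (ρ : ℝ) (k : KernelSpace n) : dilCLM n ρ k = dilL1 ρ k := rfl

/-- For scales in `[ρ₀/2, 2ρ₀]` the dilates of `g` are uniformly bounded and live in one ball, so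
dominated convergence applies. -/
theorem tendsto_dilFun {g : Eucl n → ℂ} (hg : Continuous g) (hs : HasCompactSupport g) {ρ₀ : ℝ}
    (hρ₀ : 0 < ρ₀) :
    Tendsto (fun ρ => ∫ x, ‖dilFun ρ g x - dilFun ρ₀ g x‖) (𝓝 ρ₀) (𝓝 0) := by
  obtain ⟨C, hC⟩ := hg.bounded_above_of_compact_support hs
  obtain ⟨R, hR⟩ := hs.isCompact.isBounded.subset_closedBall 0
  have hC0 : 0 ≤ C := (norm_nonneg _).trans (hC 0)
  have hcont : ∀ ρ, AEStronglyMeasurable (dilFun ρ g) volume := by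
    intro ρ
    have : Continuous (dilFun ρ g) := by
      unfold dilFun
      fun_prop
    exact this.aestronglyMeasurable
  have hbd : ∀ ρ, ρ₀ / 2 ≤ ρ → ρ ≤ 2 * ρ₀ → ∀ x, ‖dilFun ρ g x‖ ≤
      (Metric.closedBall (0 : Eucl n) (2 * ρ₀ * R)).indicator (fun _ => ((ρ₀ / 2) ^ n)⁻¹ * C) x := by
    intro ρ h1 h2 x
    have hρ : 0 < ρ := by linarith
    by_cases hx : x ∈ Metric.closedBall (0 : Eucl n) (2 * ρ₀ * R)
    · rw [indicator_of_mem hx, dilFun, norm_smul, norm_inv, norm_pow, Real.norm_eq_abs, abs_abs,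
        abs_of_pos hρ]
      gcongr
      exact hC _
    · rw [indicator_of_notMem hx]
      have : g (ρ⁻¹ • x) = 0 := by
        by_contra hne
        have h3 := hR (subset_tsupport _ hne)
        rw [mem_closedBall_zero_iff, norm_smul, norm_inv, Real.norm_of_nonneg hρ.le,
          inv_mul_le_iff₀ hρ] at h3
        apply hx
        rw [mem_closedBall_zero_iff]
        have hR0 : 0 ≤ R := by
          by_contra hR0
          nlinarith [norm_nonneg x]
        exact h3.trans (by gcongr)
      simp [dilFun, this]
  have hρ2 : ∀ᶠ ρ in 𝓝 ρ₀, ρ₀ / 2 ≤ ρ ∧ ρ ≤ 2 * ρ₀ :=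
    (eventually_ge_nhds (by linarith)).and (eventually_le_nhds (by linarith))
  have hlim := tendsto_integral_filter_of_dominated_convergence (μ := (volume : Measure (Eucl n)))
    (F := fun ρ x => ‖dilFun ρ g x - dilFun ρ₀ g x‖) (f := fun _ => (0 : ℝ)) (l := 𝓝 ρ₀)
    (fun x => 2 * (Metric.closedBall (0 : Eucl n) (2 * ρ₀ * R)).indicator
      (fun _ => ((ρ₀ / 2) ^ n)⁻¹ * C) x)
    (Eventually.of_forall fun ρ => ((hcont ρ).sub (hcont ρ₀)).norm)
    (by
      filter_upwards [hρ2] with ρ hρ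
      refine Eventually.of_forall fun x => ?_
      rw [norm_norm]
      refine (norm_sub_le _ _).trans ?_
      linarith [hbd ρ hρ.1 hρ.2 x, hbd ρ₀ (by linarith) (by linarith) x])
    (((integrable_indicator_iff measurableSet_closedBall).2
      (integrableOn_const (measure_closedBall_lt_top.ne))).const_mul 2)
    (Eventually.of_forall fun x => by
      have hc : ContinuousAt (fun ρ => dilFun ρ g x) ρ₀ := by
        refine ContinuousAt.fun_smul (f := fun ρ : ℝ => (|ρ| ^ n)⁻¹) (g := fun ρ => g (ρ⁻¹ • x)) ?_ ?_
        · exact (continuousAt_id.abs.pow n).inv₀ (pow_ne_zero _ (abs_ne_zero.2 hρ₀.ne'))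
        · exact hg.continuousAt.comp ((continuousAt_inv₀ hρ₀.ne').smul continuousAt_const)
      have := (hc.tendsto.sub_const (dilFun ρ₀ g x)).norm
      simpa using this)
  simpa using hlim

/-- Dilations are strongly continuous on `L¹`. -/
theorem continuousAt_dilL1 (k : KernelSpace n) {ρ₀ : ℝ} (hρ₀ : 0 < ρ₀) :
    ContinuousAt (fun ρ => dilL1 ρ k) ρ₀ := by
  rw [Metric.continuousAt_iff']
  intro ε hε
  -- Approximation by a compactly supported continuous `g`: the two contractions each cost at most
  -- `ε / 4`, and the dilates of `g` less than `ε / 2`.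
  obtain ⟨g, hgs, hgk, hgc, hgi⟩ := (integrable_kernel k).exists_hasCompactSupport_integral_sub_le
    (ε := ε / 4) (by linarith)
  set G : KernelSpace n := (memLp_one_iff_integrable.2 hgi).toLp with hG
  have hGg : G =ᵐ[volume] g := MemLp.coeFn_toLp _
  have hkG : ‖k - G‖ ≤ ε / 4 := by
    refine le_trans (le_of_eq ?_) hgk
    rw [L1.norm_eq_integral_norm]
    refine integral_congr_ae ?_
    filter_upwards [Lp.coeFn_sub k G, hGg] with x h1 h2
    rw [h1, Pi.sub_apply, h2]
  have hd : ∀ ρ, 0 < ρ → ‖dilL1 ρ G - dilL1 ρ₀ G‖ = ∫ x, ‖dilFun ρ g x - dilFun ρ₀ g x‖ := by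
    intro ρ hρ
    rw [L1.norm_eq_integral_norm]
    refine integral_congr_ae ?_
    filter_upwards [Lp.coeFn_sub (dilL1 ρ G) (dilL1 ρ₀ G), coeFn_dilL1 hρ.ne' G,
      coeFn_dilL1 hρ₀.ne' G, dilFun_congr hρ.ne' hGg, dilFun_congr hρ₀.ne' hGg] with x h1 h2 h3 h4 h5
    rw [h1, Pi.sub_apply, h2, h3, h4, h5]
  have hev := (tendsto_dilFun hgc hgs hρ₀).eventually (gt_mem_nhds (half_pos hε))
  filter_upwards [hev, eventually_gt_nhds hρ₀] with ρ h1 h2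
  rw [← hd ρ h2] at h1
  have e1 : dilL1 ρ k - dilL1 ρ₀ k =
      dilL1 ρ (k - G) - dilL1 ρ₀ (k - G) + (dilL1 ρ G - dilL1 ρ₀ G) := by
    have h3 : ∀ ρ, dilL1 ρ (k - G) = dilL1 ρ k - dilL1 ρ G := fun ρ => map_sub (dilCLM n ρ) k G
    rw [h3, h3]; abel
  rw [dist_eq_norm, e1]
  have h4 := norm_add_le (dilL1 ρ (k - G) - dilL1 ρ₀ (k - G)) (dilL1 ρ G - dilL1 ρ₀ G)
  have h5 := norm_sub_le (dilL1 ρ (k - G)) (dilL1 ρ₀ (k - G))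
  linarith [norm_dilL1_le ρ (k - G), norm_dilL1_le ρ₀ (k - G)]

/-- This moves a degenerating scalar factor of the matrix out of the Gaussian and into a contraction
of `L¹`. -/
theorem dilL1_heatL1 {r : ℝ} (hr : 0 < r) {N : Matrix (Fin n) (Fin n) ℝ} (hN : N.PosDef) :
    dilL1 (√r) (heatL1 N) = heatL1 (r • N) := by
  have hs : 0 < √r := Real.sqrt_pos.2 hr
  refine Lp.ext ?_
  filter_upwards [coeFn_dilL1 hs.ne' (heatL1 N), coeFn_heatL1 (hN.smul hr).mem_gaussDomain,
    dilFun_congr hs.ne' (coeFn_heatL1 hN.mem_gaussDomain)] with x h1 h2 h3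
  rw [h1, h2, h3, dilFun, Complex.real_smul, ← Complex.ofReal_mul]
  congr 1
  have hinv : (r • N)⁻¹ = r⁻¹ • N⁻¹ := by
    refine Matrix.inv_eq_left_inv ?_
    rw [smul_mul_smul_comm, inv_mul_cancel₀ hr.ne', one_smul,
      Matrix.nonsing_inv_mul _ (isUnit_iff_ne_zero.2 hN.det_pos.ne')]
  have hq : quadForm (r • N)⁻¹ x = quadForm N⁻¹ ((√r)⁻¹ • x) := by
    rw [hinv]
    simp only [quadForm, Matrix.smul_mulVec, WithLp.ofLp_smul, Matrix.mulVec_smul, dotProduct_smul,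
      smul_dotProduct, smul_eq_mul]
    rw [← mul_assoc, ← mul_inv, Real.mul_self_sqrt hr.le]
  have hc : heatConst (r • N) = (|√r| ^ n)⁻¹ * heatConst N := by
    have h4 : √((4 * Real.pi) ^ n * (r • N).det) = √r ^ n * √((4 * Real.pi) ^ n * N.det) := by
      rw [Matrix.det_smul, Fintype.card_fin, mul_left_comm, Real.sqrt_mul (by positivity)]
      congr 1
      rw [Real.sqrt_eq_iff_mul_self_eq (by positivity) (by positivity), ← mul_pow,
        Real.mul_self_sqrt hr.le]
    rw [heatConst, h4, heatConst, abs_of_pos hs, one_div, one_div, mul_inv]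
  rw [heatGaussian, heatGaussian, hq, hc]
  ring

end Dilation

open scoped Interval

/-! ### Differentiation under the integral with a strongly continuous family of contractions. -/

section ParametricIntegral

variable {P E₁ E₂ F : Type*} [NormedAddCommGroup P] [NormedSpace ℝ P]
  [NormedAddCommGroup E₁] [NormedSpace ℝ E₁] [NormedAddCommGroup E₂] [NormedSpace ℝ E₂]
  [NormedAddCommGroup F] [NormedSpace ℝ F]

/-- The partial derivative with respect to the first, real, variable. -/
noncomputable def partialDeriv (K : ℝ × P → E₁) (z : ℝ × P) : E₁ := fderiv ℝ K z (1, 0)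

theorem contDiffOn_partialDeriv {K : ℝ × P → E₁} {U : Set (ℝ × P)} (hU : IsOpen U)
    (hK : ContDiffOn ℝ ∞ K U) : ContDiffOn ℝ ∞ (partialDeriv K) U :=
  (hK.fderiv_of_isOpen hU (by simp)).clm_apply contDiffOn_const

theorem hasDerivAt_partialDeriv {K : ℝ × P → E₁} {U : Set (ℝ × P)} (hU : IsOpen U)
    (hK : ContDiffOn ℝ ∞ K U) {t : ℝ} {p : P} (h : (t, p) ∈ U) :
    HasDerivAt (fun τ => K (τ, p)) (partialDeriv K (t, p)) t := by
  have h1 : HasFDerivAt K (fderiv ℝ K (t, p)) (t, p) :=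
    ((hK.contDiffAt (hU.mem_nhds h)).differentiableAt (by simp)).hasFDerivAt
  have h2 : HasDerivAt (fun τ : ℝ => (τ, p)) (1, 0) t := (hasDerivAt_id t).prodMk (hasDerivAt_const t p)
  exact h1.comp_hasDerivAt t h2

/-- A uniform bound upgrades strong continuity to continuity along moving arguments. Norm continuity
in `θ` would be too much to ask of dilations. -/
theorem continuousOn_clm_of_strong {Φ : ℝ → E₁ →L[ℝ] F} {s : Set ℝ} {k : ℝ → E₁}
    (hb : ∀ θ ∈ s, ∀ k, ‖Φ θ k‖ ≤ ‖k‖) (hc : ∀ k, ContinuousOn (fun θ => Φ θ k) s)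
    (hk : ContinuousOn k s) : ContinuousOn (fun θ => Φ θ (k θ)) s := by
  intro θ₀ hθ₀
  rw [ContinuousWithinAt, tendsto_iff_norm_sub_tendsto_zero]
  have h1 := (tendsto_iff_norm_sub_tendsto_zero.1 (hk θ₀ hθ₀)).add
    (tendsto_iff_norm_sub_tendsto_zero.1 (hc (k θ₀) θ₀ hθ₀))
  rw [add_zero] at h1
  refine squeeze_zero' (Eventually.of_forall fun _ => norm_nonneg _) ?_ h1
  filter_upwards [self_mem_nhdsWithin] with θ hθ
  have e : Φ θ (k θ) - Φ θ₀ (k θ₀) = Φ θ (k θ - k θ₀) + (Φ θ (k θ₀) - Φ θ₀ (k θ₀)) := by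
    rw [map_sub]; abel
  rw [e]
  exact (norm_add_le _ _).trans (by gcongr; exact hb θ hθ _)

/-- The image of a compact rectangle is compact. Only continuity of `p` enters, so data merely
continuous in `θ` may be hidden in `p`. -/
theorem exists_bound_on_strip {X : Type*} [NormedAddCommGroup X] [NormedSpace ℝ X] {α β : ℝ}
    {p : ℝ → P} {U : Set (ℝ × P)} {I : Set ℝ} {H : ℝ × P → X} {c d : ℝ}
    (hp : ContinuousOn p (Icc α β)) (hIU : ∀ t ∈ I, ∀ θ ∈ Icc α β, (t, p θ) ∈ U)
    (hsub : Icc c d ⊆ I) (hH : ContDiffOn ℝ ∞ H U) :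
    ∃ C, 0 ≤ C ∧ ∀ τ ∈ Icc c d, ∀ θ ∈ Icc α β, ‖H (τ, p θ)‖ ≤ C := by
  have hcomp : IsCompact ((fun z : ℝ × ℝ => (z.1, p z.2)) '' (Icc c d ×ˢ Icc α β)) :=
    (isCompact_Icc.prod isCompact_Icc).image_of_continuousOn
      (continuousOn_fst.prodMk (hp.comp continuousOn_snd fun z hz => hz.2))
  obtain ⟨C, hC⟩ := hcomp.exists_bound_of_continuousOn (hH.continuousOn.mono (by
    rintro _ ⟨z, hz, rfl⟩
    exact hIU _ (hsub hz.1) _ hz.2))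
  refine ⟨max C 0, le_max_right _ _, fun τ hτ θ hθ => ?_⟩
  exact (hC _ ⟨(τ, θ), ⟨hτ, hθ⟩, rfl⟩).trans (le_max_left _ _)

variable {Φ : ℝ → E₁ →L[ℝ] E₂ →L[ℝ] F} {α β : ℝ} {p : ℝ → P} {U : Set (ℝ × P)} {I : Set ℝ}
  {K : ℝ × P → E₁} {g : ℝ × P → E₂}

/-- Dominated differentiation, with constant bounds from compactness. `Φ` is controlled only on `[α,
β)` because it may degenerate at `β`, a null set. -/
theorem hasDerivAt_parametric_integral (hαβ : α ≤ β) (hp : ContinuousOn p (Icc α β))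
    (hU : IsOpen U) (hI : IsOpen I) (hIU : ∀ t ∈ I, ∀ θ ∈ Icc α β, (t, p θ) ∈ U)
    (hb : ∀ θ ∈ Ico α β, ∀ k, ‖Φ θ k‖ ≤ ‖k‖)
    (hc : ∀ k, ContinuousOn (fun θ => Φ θ k) (Ico α β))
    (hK : ContDiffOn ℝ ∞ K U) (hg : ContDiffOn ℝ ∞ g U) {t : ℝ} (ht : t ∈ I) :
    HasDerivAt (fun t => ∫ θ in α..β, Φ θ (K (t, p θ)) (g (t, p θ)))
      ((∫ θ in α..β, Φ θ (partialDeriv K (t, p θ)) (g (t, p θ))) +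
        ∫ θ in α..β, Φ θ (K (t, p θ)) (partialDeriv g (t, p θ))) t := by
  have hK' := contDiffOn_partialDeriv hU hK
  have hg' := contDiffOn_partialDeriv hU hg
  have hcp : ∀ τ ∈ I, ContinuousOn (fun θ => (τ, p θ)) (Icc α β) := fun τ _ =>
    continuousOn_const.prodMk hp
  have hcont : ∀ {K₁ : ℝ × P → E₁} {g₁ : ℝ × P → E₂}, ContDiffOn ℝ ∞ K₁ U → ContDiffOn ℝ ∞ g₁ U →
      ∀ τ ∈ I, ContinuousOn (fun θ => Φ θ (K₁ (τ, p θ)) (g₁ (τ, p θ))) (Ico α β) := by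
    intro K₁ g₁ h1 h2 τ hτ
    refine ContinuousOn.clm_apply (continuousOn_clm_of_strong hb hc ?_) ?_
    · exact (h1.continuousOn.comp (hcp τ hτ) (hIU τ hτ)).mono Ico_subset_Icc_self
    · exact (h2.continuousOn.comp (hcp τ hτ) (hIU τ hτ)).mono Ico_subset_Icc_self
  have hmeas : ∀ {G : ℝ → F}, ContinuousOn G (Ico α β) →
      AEStronglyMeasurable G (volume.restrict (Ι α β)) := by
    intro G hG
    rw [uIoc_of_le hαβ, ← restrict_Ico_eq_restrict_Ioc]
    exact hG.aestronglyMeasurable measurableSet_Ico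
  obtain ⟨ε, hε, hεI⟩ := Metric.isOpen_iff.1 hI t ht
  have hsub : Icc (t - ε / 2) (t + ε / 2) ⊆ I := by
    intro τ hτ
    apply hεI
    rw [Metric.mem_ball, Real.dist_eq, abs_lt]
    constructor <;> linarith [hτ.1, hτ.2]
  obtain ⟨C1, hC1, hK1⟩ := exists_bound_on_strip hp hIU hsub hK
  obtain ⟨C2, hC2, hK2⟩ := exists_bound_on_strip hp hIU hsub hK'
  obtain ⟨C3, hC3, hg1⟩ := exists_bound_on_strip hp hIU hsub hg
  obtain ⟨C4, hC4, hg2⟩ := exists_bound_on_strip hp hIU hsub hg'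
  have hest : ∀ θ ∈ Ico α β, ∀ k e c d, ‖k‖ ≤ c → ‖e‖ ≤ d → 0 ≤ c → ‖Φ θ k e‖ ≤ c * d := by
    intro θ hθ k e c d hk he hc0
    exact (ContinuousLinearMap.le_opNorm _ _).trans
      (mul_le_mul ((hb θ hθ k).trans hk) he (norm_nonneg _) hc0)
  have hae : ∀ {Q : ℝ → Prop}, (∀ θ ∈ Ico α β, Q θ) → ∀ᵐ θ, θ ∈ Ι α β → Q θ := by
    intro Q hQ
    filter_upwards [compl_mem_ae_iff.2 (measure_singleton (μ := (volume : Measure ℝ)) β)] with θ hne hθ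
    rw [uIoc_of_le hαβ] at hθ
    exact hQ θ ⟨hθ.1.le, lt_of_le_of_ne hθ.2 hne⟩
  have hint : ∀ {G : ℝ → F} {C : ℝ}, ContinuousOn G (Ico α β) → (∀ θ ∈ Ico α β, ‖G θ‖ ≤ C) →
      IntervalIntegrable G volume α β := by
    intro G C hG hGC
    refine (intervalIntegrable_const (c := C)).mono_fun (hmeas hG) ?_
    rw [EventuallyLE, ae_restrict_iff' measurableSet_uIoc]
    exact hae fun θ hθ => (hGC θ hθ).trans (le_abs_self C)
  have htt : t ∈ Icc (t - ε / 2) (t + ε / 2) := ⟨by linarith, by linarith⟩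
  have hiK := hint (hcont hK' hg t ht) fun θ hθ => hest θ hθ _ _ C2 C3
    (hK2 t htt θ (Ico_subset_Icc_self hθ)) (hg1 t htt θ (Ico_subset_Icc_self hθ)) hC2
  have hig := hint (hcont hK hg' t ht) fun θ hθ => hest θ hθ _ _ C1 C4
    (hK1 t htt θ (Ico_subset_Icc_self hθ)) (hg2 t htt θ (Ico_subset_Icc_self hθ)) hC1
  rw [← intervalIntegral.integral_add hiK hig]
  refine (intervalIntegral.hasDerivAt_integral_of_dominated_loc_of_deriv_le
    (F := fun t θ => Φ θ (K (t, p θ)) (g (t, p θ)))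
    (F' := fun t θ => Φ θ (partialDeriv K (t, p θ)) (g (t, p θ)) +
      Φ θ (K (t, p θ)) (partialDeriv g (t, p θ)))
    (bound := fun _ => C2 * C3 + C1 * C4)
    (Icc_mem_nhds (by linarith) (by linarith) : Icc (t - ε / 2) (t + ε / 2) ∈ 𝓝 t)
    ?_ ?_ ?_ ?_ intervalIntegrable_const ?_).2
  · filter_upwards [hI.mem_nhds ht] with τ hτ
    exact hmeas (hcont hK hg τ hτ)
  · exact hint (hcont hK hg t ht) fun θ hθ => hest θ hθ _ _ C1 C3
      (hK1 t htt θ (Ico_subset_Icc_self hθ)) (hg1 t htt θ (Ico_subset_Icc_self hθ)) hC1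
  · exact hmeas ((hcont hK' hg t ht).add (hcont hK hg' t ht))
  · refine hae fun θ hθ τ hτ => (norm_add_le _ _).trans (add_le_add ?_ ?_)
    · exact hest θ hθ _ _ C2 C3
        (hK2 τ hτ θ (Ico_subset_Icc_self hθ)) (hg1 τ hτ θ (Ico_subset_Icc_self hθ)) hC2
    · exact hest θ hθ _ _ C1 C4
        (hK1 τ hτ θ (Ico_subset_Icc_self hθ)) (hg2 τ hτ θ (Ico_subset_Icc_self hθ)) hC1
  · refine hae fun θ hθ τ hτ => ?_
    have hz := hIU τ (hsub hτ) θ (Ico_subset_Icc_self hθ)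
    exact (((Φ θ).hasFDerivAt.comp_hasDerivAt τ (hasDerivAt_partialDeriv hU hK hz)).clm_apply
      (hasDerivAt_partialDeriv hU hg hz))

/-- Smoothness of parametric integrals `∫ Φ_θ(K(t, p(θ)))(g(t, p(θ))) dθ`, for smooth `K`, `g` and a
strongly continuous family `Φ` of contractions. -/
theorem contDiffOn_parametric_integral (hαβ : α ≤ β) (hp : ContinuousOn p (Icc α β))
    (hU : IsOpen U) (hI : IsOpen I) (hIU : ∀ t ∈ I, ∀ θ ∈ Icc α β, (t, p θ) ∈ U)
    (hb : ∀ θ ∈ Ico α β, ∀ k, ‖Φ θ k‖ ≤ ‖k‖)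
    (hc : ∀ k, ContinuousOn (fun θ => Φ θ k) (Ico α β))
    (hK : ContDiffOn ℝ ∞ K U) (hg : ContDiffOn ℝ ∞ g U) :
    ContDiffOn ℝ ∞ (fun t => ∫ θ in α..β, Φ θ (K (t, p θ)) (g (t, p θ))) I := by
  rw [contDiffOn_infty]
  intro m
  -- The derivative is a sum of two integrals of the same form, with `K` or `g` replaced by its
  -- partial derivative in `t`.
  induction m generalizing K g with
  | zero =>
    rw [Nat.cast_zero, contDiffOn_zero]
    exact fun t ht => (hasDerivAt_parametric_integral hαβ hp hU hI hIU hb hc hK hg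
      ht).continuousAt.continuousWithinAt
  | succ m ih =>
    rw [Nat.cast_succ, contDiffOn_succ_iff_deriv_of_isOpen hI]
    have hd := fun t (ht : t ∈ I) => hasDerivAt_parametric_integral hαβ hp hU hI hIU hb hc hK hg ht
    refine ⟨fun t ht => (hd t ht).differentiableAt.differentiableWithinAt, by simp, ?_⟩
    exact ((ih (contDiffOn_partialDeriv hU hK) hg).add
      (ih hK (contDiffOn_partialDeriv hU hg))).congr fun t ht => (hd t ht).deriv

end ParametricIntegral

/-! ### Smoothness of means over the segment between two times. -/

section SegmentMean

/-- The weighted mean `∫₀¹ w(σ) h(s + σ(t - s)) dσ` of `h` over the segment from `s` to `t`. -/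
noncomputable def segmentMean (w h : ℝ → ℝ) (z : ℝ × ℝ) : ℝ :=
  ∫ σ in (0 : ℝ)..1, w σ * h (z.1 + σ * (z.2 - z.1))

theorem segment_mem_Icc {m M σ : ℝ} (hσ : σ ∈ Icc (0 : ℝ) 1) {z : ℝ × ℝ} (h1 : z.1 ∈ Icc m M)
    (h2 : z.2 ∈ Icc m M) : z.1 + σ * (z.2 - z.1) ∈ Icc m M := by
  have := (convex_Icc m M).add_smul_sub_mem h1 h2 hσ
  simpa using this

/-- Differentiating in an endpoint replaces `h` by `h'` and multiplies the weight by `1 - σ` or `σ`;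
general weights are allowed so that this can be iterated. -/
theorem hasFDerivAt_segmentMean {w h : ℝ → ℝ} (hw : Continuous w) (hh : ContDiffOn ℝ ∞ h (Ioi 0))
    {z : ℝ × ℝ} (h1 : 0 < z.1) (h2 : 0 < z.2) :
    HasFDerivAt (segmentMean w h)
      (segmentMean (fun σ => w σ * (1 - σ)) (deriv h) z • ContinuousLinearMap.fst ℝ ℝ ℝ +
        segmentMean (fun σ => w σ * σ) (deriv h) z • ContinuousLinearMap.snd ℝ ℝ ℝ) z := by
  set m := min z.1 z.2 / 2
  set M := max z.1 z.2 + 1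
  have hmin : 0 < min z.1 z.2 := lt_min h1 h2
  have hm : 0 < m := half_pos hmin
  have hIcc : Icc m M ⊆ Ioi 0 := fun x hx => hm.trans_le hx.1
  have hz1 : z.1 ∈ Ioo m M := ⟨(half_lt_self hmin).trans_le (min_le_left _ _),
    (le_max_left _ _).trans_lt (lt_add_one _)⟩
  have hz2 : z.2 ∈ Ioo m M := ⟨(half_lt_self hmin).trans_le (min_le_right _ _),
    (le_max_right _ _).trans_lt (lt_add_one _)⟩
  have hd : ContDiffOn ℝ ∞ (deriv h) (Ioi 0) := hh.deriv_of_isOpen isOpen_Ioi (by simp)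
  obtain ⟨C, hC⟩ := isCompact_Icc.exists_bound_of_continuousOn (hd.continuousOn.mono hIcc)
  have hseg : ∀ x ∈ Ioo m M ×ˢ Ioo m M, ∀ σ ∈ Icc (0 : ℝ) 1, x.1 + σ * (x.2 - x.1) ∈ Icc m M :=
    fun x hx σ hσ => segment_mem_Icc hσ (Ioo_subset_Icc_self hx.1) (Ioo_subset_Icc_self hx.2)
  have hcont : ∀ {w k : ℝ → ℝ}, Continuous w → ContinuousOn k (Ioi 0) → ∀ x ∈ Ioo m M ×ˢ Ioo m M,
      ContinuousOn (fun σ => w σ * k (x.1 + σ * (x.2 - x.1))) (uIcc 0 1) := by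
    intro w k hw hk x hx
    rw [uIcc_of_le zero_le_one]
    exact hw.continuousOn.mul (hk.comp (by fun_prop) fun σ hσ => hIcc (hseg x hx σ hσ))
  have hzs : z ∈ Ioo m M ×ˢ Ioo m M := ⟨hz1, hz2⟩
  have hopen : IsOpen (Ioo m M ×ˢ Ioo m M) := isOpen_Ioo.prod isOpen_Ioo
  have hF' : ContinuousOn (fun σ => (w σ * (1 - σ) * deriv h (z.1 + σ * (z.2 - z.1))) •
      ContinuousLinearMap.fst ℝ ℝ ℝ + (w σ * σ * deriv h (z.1 + σ * (z.2 - z.1))) •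
      ContinuousLinearMap.snd ℝ ℝ ℝ) (uIcc 0 1) :=
    ((hcont (by fun_prop) hd.continuousOn z hzs).smul continuousOn_const).add
      ((hcont (by fun_prop) hd.continuousOn z hzs).smul continuousOn_const)
  have hsub : ∀ {σ : ℝ}, σ ∈ Ι (0 : ℝ) 1 → σ ∈ Icc (0 : ℝ) 1 := by
    intro σ hσ
    rw [uIoc_of_le zero_le_one] at hσ
    exact Ioc_subset_Icc_self hσ
  have key := intervalIntegral.hasFDerivAt_integral_of_dominated_of_fderiv_le (μ := volume)
    (a := 0) (b := 1) (x₀ := z) (s := Ioo m M ×ˢ Ioo m M)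
    (F := fun x σ => w σ * h (x.1 + σ * (x.2 - x.1)))
    (F' := fun x σ => (w σ * (1 - σ) * deriv h (x.1 + σ * (x.2 - x.1))) •
      ContinuousLinearMap.fst ℝ ℝ ℝ + (w σ * σ * deriv h (x.1 + σ * (x.2 - x.1))) •
      ContinuousLinearMap.snd ℝ ℝ ℝ)
    (bound := fun σ => |w σ * (1 - σ)| * C * ‖ContinuousLinearMap.fst ℝ ℝ ℝ‖ +
      |w σ * σ| * C * ‖ContinuousLinearMap.snd ℝ ℝ ℝ‖)
    (hopen.mem_nhds hzs) ?_ (hcont hw hh.continuousOn z hzs).intervalIntegrable ?_ ?_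
    (Continuous.intervalIntegrable (by fun_prop) _ _) ?_
  · rw [intervalIntegral.integral_add, intervalIntegral.integral_smul_const,
      intervalIntegral.integral_smul_const] at key
    · exact key
    · exact ((hcont (by fun_prop) hd.continuousOn z hzs).smul continuousOn_const).intervalIntegrable
    · exact ((hcont (by fun_prop) hd.continuousOn z hzs).smul continuousOn_const).intervalIntegrable
  · filter_upwards [hopen.mem_nhds hzs] with x hx
    exact (hcont hw hh.continuousOn x hx).intervalIntegrable.def'.aestronglyMeasurable
  · exact hF'.intervalIntegrable.def'.aestronglyMeasurable
  · refine Eventually.of_forall fun σ hσ x hx => (norm_add_le _ _).trans ?_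
    have hb := hC _ (hseg x hx σ (hsub hσ))
    rw [norm_smul, norm_smul, norm_mul, norm_mul (w σ * σ), Real.norm_eq_abs (w σ * _),
      Real.norm_eq_abs (w σ * _)]
    gcongr
  · refine Eventually.of_forall fun σ hσ x hx => ?_
    have hx0 := hIcc (hseg x hx σ (hsub hσ))
    have hdh : HasDerivAt h (deriv h (x.1 + σ * (x.2 - x.1))) (x.1 + σ * (x.2 - x.1)) :=
      ((hh.contDiffAt (isOpen_Ioi.mem_nhds hx0)).differentiableAt (by simp)).hasDerivAt
    have hl : HasFDerivAt (fun x : ℝ × ℝ => x.1 + σ * (x.2 - x.1))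
        (ContinuousLinearMap.fst ℝ ℝ ℝ + σ • (ContinuousLinearMap.snd ℝ ℝ ℝ -
          ContinuousLinearMap.fst ℝ ℝ ℝ)) x :=
      hasFDerivAt_fst.add ((hasFDerivAt_snd.sub hasFDerivAt_fst).const_mul σ)
    refine ((hdh.comp_hasFDerivAt x hl).const_mul (w σ)).congr_fderiv ?_
    module

theorem contDiffOn_segmentMean {w h : ℝ → ℝ} (hw : Continuous w) (hh : ContDiffOn ℝ ∞ h (Ioi 0)) :
    ContDiffOn ℝ ∞ (segmentMean w h) (Ioi 0 ×ˢ Ioi 0) := by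
  rw [contDiffOn_infty]
  intro m
  have hopen : IsOpen (Ioi (0 : ℝ) ×ˢ Ioi (0 : ℝ)) := isOpen_Ioi.prod isOpen_Ioi
  induction m generalizing w h with
  | zero =>
    rw [Nat.cast_zero, contDiffOn_zero]
    exact fun z hz => (hasFDerivAt_segmentMean hw hh hz.1 hz.2).continuousAt.continuousWithinAt
  | succ m ih =>
    rw [Nat.cast_succ, contDiffOn_succ_iff_fderiv_of_isOpen hopen]
    have hd : ContDiffOn ℝ ∞ (deriv h) (Ioi 0) := hh.deriv_of_isOpen isOpen_Ioi (by simp)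
    refine ⟨fun z hz =>
      (hasFDerivAt_segmentMean hw hh hz.1 hz.2).differentiableAt.differentiableWithinAt, by simp, ?_⟩
    refine ContDiffOn.congr ?_ fun z hz => (hasFDerivAt_segmentMean hw hh hz.1 hz.2).fderiv
    exact ((ih (by fun_prop) hd).smul contDiffOn_const).add
      ((ih (by fun_prop) hd).smul contDiffOn_const)

theorem integral_eq_mul_segmentMean (h : ℝ → ℝ) (s t : ℝ) :
    ∫ r in s..t, h r = (t - s) * segmentMean (fun _ => 1) h (s, t) := by
  rw [segmentMean]
  simp only [one_mul]
  have := intervalIntegral.smul_integral_comp_add_mul (a := 0) (b := 1) h (t - s) s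
  simp only [mul_zero, add_zero, mul_one, add_sub_cancel, smul_eq_mul] at this
  rw [← this]
  simp only [mul_comm]

end SegmentMean

/-! ### The matrix `A(t) - A(s)` and its factorization through the mean of `a`. -/

section Cumulative

attribute [local instance] Matrix.normedAddCommGroup Matrix.normedSpace

variable {n : ℕ} {a : ℝ → Matrix (Fin n) (Fin n) ℝ}

theorem IsDiffusivity.intervalIntegrable (ha : IsDiffusivity a) {s t : ℝ} (hs : 0 ≤ s) (ht : 0 ≤ t)
    (i j : Fin n) : IntervalIntegrable (fun r => a r i j) volume s t :=
  ((ha.continuousOn i j).mono fun _ hr => (le_min hs ht).trans hr.1).intervalIntegrable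

theorem IsDiffusivity.cumulative_sub_apply (ha : IsDiffusivity a) {s t : ℝ} (hs : 0 ≤ s)
    (ht : 0 ≤ t) (i j : Fin n) :
    (cumulativeDiffusivity a t - cumulativeDiffusivity a s) i j = ∫ r in s..t, a r i j :=
  intervalIntegral.integral_interval_sub_left (ha.intervalIntegrable le_rfl ht i j)
    (ha.intervalIntegrable le_rfl hs i j)

/-- The quadratic form is the integral of forms that are positive on the open interval `(s, t)`, so
no positivity at time `0` is needed. -/
theorem IsDiffusivity.posDef_sub (ha : IsDiffusivity a) {s t : ℝ} (hs : 0 ≤ s) (hst : s < t) :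
    (cumulativeDiffusivity a t - cumulativeDiffusivity a s).PosDef := by
  have ht : 0 ≤ t := hs.trans hst.le
  refine posDef_of_quadForm_pos ?_ fun x hx => ?_
  · ext i j
    rw [Matrix.transpose_apply, ha.cumulative_sub_apply hs ht, ha.cumulative_sub_apply hs ht]
    refine intervalIntegral.integral_congr_ae (Eventually.of_forall fun r hr => ?_)
    rw [uIoc_of_le hst.le] at hr
    exact (ha.posDef r (hs.trans_lt hr.1)).isSymm.apply i j
  · have hsub : uIcc s t ⊆ Ici 0 := fun _ hr => (le_min hs ht).trans hr.1
    have hc : ∀ i j, ContinuousOn (fun r => a r i j * (x i * x j)) (uIcc s t) := fun i j =>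
      ((ha.continuousOn i j).mono hsub).mul continuousOn_const
    have hc' : ∀ i, ContinuousOn (fun r => ∑ j, a r i j * (x i * x j)) (uIcc s t) := fun i =>
      continuousOn_finsetSum _ fun j _ => hc i j
    have h : quadForm (cumulativeDiffusivity a t - cumulativeDiffusivity a s) x =
        ∫ r in s..t, quadForm (a r) x := by
      simp only [quadForm_eq_sum]
      rw [intervalIntegral.integral_finsetSum fun i _ => (hc' i).intervalIntegrable]
      refine Finset.sum_congr rfl fun i _ => ?_
      rw [intervalIntegral.integral_finsetSum fun j _ => (hc i j).intervalIntegrable]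
      refine Finset.sum_congr rfl fun j _ => ?_
      rw [intervalIntegral.integral_mul_const, ha.cumulative_sub_apply hs ht]
    rw [h]
    refine intervalIntegral.intervalIntegral_pos_of_pos_on ?_
      (fun r hr => (ha.posDef r (hs.trans_lt hr.1)).quadForm_pos hx) hst
    simp only [quadForm_eq_sum]
    exact (continuousOn_finsetSum _ fun i _ => hc' i).intervalIntegrable

theorem IsDiffusivity.hasDerivAt_cumulative (ha : IsDiffusivity a) {t : ℝ} (ht : 0 < t) :
    HasDerivAt (cumulativeDiffusivity a) (a t) t := by
  refine hasDerivAt_matrix fun i j => ?_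
  have hc : ContinuousOn (fun r => a r i j) (Ioi 0) := (ha.contDiffOn i j).continuousOn
  exact intervalIntegral.integral_hasDerivAt_right (ha.intervalIntegrable le_rfl ht.le i j)
    (hc.stronglyMeasurableAtFilter isOpen_Ioi t ht) (hc.continuousAt (isOpen_Ioi.mem_nhds ht))

theorem IsDiffusivity.contDiffOn_cumulative (ha : IsDiffusivity a) :
    ContDiffOn ℝ ∞ (cumulativeDiffusivity a) (Ioi 0) := by
  rw [contDiffOn_infty_iff_deriv_of_isOpen isOpen_Ioi]
  refine ⟨fun t ht => (ha.hasDerivAt_cumulative ht).differentiableAt.differentiableWithinAt, ?_⟩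
  exact (contDiff_matrix ha.contDiffOn).congr fun t ht => (ha.hasDerivAt_cumulative ht).deriv

theorem IsDiffusivity.continuousOn_cumulative (ha : IsDiffusivity a) :
    ContinuousOn (cumulativeDiffusivity a) (Ici 0) := by
  refine continuousOn_pi.2 fun i => continuousOn_pi.2 fun j => fun t ht => ?_
  have ht0 : (0 : ℝ) ≤ t + 1 := by linarith [mem_Ici.1 ht]
  have h := intervalIntegral.continuousOn_primitive_interval'
    (ha.intervalIntegrable le_rfl ht0 i j) left_mem_uIcc
  rw [uIcc_of_le ht0] at h
  refine (h t ⟨ht, by linarith⟩).mono_of_mem_nhdsWithin ?_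
  exact mem_nhdsWithin.2 ⟨Iio (t + 1), isOpen_Iio, by simp, fun r hr => ⟨hr.2, hr.1.le⟩⟩

/-- The mean of `a` over the segment between two times. -/
noncomputable def meanDiffusivity (a : ℝ → Matrix (Fin n) (Fin n) ℝ) (z : ℝ × ℝ) :
    Matrix (Fin n) (Fin n) ℝ := Matrix.of fun i j => segmentMean (fun _ => 1) (fun r => a r i j) z

theorem IsDiffusivity.contDiffOn_mean (ha : IsDiffusivity a) :
    ContDiffOn ℝ ∞ (meanDiffusivity a) (Ioi 0 ×ˢ Ioi 0) :=
  contDiff_matrix fun i j => contDiffOn_segmentMean continuous_const (ha.contDiffOn i j)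

theorem IsDiffusivity.cumulative_sub (ha : IsDiffusivity a) {s t : ℝ} (hs : 0 ≤ s) (ht : 0 ≤ t) :
    cumulativeDiffusivity a t - cumulativeDiffusivity a s = (t - s) • meanDiffusivity a (s, t) := by
  ext i j
  rw [ha.cumulative_sub_apply hs ht, integral_eq_mul_segmentMean]
  rfl

/-- Unlike `A(t) - A(s)`, the mean stays nondegenerate on the diagonal, where it equals `a(s)`. The
factor `t - s` carries all of the degeneracy. -/
theorem IsDiffusivity.posDef_mean (ha : IsDiffusivity a) {s t : ℝ} (hs : 0 < s) (hst : s ≤ t) :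
    (meanDiffusivity a (s, t)).PosDef := by
  rcases hst.eq_or_lt with rfl | hst
  · have : meanDiffusivity a (s, s) = a s := by
      ext i j
      simp [meanDiffusivity, segmentMean]
    rw [this]
    exact ha.posDef s hs
  · have h := (ha.posDef_sub hs.le hst).smul (inv_pos.2 (sub_pos.2 hst))
    rwa [ha.cumulative_sub hs.le (hs.trans hst).le, smul_smul, inv_mul_cancel₀ (sub_pos.2 hst).ne',
      one_smul] at h

theorem IsDiffusivity.tendsto_trace {ι : Type*} {l : Filter ι} (ha : IsDiffusivity a)
    {s t : ι → ℝ} {r : ℝ} (hr : 0 ≤ r) (hs : Tendsto s l (𝓝[Ici 0] r))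
    (ht : Tendsto t l (𝓝[Ici 0] r)) :
    Tendsto (fun i => (cumulativeDiffusivity a (t i) - cumulativeDiffusivity a (s i)).trace) l
      (𝓝 0) := by
  have h := (ha.continuousOn_cumulative r hr)
  have h1 := ((h.tendsto.comp ht).sub (h.tendsto.comp hs))
  rw [sub_self] at h1
  have h2 : Continuous fun N : Matrix (Fin n) (Fin n) ℝ => N.trace := by fun_prop
  have h3 := (h2.tendsto 0).comp h1
  rwa [Matrix.trace_zero] at h3

end Cumulative

/-! ### The operators `W_{s,t}` as convolutions: contraction, integrability, norm estimate. -/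

section HeatOperator

attribute [local instance] Matrix.normedAddCommGroup Matrix.normedSpace

variable {n : ℕ} {a : ℝ → Matrix (Fin n) (Fin n) ℝ} {q : ℝ≥0∞} [Fact (1 ≤ q)]

/-- The heat kernel as an element of `L¹`. -/
noncomputable def heatKernelL1 (a : ℝ → Matrix (Fin n) (Fin n) ℝ) (s t : ℝ) : KernelSpace n :=
  heatL1 (cumulativeDiffusivity a t - cumulativeDiffusivity a s)

theorem IsDiffusivity.heatConvolution_eq (ha : IsDiffusivity a) {s t : ℝ} (hs : 0 ≤ s) (hst : s < t)
    (v : Eucl n → ℂ) : heatConvolution a s t v = convFun (heatKernelL1 a s t) v :=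
  convFun_congr (coeFn_heatL1 (ha.posDef_sub hs hst).mem_gaussDomain).symm (ae_eq_refl v)

/-- Integrability at every `x`, not just almost every one: the reflected kernel is Schwartz, hence
in the conjugate Lebesgue space, and Hölder applies. -/
theorem IsDiffusivity.integrable_heatKernel_mul (ha : IsDiffusivity a) {s t : ℝ} (hs : 0 ≤ s)
    (hst : s < t) (v : LqSpace n q) (x : Eucl n) :
    Integrable fun y => (heatKernel a s t (x - y) : ℂ) * v y := by
  have hN := (ha.posDef_sub hs hst).mem_gaussDomain
  have hqq : ENNReal.HolderConjugate q (1 - q⁻¹)⁻¹ := .inv_one_sub_inv' Fact.out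
  have h := MemLp.integrable_mul (p := (1 - q⁻¹)⁻¹) (q := q)
    ((reflectSchwartz (heatSchwartz _ hN) x).memLp (1 - q⁻¹)⁻¹ volume) (Lp.memLp v)
  refine h.congr (Eventually.of_forall fun y => ?_)
  simp only [Pi.mul_apply]
  rw [reflectSchwartz_apply, heatSchwartz_apply]
  rfl

theorem IsDiffusivity.memLp_heatConvolution (ha : IsDiffusivity a) {s t : ℝ} (hs : 0 ≤ s)
    (hst : s < t) (v : LqSpace n q) : MemLp (heatConvolution a s t v) q volume := by
  rw [ha.heatConvolution_eq hs hst]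
  exact memLp_convFun Fact.out (integrable_kernel _) (Lp.memLp v)

theorem IsDiffusivity.heatOperator_eq (ha : IsDiffusivity a) {s t : ℝ} (hs : 0 ≤ s) (hst : s < t)
    (v : LqSpace n q) : heatOperator a s t v = convCLM n q (heatKernelL1 a s t) v := by
  rw [heatOperator, if_pos hst, dif_pos (ha.memLp_heatConvolution hs hst v)]
  refine Lp.ext ?_
  filter_upwards [(ha.memLp_heatConvolution hs hst v).coeFn_toLp,
    coeFn_convCLM (heatKernelL1 a s t) v] with x h1 h2
  rw [h1, h2, ha.heatConvolution_eq hs hst]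

omit [Fact (1 ≤ q)] in
theorem heatOperator_self (t : ℝ) (v : LqSpace n q) : heatOperator a t t v = v := by
  rw [heatOperator, if_neg (lt_irrefl t)]

theorem IsDiffusivity.norm_heatKernelL1 (ha : IsDiffusivity a) {s t : ℝ} (hs : 0 ≤ s)
    (hst : s < t) : ‖heatKernelL1 a s t‖ = 1 := (ha.posDef_sub hs hst).norm_heatL1

theorem IsDiffusivity.norm_heatOperator_le (ha : IsDiffusivity a) {s t : ℝ} (hs : 0 ≤ s)
    (hst : s ≤ t) (v : LqSpace n q) : ‖heatOperator a s t v‖ ≤ ‖v‖ := by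
  rcases hst.eq_or_lt with rfl | hst
  · rw [heatOperator_self]
  · rw [ha.heatOperator_eq hs hst]
    refine (ContinuousLinearMap.le_of_opNorm_le _ (norm_convCLM_apply_le _) v).trans ?_
    rw [ha.norm_heatKernelL1 hs hst, one_mul]

theorem IsDiffusivity.isApproximateIdentity (ha : IsDiffusivity a) {ι : Type*} {l : Filter ι}
    [l.IsCountablyGenerated] {s t : ι → ℝ} {r : ℝ} (hr : 0 ≤ r) (hs : Tendsto s l (𝓝[Ici 0] r))
    (ht : Tendsto t l (𝓝[Ici 0] r)) (hst : ∀ᶠ i in l, s i < t i) :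
    IsApproximateIdentity l fun i => heatKernelL1 a (s i) (t i) := by
  refine isApproximateIdentity_heatL1 ?_ (ha.tendsto_trace hr hs ht)
  filter_upwards [hst, hs.eventually self_mem_nhdsWithin] with i h1 h2
  exact ha.posDef_sub h2 h1

theorem IsDiffusivity.continuousOn_heatKernelL1 (ha : IsDiffusivity a) (t : ℝ) :
    ContinuousOn (fun s => heatKernelL1 a s t) (Ico 0 t) := by
  refine contDiffOn_heatL1.continuousOn.comp
    (continuousOn_const.sub (ha.continuousOn_cumulative.mono fun s hs => hs.1)) fun s hs => ?_
  exact (ha.posDef_sub hs.1 hs.2).mem_gaussDomain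

theorem IsDiffusivity.continuousOn_heatOperator (ha : IsDiffusivity a) {f : ℝ → LqSpace n q}
    (hf : ContinuousOn f (Ici 0)) (t : ℝ) :
    ContinuousOn (fun s => heatOperator a s t (f s)) (Ico 0 t) := by
  have h : ContinuousOn (fun s => convCLM n q (heatKernelL1 a s t) (f s)) (Ico 0 t) :=
    ((convCLM n q).continuous.comp_continuousOn (ha.continuousOn_heatKernelL1 t)).clm_apply
      (hf.mono fun s hs => hs.1)
  exact h.congr fun s hs => ha.heatOperator_eq hs.1 hs.2 (f s)

/-- Measurability comes from continuity on `[0, t)`, the endpoint being null; the contraction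
property gives the majorant `‖f s‖`. -/
theorem IsDiffusivity.intervalIntegrable_heatOperator (ha : IsDiffusivity a) {f : ℝ → LqSpace n q}
    (hf : ContinuousOn f (Ici 0)) {t : ℝ} (ht : 0 ≤ t) :
    IntervalIntegrable (fun s => heatOperator a s t (f s)) volume 0 t := by
  have hfi : IntervalIntegrable f volume 0 t :=
    (hf.mono fun s hs => by rw [uIcc_of_le ht] at hs; exact hs.1).intervalIntegrable
  refine hfi.mono_fun ?_ ?_
  · rw [uIoc_of_le ht, ← restrict_Ico_eq_restrict_Ioc]
    exact (ha.continuousOn_heatOperator hf t).aestronglyMeasurable measurableSet_Ico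
  · rw [EventuallyLE, ae_restrict_iff' measurableSet_uIoc]
    refine Eventually.of_forall fun s hs => ?_
    rw [uIoc_of_le ht] at hs
    exact ha.norm_heatOperator_le hs.1.le hs.2 _

theorem IsDiffusivity.norm_integral_heatOperator_le (ha : IsDiffusivity a) {f : ℝ → LqSpace n q}
    (hf : ContinuousOn f (Ici 0)) {t : ℝ} (ht : 0 ≤ t) :
    ‖∫ s in (0 : ℝ)..t, heatOperator a s t (f s)‖ ≤ ∫ s in (0 : ℝ)..t, ‖f s‖ := by
  have hfi : IntervalIntegrable f volume 0 t :=
    (hf.mono fun s hs => by rw [uIcc_of_le ht] at hs; exact hs.1).intervalIntegrable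
  refine (intervalIntegral.norm_integral_le_integral_norm ht).trans
    (intervalIntegral.integral_mono_on ht (ha.intervalIntegrable_heatOperator hf ht).norm hfi.norm
      fun s hs => ha.norm_heatOperator_le hs.1 hs.2 _)

theorem IsDiffusivity.norm_duhamel_le (ha : IsDiffusivity a) (u₀ : LqSpace n q)
    {f : ℝ → LqSpace n q} (hf : ContinuousOn f (Ici 0)) {t : ℝ} (ht : 0 ≤ t) :
    ‖duhamel a u₀ f t‖ ≤ ‖u₀‖ + ∫ s in (0 : ℝ)..t, ‖f s‖ :=
  (norm_add_le _ _).trans (add_le_add (ha.norm_heatOperator_le le_rfl ht u₀)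
    (ha.norm_integral_heatOperator_le hf ht))

end HeatOperator

/-! ### Positivity, phrased with the order of `L^q`. -/

section Positivity

open scoped ComplexOrder

variable {n : ℕ} {a : ℝ → Matrix (Fin n) (Fin n) ℝ} {q : ℝ≥0∞}

theorem isNonnegLp_iff (v : LqSpace n q) : IsNonnegLp v ↔ 0 ≤ v := by
  rw [← Lp.coeFn_nonneg, IsNonnegLp, EventuallyLE]
  refine eventually_congr (Eventually.of_forall fun x => ?_)
  rw [Pi.zero_apply, Complex.nonneg_iff, eq_comm (a := (v x).im)]

variable [Fact (1 ≤ q)]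

theorem IsDiffusivity.heatOperator_nonneg (ha : IsDiffusivity a) {s t : ℝ} (hs : 0 ≤ s)
    (hst : s ≤ t) {v : LqSpace n q} (hv : 0 ≤ v) : 0 ≤ heatOperator a s t v := by
  rcases hst.eq_or_lt with rfl | hst
  · rwa [heatOperator_self]
  rw [heatOperator, if_pos hst, dif_pos (ha.memLp_heatConvolution hs hst v), ← Lp.coeFn_nonneg]
  filter_upwards [(ha.memLp_heatConvolution hs hst v).coeFn_toLp] with x hx
  rw [hx]
  refine integral_nonneg_of_ae ?_
  filter_upwards [(Lp.coeFn_nonneg v).2 hv] with y hy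
  exact mul_nonneg (Complex.zero_le_real.2 (heatGaussian_nonneg _ _)) hy

theorem IsDiffusivity.duhamel_nonneg (ha : IsDiffusivity a) {u₀ : LqSpace n q}
    {f : ℝ → LqSpace n q} (hu : 0 ≤ u₀) (hf : ∀ t, 0 < t → 0 ≤ f t) {t : ℝ} (ht : 0 ≤ t) :
    0 ≤ duhamel a u₀ f t := by
  refine add_nonneg (ha.heatOperator_nonneg le_rfl ht hu) ?_
  rw [intervalIntegral.integral_of_le ht]
  have : IsOrderedModule ℝ (LqSpace n q) := .of_smul_nonneg fun c hc w hw => by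
    rw [← Lp.coeFn_nonneg] at hw ⊢
    filter_upwards [hw, Lp.coeFn_smul c w] with x h1 h2
    rw [h2]
    exact smul_nonneg hc h1
  refine integral_nonneg_of_ae ?_
  rw [EventuallyLE, ae_restrict_iff' measurableSet_Ioc]
  exact Eventually.of_forall fun s hs => ha.heatOperator_nonneg hs.1.le hs.2 (hf s hs.1)

end Positivity

/-! ### Behaviour as `t → 0+`. -/

section InitialCondition

variable {n : ℕ} {a : ℝ → Matrix (Fin n) (Fin n) ℝ} {q : ℝ≥0∞} [Fact (1 ≤ q)]

theorem duhamel_zero (u₀ : LqSpace n q) (f : ℝ → LqSpace n q) : duhamel a u₀ f 0 = u₀ := by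
  rw [duhamel, heatOperator_self, intervalIntegral.integral_same, add_zero]

theorem IsDiffusivity.tendsto_integral_heatOperator (ha : IsDiffusivity a) {f : ℝ → LqSpace n q}
    (hf : ContinuousOn f (Ici 0)) :
    Tendsto (fun t => ∫ s in (0 : ℝ)..t, heatOperator a s t (f s)) (𝓝[>] 0) (𝓝 0) := by
  have hfi : IntervalIntegrable (fun s => ‖f s‖) volume 0 1 := ContinuousOn.intervalIntegrable
    (hf.norm.mono fun s hs => by rw [uIcc_of_le zero_le_one] at hs; exact hs.1)
  have h := intervalIntegral.continuousOn_primitive_interval' hfi left_mem_uIcc 0 left_mem_uIcc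
  rw [uIcc_of_le zero_le_one, ContinuousWithinAt, intervalIntegral.integral_same] at h
  refine squeeze_zero_norm' ?_ (h.mono_left (nhdsWithin_le_of_mem
    (mem_of_superset (Ioo_mem_nhdsGT zero_lt_one) Ioo_subset_Icc_self)))
  filter_upwards [self_mem_nhdsWithin] with t ht
  exact ha.norm_integral_heatOperator_le hf (le_of_lt ht)

theorem tendsto_nhdsGT_Ici (r : ℝ) : Tendsto (fun t : ℝ => t) (𝓝[>] r) (𝓝[Ici r] r) :=
  nhdsWithin_mono _ Ioi_subset_Ici_self

theorem IsDiffusivity.isApproximateIdentity_zero (ha : IsDiffusivity a) :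
    IsApproximateIdentity (𝓝[>] 0) fun t => heatKernelL1 a 0 t :=
  ha.isApproximateIdentity le_rfl (tendsto_const_pure.mono_right (pure_le_nhdsWithin self_mem_Ici))
    (tendsto_nhdsGT_Ici 0) self_mem_nhdsWithin

theorem IsDiffusivity.tendsto_duhamel (ha : IsDiffusivity a) (hq : q ≠ ⊤) (u₀ : LqSpace n q)
    {f : ℝ → LqSpace n q} (hf : ContinuousOn f (Ici 0)) :
    Tendsto (duhamel a u₀ f) (𝓝[>] 0) (𝓝 u₀) := by
  have h := (ha.isApproximateIdentity_zero.tendsto_convCLM hq u₀).add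
    (ha.tendsto_integral_heatOperator hf)
  rw [add_zero] at h
  refine h.congr' ?_
  filter_upwards [self_mem_nhdsWithin] with t ht
  rw [← ha.heatOperator_eq le_rfl ht u₀]
  rfl

/-- The integral term still vanishes in norm; only the term with `u₀` requires the weak-* limit. -/
theorem IsDiffusivity.tendsto_duhamel_top (ha : IsDiffusivity a) (u₀ : LqSpace n ⊤)
    {f : ℝ → LqSpace n ⊤} (hf : ContinuousOn f (Ici 0)) {φ : Eucl n → ℂ} (hφ : Integrable φ) :
    Tendsto (fun t => ∫ x, duhamel a u₀ f t x * φ x) (𝓝[>] 0) (𝓝 (∫ x, u₀ x * φ x)) := by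
  have hsymm : ∀ᶠ t in 𝓝[>] (0 : ℝ), ∀ᵐ x, heatKernelL1 a 0 t (-x) = heatKernelL1 a 0 t x := by
    filter_upwards [self_mem_nhdsWithin] with t ht
    exact (ha.posDef_sub le_rfl ht).heatL1_even
  have h := (ha.isApproximateIdentity_zero.tendsto_pairing hsymm u₀ hφ).add
    (((pairingCLM hφ).continuous.tendsto _).comp (ha.tendsto_integral_heatOperator hf))
  simp only [map_zero, add_zero, pairingCLM_apply hφ u₀] at h
  refine h.congr' ?_
  filter_upwards [self_mem_nhdsWithin] with t ht
  rw [Function.comp_apply, ← map_add, ← ha.heatOperator_eq le_rfl ht u₀, ← pairingCLM_apply]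
  rfl

end InitialCondition

/-! ### Smoothness of the two pieces of the Duhamel integral. -/

section Smoothness

attribute [local instance] Matrix.normedAddCommGroup Matrix.normedSpace

variable {n : ℕ} {a : ℝ → Matrix (Fin n) (Fin n) ℝ} {q : ℝ≥0∞} [Fact (1 ≤ q)]

theorem IsDiffusivity.contDiffOn_heatOperator_zero (ha : IsDiffusivity a) (u₀ : LqSpace n q) :
    ContDiffOn ℝ ∞ (fun t => heatOperator a 0 t u₀) (Ioi 0) := by
  have h : ContDiffOn ℝ ∞ (fun t => heatKernelL1 a 0 t) (Ioi 0) :=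
    contDiffOn_heatL1.comp (ha.contDiffOn_cumulative.sub contDiffOn_const)
      fun t ht => (ha.posDef_sub le_rfl ht).mem_gaussDomain
  exact (((convCLM n q).contDiff.comp_contDiffOn h).clm_apply contDiffOn_const).congr
    fun t ht => ha.heatOperator_eq le_rfl ht u₀

/-- The contribution of the sources before time `δ` is smooth after `δ`. -/
theorem IsDiffusivity.contDiffOn_integral_early (ha : IsDiffusivity a) {f : ℝ → LqSpace n q}
    (hf : ContinuousOn f (Ici 0)) {δ : ℝ} (hδ : 0 < δ) :
    ContDiffOn ℝ ∞ (fun t => ∫ s in (0 : ℝ)..δ, heatOperator a s t (f s)) (Ioi δ) := by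
  -- The parameter `p(s) = (A(s), f(s))` carries all dependence on `s` and is only continuous at
  -- `0`; the integrand is smooth in `t`, the matrix and the vector.
  let U : Set (ℝ × (Matrix (Fin n) (Fin n) ℝ × LqSpace n q)) :=
    {z | δ < z.1} ∩ (fun z => cumulativeDiffusivity a z.1 - z.2.1) ⁻¹' gaussDomain n
  have hN : ContDiffOn ℝ ∞ (fun z : ℝ × (Matrix (Fin n) (Fin n) ℝ × LqSpace n q) =>
      cumulativeDiffusivity a z.1 - z.2.1) {z | δ < z.1} :=
    (ha.contDiffOn_cumulative.comp contDiffOn_fst fun z hz => hδ.trans hz).sub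
      (contDiff_fst.comp contDiff_snd).contDiffOn
  have hU : IsOpen U := hN.continuousOn.isOpen_inter_preimage
    (isOpen_lt continuous_const continuous_fst) isOpen_gaussDomain
  have h := contDiffOn_parametric_integral (Φ := fun _ => convCLM n q) (α := 0) (β := δ)
    (p := fun s => (cumulativeDiffusivity a s, f s)) (U := U) (I := Ioi δ)
    (K := fun z => heatL1 (cumulativeDiffusivity a z.1 - z.2.1)) (g := fun z => z.2.2) hδ.le
    ((ha.continuousOn_cumulative.mono fun s hs => hs.1).prodMk (hf.mono fun s hs => hs.1))
    hU isOpen_Ioi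
    (fun t ht s hs => ⟨ht, (ha.posDef_sub hs.1 (hs.2.trans_lt ht)).mem_gaussDomain⟩)
    (fun _ _ k => norm_convCLM_apply_le k) (fun _ => continuousOn_const)
    (contDiffOn_heatL1.comp (hN.mono inter_subset_left) fun z hz => hz.2)
    (contDiff_snd.comp contDiff_snd).contDiffOn
  refine h.congr fun t ht => intervalIntegral.integral_congr fun s hs => ?_
  rw [uIcc_of_le hδ.le] at hs
  exact ha.heatOperator_eq hs.1 (hs.2.trans_lt ht) (f s)

/-- The contribution of the sources after time `δ` is smooth after `δ`. -/
theorem IsDiffusivity.contDiffOn_integral_late (ha : IsDiffusivity a) {f : ℝ → LqSpace n q}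
    (hf : ContDiffOn ℝ ∞ f (Ioi 0)) {δ : ℝ} (hδ : 0 < δ) :
    ContDiffOn ℝ ∞ (fun t => ∫ s in δ..t, heatOperator a s t (f s)) (Ioi δ) := by
  -- The substitution `s = δ + θ(t - δ)` fixes the interval of integration. It gives `t - s = (1 -
  -- θ)(t - δ)`, hence `A(t) - A(s) = (1 - θ) (t - δ) M`.
  let S : ℝ × ℝ → ℝ := fun z => δ + z.2 * (z.1 - δ)
  have hS : ContDiff ℝ ∞ S := by fun_prop
  let V : Set (ℝ × ℝ) := {z | δ < z.1} ∩ {z | 0 < S z}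
  have hV : IsOpen V := (isOpen_lt continuous_const continuous_fst).inter
    (isOpen_lt continuous_const hS.continuous)
  let U : Set (ℝ × ℝ) := V ∩ (fun z => (z.1 - δ) • meanDiffusivity a (S z, z.1)) ⁻¹' gaussDomain n
  have hM : ContDiffOn ℝ ∞ (fun z : ℝ × ℝ => (z.1 - δ) • meanDiffusivity a (S z, z.1)) V :=
    (contDiff_fst.sub contDiff_const).contDiffOn.smul
      (ha.contDiffOn_mean.comp (hS.prodMk contDiff_fst).contDiffOn
        fun z hz => ⟨hz.2, hδ.trans hz.1⟩)
  have hU : IsOpen U := hM.continuousOn.isOpen_inter_preimage hV isOpen_gaussDomain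
  have hSt : ∀ t ∈ Ioi δ, ∀ θ ∈ Icc (0 : ℝ) 1, S (t, θ) ∈ Icc δ t := by
    intro t ht θ hθ
    have h1 : 0 ≤ t - δ := (sub_pos.2 ht).le
    constructor
    · simp only [S]; nlinarith [mul_nonneg hθ.1 h1]
    · simp only [S]; nlinarith [mul_le_mul_of_nonneg_right hθ.2 h1]
  have hIU : ∀ t ∈ Ioi δ, ∀ θ ∈ Icc (0 : ℝ) 1, (t, id θ) ∈ U := by
    intro t ht θ hθ
    have h := hSt t ht θ hθ
    exact ⟨⟨ht, hδ.trans_le h.1⟩, ((ha.posDef_mean (hδ.trans_le h.1) h.2).smul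
      (sub_pos.2 ht)).mem_gaussDomain⟩
  -- The factor `1 - θ` becomes the dilation by `√(1 - θ)` in `Φ`, degenerate only at `θ = 1`. `K`
  -- keeps the matrix `(t - δ) M`, smooth and positive definite, and `g` absorbs the Jacobian `t -
  -- δ`.
  have h := contDiffOn_parametric_integral (Φ := fun θ => (convCLM n q).comp (dilCLM n (√(1 - θ))))
    (α := 0) (β := 1) (p := id) (U := U) (I := Ioi δ)
    (K := fun z => heatL1 ((z.1 - δ) • meanDiffusivity a (S z, z.1)))
    (g := fun z => (z.1 - δ) • f (S z)) zero_le_one continuousOn_id hU isOpen_Ioi hIU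
    (fun θ _ k => (norm_convCLM_apply_le _).trans (norm_dilL1_le _ k))
    (fun k θ hθ => ?_) (contDiffOn_heatL1.comp (hM.mono inter_subset_left) fun z hz => hz.2)
    ((contDiff_fst.sub contDiff_const).contDiffOn.smul
      (hf.comp hS.contDiffOn fun z hz => hz.1.2))
  · refine h.congr fun t ht => ?_
    have ht0 : 0 < t - δ := sub_pos.2 ht
    have hsub := intervalIntegral.smul_integral_comp_add_mul (a := 0) (b := 1)
      (fun s => heatOperator a s t (f s)) (t - δ) δ
    simp only [mul_zero, add_zero, mul_one, add_sub_cancel] at hsub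
    rw [← hsub, ← intervalIntegral.integral_smul]
    refine intervalIntegral.integral_congr_ae ?_
    filter_upwards [compl_mem_ae_iff.2 (measure_singleton (μ := (volume : Measure ℝ)) 1)] with θ hne hθ
    rw [uIoc_of_le zero_le_one] at hθ
    have hθ1 : θ < 1 := lt_of_le_of_ne hθ.2 hne
    have hs := hSt t ht θ (Ioc_subset_Icc_self hθ)
    have hS0 : 0 < S (t, θ) := hδ.trans_le hs.1
    have hst : t - S (t, θ) = (1 - θ) * (t - δ) := by simp only [S]; ring
    have hlt : S (t, θ) < t := by nlinarith [mul_pos (sub_pos.2 hθ1) ht0]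
    have e1 : δ + (t - δ) * θ = S (t, θ) := by simp only [S]; ring
    have hk : dilL1 (√(1 - θ)) (heatL1 ((t - δ) • meanDiffusivity a (S (t, θ), t))) =
        heatKernelL1 a (S (t, θ)) t := by
      rw [dilL1_heatL1 (sub_pos.2 hθ1) ((ha.posDef_mean hS0 hs.2).smul ht0), smul_smul, ← hst,
        ← ha.cumulative_sub hS0.le (hδ.trans ht).le]
      rfl
    simp only [e1, id, ContinuousLinearMap.comp_apply, dilCLM_apply, hk, map_smul]
    rw [ha.heatOperator_eq hS0.le hlt]
  · have h1 : ContinuousAt (fun θ : ℝ => √(1 - θ)) θ := by fun_prop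
    have h2 : ContinuousAt (fun θ : ℝ => dilL1 (√(1 - θ)) k) θ :=
      ContinuousAt.comp (f := fun θ : ℝ => √(1 - θ)) (g := fun ρ => dilL1 ρ k)
        (continuousAt_dilL1 k (Real.sqrt_pos.2 (sub_pos.2 hθ.2))) h1
    exact ((convCLM n q).continuous.continuousAt.comp h2).continuousWithinAt

end Smoothness

/-! ### Smoothness of the solution and the differential equation. -/

section Equation

attribute [local instance] Matrix.normedAddCommGroup Matrix.normedSpace

variable {n : ℕ} {a : ℝ → Matrix (Fin n) (Fin n) ℝ} {q : ℝ≥0∞} [Fact (1 ≤ q)]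

/-- Cutting at `t / 2` separates the two obstacles: `f` may fail to be smooth at `0`, and the kernel
is singular at `s = t`. -/
theorem IsDiffusivity.contDiffOn_integral_heatOperator (ha : IsDiffusivity a) {f : ℝ → LqSpace n q}
    (hf_smooth : ContDiffOn ℝ ∞ f (Ioi 0)) (hf : ContinuousOn f (Ici 0)) :
    ContDiffOn ℝ ∞ (fun t => ∫ s in (0 : ℝ)..t, heatOperator a s t (f s)) (Ioi 0) := by
  intro t ht
  have hδ : 0 < t / 2 := half_pos ht
  have htδ : t ∈ Ioi (t / 2) := mem_Ioi.2 (half_lt_self ht)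
  have h := (ha.contDiffOn_integral_early hf hδ).add (ha.contDiffOn_integral_late hf_smooth hδ)
  refine ((h.congr fun τ hτ => ?_).contDiffAt (isOpen_Ioi.mem_nhds htδ)).contDiffWithinAt
  have hτ : t / 2 < τ := hτ
  have hi := ha.intervalIntegrable_heatOperator hf (hδ.trans hτ).le
  refine (intervalIntegral.integral_add_adjacent_intervals (hi.mono_set ?_) (hi.mono_set ?_)).symm
  · rw [uIcc_of_le hδ.le, uIcc_of_le (hδ.trans hτ).le]
    exact Icc_subset_Icc_right hτ.le
  · rw [uIcc_of_le hτ.le, uIcc_of_le (hδ.trans hτ).le]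
    exact Icc_subset_Icc_left hδ.le

theorem IsDiffusivity.contDiffOn_duhamel (ha : IsDiffusivity a) (u₀ : LqSpace n q)
    {f : ℝ → LqSpace n q} (hf_smooth : ContDiffOn ℝ ∞ f (Ioi 0)) (hf : ContinuousOn f (Ici 0)) :
    ContDiffOn ℝ ∞ (duhamel a u₀ f) (Ioi 0) :=
  (ha.contDiffOn_heatOperator_zero u₀).add (ha.contDiffOn_integral_heatOperator hf_smooth hf)

/-- The kernel's heat equation with the derivatives thrown onto `φ`. In this form nothing blows up
as `t` decreases to `s`. -/
theorem IsDiffusivity.hasDerivAt_testCLM (ha : IsDiffusivity a) {s t : ℝ} (hs : 0 ≤ s)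
    (hst : s < t) (φ : 𝓢(Eucl n, ℂ)) (v : LqSpace n q) :
    HasDerivAt (fun τ => testCLM q φ (heatOperator a s τ v))
      (testCLM q (secondOrderSchwartz (a t) φ) (heatOperator a s t v)) t := by
  have ht : 0 < t := hs.trans_lt hst
  have hN := ha.posDef_sub hs hst
  have h1 := hasDerivAt_heatL1_curve
    ((ha.hasDerivAt_cumulative ht).sub_const (cumulativeDiffusivity a s)) hN.mem_gaussDomain
    hN.isSymm
  have h2 := (kernelTestCLM φ v).hasFDerivAt.comp_hasDerivAt t h1
  rw [kernelTestCLM_apply, testCLM_convCLM_secondOrderSchwartz (ha.posDef t ht).isSymm,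
    schwartzKernel_heatSchwartz] at h2
  rw [ha.heatOperator_eq hs hst]
  refine h2.congr_of_eventuallyEq ?_
  filter_upwards [isOpen_Ioi.mem_nhds hst] with τ hτ
  rw [ha.heatOperator_eq hs hτ]
  rfl

/-- Weak convergence holds for every `q`; at `q = ∞` the integrability of `φ` reduces it to the
weak-* statement. -/
theorem IsDiffusivity.tendsto_testCLM (ha : IsDiffusivity a) {s : ℝ} (hs : 0 ≤ s)
    (φ : 𝓢(Eucl n, ℂ)) (v : LqSpace n q) :
    Tendsto (fun τ => testCLM q φ (heatOperator a s τ v)) (𝓝[>] s) (𝓝 (testCLM q φ v)) := by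
  have hk : IsApproximateIdentity (𝓝[>] s) fun t => heatKernelL1 a s t :=
    ha.isApproximateIdentity hs
      (tendsto_const_pure.mono_right (pure_le_nhdsWithin hs))
      (nhdsWithin_mono _ fun t ht => hs.trans (le_of_lt ht)) self_mem_nhdsWithin
  have heq : ∀ᶠ τ in 𝓝[>] s,
      testCLM q φ (convCLM n q (heatKernelL1 a s τ) v) = testCLM q φ (heatOperator a s τ v) := by
    filter_upwards [self_mem_nhdsWithin] with τ hτ
    rw [ha.heatOperator_eq hs hτ]
  refine Tendsto.congr' heq ?_
  by_cases hq : q = ⊤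
  · subst hq
    have hsymm : ∀ᶠ t in 𝓝[>] s, ∀ᵐ x, heatKernelL1 a s t (-x) = heatKernelL1 a s t x := by
      filter_upwards [self_mem_nhdsWithin] with t ht
      exact (ha.posDef_sub hs ht).heatL1_even
    have h := hk.tendsto_pairing hsymm v φ.integrable
    simp only [pairingCLM_apply] at h
    have e : ∀ w : LqSpace n ⊤, testCLM ⊤ φ w = ∫ x, w x * φ x := fun w => by
      rw [testCLM_eq_integral]
      exact integral_congr_ae (Eventually.of_forall fun x => mul_comm _ _)
    simp only [e]
    exact h
  · exact ((testCLM q φ).continuous.tendsto v).comp (hk.tendsto_convCLM hq v)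

theorem IsDiffusivity.exists_bound_testCLM (ha : IsDiffusivity a) (φ : 𝓢(Eucl n, ℂ)) (T : ℝ) :
    ∃ C, 0 ≤ C ∧ ∀ r ∈ Icc 0 T, ∀ w : LqSpace n q,
      ‖testCLM q (secondOrderSchwartz (a r) φ) w‖ ≤ C * ‖w‖ := by
  have hb : ∀ i j, ∃ M, ∀ r ∈ Icc 0 T, ‖a r i j‖ ≤ M := fun i j =>
    isCompact_Icc.exists_bound_of_continuousOn ((ha.continuousOn i j).mono fun r hr => hr.1)
  choose M hM using hb
  refine ⟨∑ i, ∑ j, |M i j| * ‖testCLM q (∂_{(EuclideanSpace.single j (1 : ℝ) : Eucl n)}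
        (∂_{(EuclideanSpace.single i (1 : ℝ) : Eucl n)} φ))‖, by positivity, fun r hr w => ?_⟩
  rw [testCLM_secondOrderSchwartz, Finset.sum_mul]
  refine norm_sum_le_of_le _ fun i _ => ?_
  rw [Finset.sum_mul]
  refine norm_sum_le_of_le _ fun j _ => ?_
  rw [norm_mul, Complex.norm_real, mul_assoc]
  exact mul_le_mul ((hM i j r hr).trans (le_abs_self _)) (ContinuousLinearMap.le_opNorm _ _)
    (norm_nonneg _) (abs_nonneg _)

/-- The mean value inequality for `σ > s`, then the limit `σ → s+`. The Lipschitz constant does not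
deteriorate near `s`, which the Duhamel difference quotients require. -/
theorem IsDiffusivity.norm_testCLM_sub_le (ha : IsDiffusivity a) {φ : 𝓢(Eucl n, ℂ)} {T C : ℝ}
    (hC : ∀ r ∈ Icc 0 T, ∀ w : LqSpace n q,
      ‖testCLM q (secondOrderSchwartz (a r) φ) w‖ ≤ C * ‖w‖) (hC0 : 0 ≤ C) {s σ τ : ℝ}
    (hs : 0 ≤ s) (hsσ : s ≤ σ) (hστ : σ ≤ τ) (hτ : τ ≤ T) (v : LqSpace n q) :
    ‖testCLM q φ (heatOperator a s τ v) - testCLM q φ (heatOperator a s σ v)‖ ≤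
      C * ‖v‖ * (τ - σ) := by
  have key : ∀ σ, s < σ → σ ≤ τ →
      ‖testCLM q φ (heatOperator a s τ v) - testCLM q φ (heatOperator a s σ v)‖ ≤
      C * ‖v‖ * (τ - σ) := by
    intro σ hsσ hστ
    have h := (convex_Icc σ τ).norm_image_sub_le_of_norm_hasDerivWithin_le (C := C * ‖v‖)
      (fun r hr => (ha.hasDerivAt_testCLM hs (hsσ.trans_le hr.1) φ v).hasDerivWithinAt)
      (fun r hr => (hC r ⟨hs.trans (hsσ.le.trans hr.1), hr.2.trans hτ⟩ _).trans
        (mul_le_mul_of_nonneg_left (ha.norm_heatOperator_le hs (hsσ.le.trans hr.1) v) hC0))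
      (left_mem_Icc.2 hστ) (right_mem_Icc.2 hστ)
    rwa [Real.norm_of_nonneg (sub_nonneg.2 hστ)] at h
  rcases hsσ.eq_or_lt with rfl | h
  · rcases hστ.eq_or_lt with rfl | hlt
    · simp
    rw [heatOperator_self]
    have h1 := ((tendsto_const_nhds (x := testCLM q φ (heatOperator a s τ v))).sub
      (ha.tendsto_testCLM hs φ v)).norm
    have h2 : Tendsto (fun σ : ℝ => C * ‖v‖ * (τ - σ)) (𝓝[>] s) (𝓝 (C * ‖v‖ * (τ - s))) :=
      (Continuous.tendsto (by fun_prop) s).mono_left nhdsWithin_le_nhds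
    refine le_of_tendsto_of_tendsto h1 h2 ?_
    filter_upwards [Ioo_mem_nhdsGT hlt] with σ hσ
    exact key σ hσ.1 hσ.2.le
  · exact key σ h hστ

/-- The weak right derivative of the Duhamel integral. -/
theorem IsDiffusivity.tendsto_slope_testCLM (ha : IsDiffusivity a) {f : ℝ → LqSpace n q}
    (hf : ContinuousOn f (Ici 0)) {t : ℝ} (ht : 0 < t) (φ : 𝓢(Eucl n, ℂ)) :
    Tendsto (slope (fun τ => testCLM q φ (∫ s in (0 : ℝ)..τ, heatOperator a s τ (f s))) t) (𝓝[>] t)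
      (𝓝 (testCLM q (secondOrderSchwartz (a t) φ) (∫ s in (0 : ℝ)..t, heatOperator a s t (f s)) +
        testCLM q φ (f t))) := by
  obtain ⟨C, hC0, hC⟩ := ha.exists_bound_testCLM (q := q) φ (t + 1)
  obtain ⟨B, hB⟩ := isCompact_Icc.exists_bound_of_continuousOn
    (hf.mono (fun r hr => hr.1 : Icc 0 (t + 1) ⊆ Ici 0))
  have hB0 : 0 ≤ B := (norm_nonneg _).trans (hB 0 ⟨le_rfl, by linarith⟩)
  let h : ℝ → ℝ → ℂ := fun s τ => testCLM q φ (heatOperator a s τ (f s))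
  have hTf : ContinuousOn (fun s => testCLM q φ (f s)) (Ici 0) :=
    (testCLM q φ).continuous.comp_continuousOn hf
  have hlip : ∀ s σ τ, 0 ≤ s → s ≤ σ → σ ≤ τ → τ ≤ t + 1 → ‖h s τ - h s σ‖ ≤ C * B * (τ - σ) := by
    intro s σ τ h1 h2 h3 h4
    refine (ha.norm_testCLM_sub_le hC hC0 h1 h2 h3 h4 (f s)).trans ?_
    have := hB s ⟨h1, by linarith⟩
    have h5 : 0 ≤ τ - σ := sub_nonneg.2 h3
    gcongr
  have hint : ∀ τ, 0 ≤ τ → IntervalIntegrable (fun s => h s τ) volume 0 τ := fun τ hτ =>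
    ⟨(testCLM q φ).integrable_comp (ha.intervalIntegrable_heatOperator hf hτ).1,
      (testCLM q φ).integrable_comp (ha.intervalIntegrable_heatOperator hf hτ).2⟩
  have hT : ∀ (ψ : 𝓢(Eucl n, ℂ)) (τ : ℝ), 0 ≤ τ →
      testCLM q ψ (∫ s in (0 : ℝ)..τ, heatOperator a s τ (f s)) =
        ∫ s in (0 : ℝ)..τ, testCLM q ψ (heatOperator a s τ (f s)) := fun ψ τ hτ =>
    ((testCLM q ψ).intervalIntegral_comp_comm (ha.intervalIntegrable_heatOperator hf hτ)).symm
  have hsubi : ∀ τ, t ≤ τ → IntervalIntegrable (fun s => h s τ) volume 0 t ∧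
      IntervalIntegrable (fun s => h s τ) volume t τ := by
    intro τ hτ
    have h1 := hint τ (ht.le.trans hτ)
    constructor
    · refine h1.mono_set ?_
      rw [uIcc_of_le ht.le, uIcc_of_le (ht.le.trans hτ)]
      exact Icc_subset_Icc_right hτ
    · refine h1.mono_set ?_
      rw [uIcc_of_le hτ, uIcc_of_le (ht.le.trans hτ)]
      exact Icc_subset_Icc_left ht.le
  have hfi : ∀ τ, t ≤ τ → IntervalIntegrable (fun s => testCLM q φ (f s)) volume t τ := by
    intro τ hτ
    refine (hTf.mono fun s hs => ?_).intervalIntegrable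
    rw [uIcc_of_le hτ] at hs
    exact ht.le.trans hs.1
  have hIoo : Ioo t (t + 1) ∈ 𝓝[>] t := Ioo_mem_nhdsGT (lt_add_one t)
  -- the part from sources before time `t`
  have lim1 : Tendsto (fun τ => ∫ s in (0 : ℝ)..t, (τ - t)⁻¹ • (h s τ - h s t)) (𝓝[>] t)
      (𝓝 (∫ s in (0 : ℝ)..t, testCLM q (secondOrderSchwartz (a t) φ) (heatOperator a s t (f s)))) := by
    -- The majorant `C * B` is the Lipschitz bound `hlip`, valid for all `s ≤ t`.
    refine intervalIntegral.tendsto_integral_filter_of_dominated_convergence (fun _ => C * B)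
      ?_ ?_ intervalIntegrable_const ?_
    · filter_upwards [hIoo] with τ hτ
      exact ((hsubi τ hτ.1.le).1.sub (hint t ht.le)).def'.aestronglyMeasurable.const_smul (τ - t)⁻¹
    · filter_upwards [hIoo] with τ hτ
      refine Eventually.of_forall fun s hs => ?_
      rw [uIoc_of_le ht.le] at hs
      have hpos : 0 < τ - t := sub_pos.2 hτ.1
      rw [norm_smul, norm_inv, Real.norm_of_nonneg hpos.le, inv_mul_le_iff₀ hpos, mul_comm]
      exact hlip s t τ hs.1.le hs.2 hτ.1.le hτ.2.le
    · filter_upwards [compl_mem_ae_iff.2 (measure_singleton (μ := (volume : Measure ℝ)) t)]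
        with s hne hs
      rw [uIoc_of_le ht.le] at hs
      have hst : s < t := lt_of_le_of_ne hs.2 hne
      exact (hasDerivAt_iff_tendsto_slope.1 (ha.hasDerivAt_testCLM hs.1.le hst φ (f s))).mono_left
        (nhdsWithin_mono _ fun τ hτ => ne_of_gt hτ)
  -- On `[t, τ]` the integrand is compared with its value `⟨f(s), φ⟩` at `τ = s`; this limit is the
  -- main term.
  have lim2 : Tendsto (fun τ => (τ - t)⁻¹ • ∫ s in t..τ, testCLM q φ (f s)) (𝓝[>] t)
      (𝓝 (testCLM q φ (f t))) := by
    have hc : ContinuousOn (fun s => testCLM q φ (f s)) (Ioi 0) := hTf.mono Ioi_subset_Ici_self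
    have hd := intervalIntegral.integral_hasDerivAt_right (hfi t le_rfl)
      (hc.stronglyMeasurableAtFilter isOpen_Ioi t ht) (hc.continuousAt (isOpen_Ioi.mem_nhds ht))
    have := (hasDerivAt_iff_tendsto_slope.1 hd).mono_left
      (nhdsWithin_mono _ fun τ (hτ : τ ∈ Ioi t) => ne_of_gt hτ)
    refine this.congr fun τ => ?_
    rw [slope_def_module, intervalIntegral.integral_same, sub_zero]
  -- The error of that comparison is at most `C B (τ - t)` pointwise, so its mean over `[t, τ]`
  -- tends to zero.
  have lim3 : Tendsto (fun τ => (τ - t)⁻¹ • ∫ s in t..τ, (h s τ - testCLM q φ (f s))) (𝓝[>] t)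
      (𝓝 0) := by
    have h0 : Tendsto (fun τ : ℝ => C * B * (τ - t)) (𝓝[>] t) (𝓝 0) := by
      have : Tendsto (fun τ : ℝ => C * B * (τ - t)) (𝓝 t) (𝓝 (C * B * (t - t))) :=
        Continuous.tendsto (by fun_prop) t
      rw [sub_self, mul_zero] at this
      exact this.mono_left nhdsWithin_le_nhds
    refine squeeze_zero_norm' ?_ h0
    filter_upwards [hIoo] with τ hτ
    have hpos : 0 < τ - t := sub_pos.2 hτ.1
    rw [norm_smul, norm_inv, Real.norm_of_nonneg hpos.le, inv_mul_le_iff₀ hpos, mul_comm]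
    have := intervalIntegral.norm_integral_le_of_norm_le_const (a := t) (b := τ)
      (f := fun s => h s τ - testCLM q φ (f s)) (C := C * B * (τ - t)) fun s hs => by
        rw [uIoc_of_le hτ.1.le] at hs
        have h1 := hlip s s τ (ht.trans hs.1).le le_rfl hs.2 hτ.2.le
        simp only [h, heatOperator_self] at h1 ⊢
        refine h1.trans ?_
        have := hs.1.le
        gcongr
    rwa [abs_of_pos hpos] at this
  have hsum := (lim1.add lim2).add lim3
  rw [add_zero, ← hT _ t ht.le] at hsum
  refine hsum.congr' ?_
  filter_upwards [hIoo] with τ hτ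
  rw [slope_def_module, hT φ τ (ht.trans hτ.1).le, hT φ t ht.le,
    ← intervalIntegral.integral_add_adjacent_intervals (hsubi τ hτ.1.le).1 (hsubi τ hτ.1.le).2,
    intervalIntegral.integral_smul,
    intervalIntegral.integral_sub (hsubi τ hτ.1.le).1 (hint t ht.le),
    intervalIntegral.integral_sub (hsubi τ hτ.1.le).2 (hfi τ hτ.1.le), ← smul_add, ← smul_add]
  congr 1
  simp only [h]
  ring

/-- The norm derivative exists by smoothness, so it suffices to identify it after testing, and for
the integral term a right-hand limit is enough. -/
theorem IsDiffusivity.solvesHeatEquation_duhamel (ha : IsDiffusivity a) (u₀ : LqSpace n q)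
    {f : ℝ → LqSpace n q} (hf_smooth : ContDiffOn ℝ ∞ f (Ioi 0)) (hf : ContinuousOn f (Ici 0)) :
    SolvesHeatEquation a f (duhamel a u₀ f) := by
  intro t ht
  have hd : ∀ {g : ℝ → LqSpace n q}, ContDiffOn ℝ ∞ g (Ioi 0) → HasDerivAt g (deriv g t) t :=
    fun hg => ((hg.contDiffAt (isOpen_Ioi.mem_nhds ht)).differentiableAt (by simp)).hasDerivAt
  have h1 := hd (ha.contDiffOn_heatOperator_zero u₀)
  have h2 := hd (ha.contDiffOn_integral_heatOperator hf_smooth hf)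
  refine ⟨_, h1.add h2, ?_⟩
  ext φ
  have e1 : testCLM q φ (deriv (fun t => heatOperator a 0 t u₀) t) =
      testCLM q (secondOrderSchwartz (a t) φ) (heatOperator a 0 t u₀) :=
    (((testCLM q φ).restrictScalars ℝ).hasFDerivAt.comp_hasDerivAt t h1).unique
      (ha.hasDerivAt_testCLM le_rfl ht φ u₀)
  have e2 := tendsto_nhds_unique ((hasDerivAt_iff_tendsto_slope.1
    (((testCLM q φ).restrictScalars ℝ).hasFDerivAt.comp_hasDerivAt t h2)).mono_left
      (nhdsWithin_mono _ fun τ (hτ : τ ∈ Ioi t) => ne_of_gt hτ))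
    (ha.tendsto_slope_testCLM hf ht φ)
  have hu : duhamel a u₀ f t =
    heatOperator a 0 t u₀ + ∫ s in (0 : ℝ)..t, heatOperator a s t (f s) := rfl
  have e3 : testCLM q φ (deriv (fun t => heatOperator a 0 t u₀) t +
      deriv (fun t => ∫ s in (0 : ℝ)..t, heatOperator a s t (f s)) t) =
      testCLM q (secondOrderSchwartz (a t) φ) (duhamel a u₀ f t) + testCLM q φ (f t) := by
    rw [hu, map_add, map_add, e1, add_assoc]
    congr 1
  have e4 : secondOrderOperator (a t) (Lp.toTemperedDistribution (duhamel a u₀ f t)) φ =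
      testCLM q (secondOrderSchwartz (a t) φ) (duhamel a u₀ f t) := secondOrderOperator_apply _ _ _
  rw [testCLM_apply] at e3
  refine Eq.trans (b := _ - _) ?_ (sub_eq_of_eq_add' e3)
  rw [← e4]
  rfl

theorem IsDiffusivity.continuousOn_duhamel (ha : IsDiffusivity a) (hq : q ≠ ⊤) (u₀ : LqSpace n q)
    {f : ℝ → LqSpace n q} (hf_smooth : ContDiffOn ℝ ∞ f (Ioi 0)) (hf : ContinuousOn f (Ici 0)) :
    ContinuousOn (duhamel a u₀ f) (Ici 0) := by
  intro t ht
  rcases (mem_Ici.1 ht).eq_or_lt with rfl | ht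
  · rw [← continuousWithinAt_Ioi_iff_Ici, ContinuousWithinAt, duhamel_zero]
    exact ha.tendsto_duhamel hq u₀ hf
  · exact ((ha.contDiffOn_duhamel u₀ hf_smooth hf).continuousOn.continuousAt
      (isOpen_Ioi.mem_nhds ht)).continuousWithinAt

end Equation

/-! ### Uniqueness by backward propagation of a homogeneous solution. -/

section Uniqueness

attribute [local instance] Matrix.normedAddCommGroup Matrix.normedSpace

variable {n : ℕ} {a : ℝ → Matrix (Fin n) (Fin n) ℝ} {q : ℝ≥0∞} [Fact (1 ≤ q)]

theorem schwartzKernel_secondOrderSchwartz_neg (b : Matrix (Fin n) (Fin n) ℝ) (g : 𝓢(Eucl n, ℂ)) :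
    schwartzKernel (secondOrderSchwartz (-b) g) = -schwartzKernel (secondOrderSchwartz b g) := by
  simp only [schwartzKernel_secondOrderSchwartz, Matrix.neg_apply, neg_smul, Finset.sum_neg_distrib]

/-- Along a solution `w` of the homogeneous equation, `W_{t,T} w(t)` is stationary. -/
theorem IsDiffusivity.hasDerivAt_convCLM_solution (ha : IsDiffusivity a) {t T : ℝ} (ht : 0 < t)
    (htT : t < T) {w : ℝ → LqSpace n q} {w' : LqSpace n q} (hw : HasDerivAt w w' t)
    (heq : Lp.toTemperedDistribution w' =
      secondOrderOperator (a t) (Lp.toTemperedDistribution (w t))) :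
    HasDerivAt (fun τ => convCLM n q (heatKernelL1 a τ T) (w τ)) 0 t := by
  have hN := ha.posDef_sub ht.le htT
  have h1 : HasDerivAt (fun τ => heatKernelL1 a τ T) _ t := hasDerivAt_heatL1_curve
    ((ha.hasDerivAt_cumulative ht).const_sub (cumulativeDiffusivity a T)) hN.mem_gaussDomain
    hN.isSymm
  have h2 := ((convCLM n q).hasFDerivAt.comp_hasDerivAt t h1).clm_apply hw
  refine h2.congr_deriv ?_
  -- The kernel is Schwartz, so the distributional equation for `w` turns `k ∗ w'` into `(ℒ_t k) ∗
  -- w`, which cancels the derivative of the kernel in its initial time.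
  have h3 := convCLM_eq_of_secondOrderOperator (a t) (heatSchwartz _ hN.mem_gaussDomain) heq
  rw [schwartzKernel_heatSchwartz] at h3
  rw [schwartzKernel_secondOrderSchwartz_neg, map_neg, neg_apply, ← h3]
  exact neg_add_cancel _

theorem IsDiffusivity.tendsto_convCLM_left (ha : IsDiffusivity a) (hq : q ≠ ⊤) {T : ℝ} (hT : 0 < T)
    {w : ℝ → LqSpace n q} (hw : ContinuousAt w T) :
    Tendsto (fun t => convCLM n q (heatKernelL1 a t T) (w t)) (𝓝[<] T) (𝓝 (w T)) := by
  have hIoo : Ioo 0 T ∈ 𝓝[<] T := Ioo_mem_nhdsLT hT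
  have hk : IsApproximateIdentity (𝓝[<] T) fun t => heatKernelL1 a t T :=
    ha.isApproximateIdentity (s := fun t => t) hT.le
      (tendsto_nhdsWithin_iff.2 ⟨nhdsWithin_le_nhds, by
        filter_upwards [hIoo] with t ht using ht.1.le⟩)
      (tendsto_const_pure.mono_right (pure_le_nhdsWithin hT.le)) self_mem_nhdsWithin
  have h1 := hk.tendsto_convCLM hq (w T)
  have h2 : Tendsto (fun t => convCLM n q (heatKernelL1 a t T) (w t - w T)) (𝓝[<] T) (𝓝 0) := by
    refine squeeze_zero_norm' ?_ ((tendsto_iff_norm_sub_tendsto_zero.1 hw.tendsto).mono_left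
      nhdsWithin_le_nhds)
    filter_upwards [hIoo] with t ht
    rw [← ha.heatOperator_eq ht.1.le ht.2]
    exact ha.norm_heatOperator_le ht.1.le ht.2.le _
  have h3 := h2.add h1
  rw [zero_add] at h3
  refine h3.congr fun t => ?_
  rw [map_sub, sub_add_cancel]

/-- `W_{t,T} w(t)` has zero derivative on `(0, T)`. It tends to `0` as `t → 0+` by contractivity and
to `w(T)` as `t → T-`, so the two limits agree. -/
theorem IsDiffusivity.eq_zero_of_solution (ha : IsDiffusivity a) (hq : q ≠ ⊤)
    {w : ℝ → LqSpace n q} (hw : ∀ t, 0 < t → ∃ w', HasDerivAt w w' t ∧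
      Lp.toTemperedDistribution w' = secondOrderOperator (a t) (Lp.toTemperedDistribution (w t)))
    (hw0 : Tendsto w (𝓝[>] 0) (𝓝 0)) {T : ℝ} (hT : 0 < T) : w T = 0 := by
  let h : ℝ → LqSpace n q := fun t => convCLM n q (heatKernelL1 a t T) (w t)
  have hconst : ∀ s ∈ Ioo 0 T, ∀ t ∈ Ioo 0 T, h t = h s := by
    intro s hs t ht
    have := (convex_Ioo 0 T).norm_image_sub_le_of_norm_hasDerivWithin_le (f := h)
      (f' := fun _ => 0) (C := 0) (fun r hr => by
        obtain ⟨w', h1, h2⟩ := hw r hr.1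
        exact (ha.hasDerivAt_convCLM_solution hr.1 hr.2 h1 h2).hasDerivWithinAt)
      (fun r _ => by simp) hs ht
    rw [zero_mul] at this
    exact sub_eq_zero.1 (norm_le_zero_iff.1 this)
  have hh0 : Tendsto h (𝓝[>] 0) (𝓝 0) := by
    refine squeeze_zero_norm' ?_ (tendsto_zero_iff_norm_tendsto_zero.1 hw0)
    filter_upwards [Ioo_mem_nhdsGT hT] with t ht
    simp only [h]
    rw [← ha.heatOperator_eq ht.1.le ht.2]
    exact ha.norm_heatOperator_le ht.1.le ht.2.le _
  have hzero : ∀ s ∈ Ioo 0 T, h s = 0 := by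
    intro s hs
    refine tendsto_nhds_unique (tendsto_const_nhds (f := 𝓝[>] (0 : ℝ))) (hh0.congr' ?_)
    filter_upwards [Ioo_mem_nhdsGT hT] with t ht using hconst s hs t ht
  obtain ⟨w', hwT, -⟩ := hw T hT
  refine tendsto_nhds_unique (ha.tendsto_convCLM_left hq hT hwT.continuousAt)
    (tendsto_const_nhds.congr' ?_)
  filter_upwards [Ioo_mem_nhdsLT hT] with t ht using (hzero t ht).symm

theorem IsDiffusivity.eq_of_solvesCauchyProblem (ha : IsDiffusivity a) (hq : q ≠ ⊤)
    {u₀ : LqSpace n q} {f u v : ℝ → LqSpace n q} (hu : SolvesCauchyProblem a u₀ f u)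
    (hv : SolvesCauchyProblem a u₀ f v) {t : ℝ} (ht : 0 < t) : v t = u t := by
  refine sub_eq_zero.1 (ha.eq_zero_of_solution hq (w := fun t => v t - u t) (fun t ht => ?_) ?_ ht)
  · obtain ⟨v', h1, h2⟩ := hv.1 t ht
    obtain ⟨u', h3, h4⟩ := hu.1 t ht
    refine ⟨v' - u', h1.sub h3, ?_⟩
    ext φ
    rw [secondOrderOperator_apply]
    have e : ∀ {x' x : LqSpace n q}, Lp.toTemperedDistribution x' -
        secondOrderOperator (a t) (Lp.toTemperedDistribution x) = Lp.toTemperedDistribution (f t) →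
        testCLM q φ x' - testCLM q (secondOrderSchwartz (a t) φ) x = testCLM q φ (f t) := by
      intro x' x hx
      have := congrArg (fun S : 𝓢'(Eucl n, ℂ) => S φ) hx
      simp only [testCLM_apply, ← secondOrderOperator_apply]
      exact this
    rw [← testCLM_apply, ← testCLM_apply, map_sub, map_sub]
    linear_combination e h2 - e h4
  · simpa using hv.2.sub hu.2

end Uniqueness

/-! ### Assembly of the statements. -/

theorem mainTheorem5 {n : ℕ} (hn : 1 ≤ n) (a : ℝ → Matrix (Fin n) (Fin n) ℝ)
    (ha : IsDiffusivity a) (q : ℝ≥0∞) [Fact (1 ≤ q)]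
    (u₀ : Lp ℂ q (volume : Measure (EuclideanSpace ℝ (Fin n))))
    (f : ℝ → Lp ℂ q (volume : Measure (EuclideanSpace ℝ (Fin n))))
    (hf_smooth : ContDiffOn ℝ ∞ f (Ioi 0)) (hf_cont : ContinuousOn f (Ici 0)) :
    -- the Duhamel formula is meaningful: the convolutions lie in `L^q`, the integral converges
    (∀ s t : ℝ, 0 ≤ s → s < t →
      ∀ v : Lp ℂ q (volume : Measure (EuclideanSpace ℝ (Fin n))),
        (∀ x, Integrable (fun y => (heatKernel a s t (x - y) : ℂ) * v y)) ∧
          MemLp (heatConvolution a s t v) q volume) ∧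
    (∀ t : ℝ, 0 ≤ t →
      IntervalIntegrable (fun s => heatOperator a s t (f s)) volume 0 t) ∧
    -- smoothness and the equation for positive times
    ContDiffOn ℝ ∞ (duhamel a u₀ f) (Ioi 0) ∧
    SolvesHeatEquation a f (duhamel a u₀ f) ∧
    -- the initial condition and continuity up to `t = 0`
    (q ≠ ⊤ → SolvesCauchyProblem a u₀ f (duhamel a u₀ f) ∧
      ContinuousOn (duhamel a u₀ f) (Ici 0)) ∧
    (q = ⊤ → ∀ φ : EuclideanSpace ℝ (Fin n) → ℂ, Integrable φ →
      Tendsto (fun t => ∫ x, duhamel a u₀ f t x * φ x) (𝓝[>] 0) (𝓝 (∫ x, u₀ x * φ x))) ∧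
    -- the norm estimate
    (∀ t : ℝ, 0 ≤ t → ‖duhamel a u₀ f t‖ ≤ ‖u₀‖ + ∫ s in (0 : ℝ)..t, ‖f s‖) ∧
    -- uniqueness
    (1 < q → q ≠ ⊤ →
      ∀ v : ℝ → Lp ℂ q (volume : Measure (EuclideanSpace ℝ (Fin n))),
        SolvesCauchyProblem a u₀ f v → ∀ t : ℝ, 0 < t → v t = duhamel a u₀ f t) ∧
    -- positivity
    (IsNonnegLp u₀ → (∀ t : ℝ, 0 < t → IsNonnegLp (f t)) →
      ∀ t : ℝ, 0 ≤ t → IsNonnegLp (duhamel a u₀ f t)) := by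
  have heq := ha.solvesHeatEquation_duhamel u₀ hf_smooth hf_cont
  have hcauchy : q ≠ ⊤ → SolvesCauchyProblem a u₀ f (duhamel a u₀ f) := fun hq =>
    ⟨heq, ha.tendsto_duhamel hq u₀ hf_cont⟩
  refine ⟨fun s t hs hst v => ⟨ha.integrable_heatKernel_mul hs hst v,
    ha.memLp_heatConvolution hs hst v⟩, fun t ht => ha.intervalIntegrable_heatOperator hf_cont ht,
    ha.contDiffOn_duhamel u₀ hf_smooth hf_cont, heq,
    fun hq => ⟨hcauchy hq, ha.continuousOn_duhamel hq u₀ hf_smooth hf_cont⟩, ?_,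
    fun t ht => ha.norm_duhamel_le u₀ hf_cont ht,
    fun _ hq v hv t ht => ha.eq_of_solvesCauchyProblem hq (hcauchy hq) hv ht, fun hu hf t ht => ?_⟩
  · rintro rfl φ hφ
    exact ha.tendsto_duhamel_top u₀ hf_cont hφ
  · rw [isNonnegLp_iff] at hu ⊢
    exact ha.duhamel_nonneg hu (fun s hs => (isNonnegLp_iff _).1 (hf s hs)) ht
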